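/- **Setting.** Let $d\in\{2,3\}$, let $\Omega\subset\mathbb R^d$ be a bounded connected open set with Lipschitz boundary and unit outward normal $\mathbf n$, and let $\mathcal T_h$ be a conforming mesh of $\Omega$ whose elements $K$ (closed) are simplices or rectangles/cuboids. Write $h_K$ for the diameter of $K$, $\kappa_K=|K|/h_K^d$ for its shape-regularity parameter, $\mathcal F^e_h$ for the set of boundary facets, $K_F$ for the element that has $F\in\mathcal F_h^e$ as a facet, and $h_{\perp F}$ for the length of the altitude of $K_F$ over $F$. Let $N(K)$ be the set of elements $K'$ with $\dim_H(\partial K'\cap\partial K)=d-1$. *Coefficients.* Let $G\ge1$, $\widehat N\ge1$; all unknowns are indexed by $(g,i)\in\{1,\dots,G\}\times\{1,\dots,\widehat N\}$. Put $\alpha_0=1$, $\alpha_{m+1}=\frac{4(m+1)^2-1}{(m+1)\alpha_m}$, $t_m=\frac{\alpha_m^2}{2m+1}$. Given total cross sections $\Sigma_t^g$ and scattering moments $\Sigma_{s,m}^{g'\to g}$ ($0\le m\le 2\widehat N-1$) on $\Omega$, let $\Sigma_{r,m}^g=\Sigma_t^g-\Sigma_{s,m}^{g\to g}$. The matrix $\mathbb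 T_e$ has $(g,g')$ block $\mathrm{diag}(t_m\Sigma_{r,m}^g)$ if $g=g'$ and $-\mathrm{diag}(t_m\Sigma_{s,m}^{g'\to g})$ if $g\ne g'$, with $m=0,2,\dots,2\widehat N-2$; $\mathbb T_o$ is defined in the same way with $m=1,3,\dots,2\widehat N-1$. The matrix $\mathbb H$ is block diagonal over $g$ with blocks $\delta_{i,j}+\delta_{i,j-1}$, $\Gamma_e$ is block diagonal over $g$ with blocks $\alpha_{2(i-1)}\alpha_{2(j-1)}\int_0^1xP_{2(i-1)}(x)P_{2(j-1)}(x)\,dx$ ($P_m$ the Legendre polynomials), and $\tilde\Gamma_e=\mathbb H\Gamma_e^{-1}\mathbb H^T$. Assume: (i) for the even moments, and likewise for the odd ones, the functions $t_m\Sigma_{r,m}^g$ lie a.e. between two positive constants; (ii) there is $\varepsilon>0$ with $\varepsilon(G-1)<1$ and $|\Sigma_{s,m}^{g\to g'}|\le\varepsilon\Sigma_{r,m}^g$ a.e. for $g'\ne g$ and all $m$; (iii) $\mathbb T_o^{-1}$ and $\mathbb T_e$ are uniformly positive definite and uniformly bounded a.e. in $\Omega$. Let $\delta_e,\delta_o$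 be the diagonal parts of $\mathbb T_e,\mathbb T_o$, and $\delta^{max}_{e,K},\delta^{min}_{e,K}$ (resp. $\delta^{max}_{o,K},\delta^{min}_{o,K}$) the largest and smallest values on $K$ of their diagonal entries. *Problem.* Let $\mathbf Q(\Omega)=\{\mathbf q\in\mathbf H(\mathrm{div};\Omega):\mathbf q\cdot\mathbf n\in L^2(\partial\Omega)\}$ and let $X$ be the set of pairs $(\mathbf q,\psi)$ with $\mathbf q\in\mathbf Q(\Omega)^{\widehat N\times G}$, $\psi\in L^2(\Omega)^{\widehat N\times G}$. For $\zeta=(\mathbf p,\phi)$, $\xi=(\mathbf q,\psi)$ in $X$ set $$c(\zeta,\xi)=-(\mathbb T_o\mathbf p,\mathbf q)_{0,\Omega}+(\phi,\mathbb H^T\mathrm{div}\,\mathbf q)_{0,\Omega}+(\psi,\mathbb H^T\mathrm{div}\,\mathbf p)_{0,\Omega}+(\mathbb T_e\phi,\psi)_{0,\Omega}-(\tilde\Gamma_e(\mathbf p\cdot\mathbf n),\mathbf q\cdot\mathbf n)_{0,\partial\Omega},$$ and $d(\zeta,(\mathbf q,\psi))=c(\zeta,(-\mathbf q,\psi))$.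 Let $\zeta=(\mathbf p,\phi)\in X$ satisfy $c(\zeta,\xi)=(S_f,\psi)_{0,\Omega}$ for all $\xi=(\mathbf q,\psi)\in X$, and let $\zeta_h=(\mathbf p_h,\phi_h)\in X_h$ satisfy the same identity for all $\xi\in X_h$, where $X_h\subset X$ is the Raviart–Thomas–Nédélec space $\mathrm{RTN}_k$ of order $k\ge0$ (scalar part $L_h$: $\mathbb P_k$ on simplices, $\mathbb Q_k$ on rectangles/cuboids). Let $\tilde\zeta_h=(\mathbf p_h,\tilde\phi_h)$ with $\tilde\phi_h\in H^1(\Omega)^{\widehat N\times G}$. *Norms and estimators.* For $\xi=(\mathbf q,\psi)\in X$ let $$\|\xi\|_S^2=(\delta_o\mathbf q,\mathbf q)_{0,\Omega}+(\delta_e\psi,\psi)_{0,\Omega}+\sum_{K}\delta^{max}_{o,K}h_K^2\|\mathrm{div}\,\mathbf q\|_{0,K}^2+\sum_{F\in\mathcal F^e_h}\delta^{max}_{o,K_F}h_{\perp F}\|\tilde\Gamma_e^{1/2}(\mathbf q\cdot\mathbf n)\|_{0,F}^2 .$$ Let $X_K$ be the set of $\xi=(\mathbf q,\psi)\in X$ with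 $\mathrm{Supp}(\psi)\subset K$ and $\mathrm{Supp}(\mathbf q)\subset\bigcup_{K'\in N(K)}K'$, and let $|\zeta|_{+,K}=\sup\{d(\zeta,\xi):\xi\in X_K,\ \|\xi\|_S\le1\}$. Let $$\eta_{r,K}=\|\delta_e^{-1/2}(S_f-\mathbb H^T\mathrm{div}\,\mathbf p_h-\mathbb T_e\tilde\phi_h)\|_{0,K},\qquad \eta_{f,K}=\|\delta_o^{-1/2}(\mathbb T_o\mathbf p_h+\mathbb H\,\mathbf{grad}\,\tilde\phi_h)\|_{0,K},$$ $$\eta_{bc,F}=(\delta^{max}_{o,K_F}h_{\perp F})^{-1/2}\|\tilde\Gamma_e^{-1/2}(\mathbb H\tilde\phi_h-\tilde\Gamma_e(\mathbf p_h\cdot\mathbf n))\|_{0,F}.$$ **Theorem (efficiency).** Assume in addition that the entries of $\mathbb T_o$ and $\mathbb T_e$ and the components of $\tilde\phi_h$ are piecewise polynomial on $\mathcal T_h$, of degree at most $m_o$, $m_e$ and $m_\phi$ respectively, and that the components of $S_f$ lie in $L_h$. Then for every $K\in\mathcal T_h$ and every $F\in\mathcal F_h^e$ $$\eta_{r,K}\le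 \mathtt c\Big(\frac{\delta^{max}_{e,K}}{\delta^{min}_{e,K}}\Big)^{1/2}|\zeta-\tilde\zeta_h|_{+,K},\qquad \eta_{f,K}\le \mathtt C\Big(\frac{\delta^{max}_{o,K}}{\delta^{min}_{o,K}}\Big)^{1/2}|\zeta-\tilde\zeta_h|_{+,K},\qquad \eta_{bc,F}\le \mathsf C\,|\zeta-\tilde\zeta_h|_{+,K_F}.$$ Here $\mathtt c$ and $\mathtt C$ depend only on $k,m_o,m_e,m_\phi$, $d$ and a positive lower bound for $\kappa_K$; the constant $\mathsf C$ depends only on the same quantities (with $\kappa_{K_F}$ in place of $\kappa_K$) and on $\widehat N$, through the fixed matrix $\tilde\Gamma_e$. -/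

import Mathlib

open MeasureTheory Set Filter Topology
open scoped ENNReal NNReal Matrix ContDiff

noncomputable section

namespace SPN

/-! ### Euclidean space, domains, measures -/

/-- The Euclidean space of dimension `d`. -/
abbrev E (d : ℕ) := EuclideanSpace ℝ (Fin d)

/-- Surface measure on the boundary of `Ω`: the `(d-1)`-dimensional Hausdorff measure, normalised so
that it is Lebesgue measure on hyperplanes. -/
def surf {d : ℕ} (Ω : Set (E d)) : Measure (E d) :=
  (Measure.euclideanHausdorffMeasure (d - 1)).restrict (frontier Ω)

/-- Bounded connected open sets with Lipschitz boundary: near every boundary point the set is, for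
some unit direction `ν`, the strict subgraph of a Lipschitz function over the hyperplane
orthogonal to `ν`. -/
structure IsLipschitzDomain {d : ℕ} (Ω : Set (E d)) : Prop where
  isOpen : IsOpen Ω
  isBounded : Bornology.IsBounded Ω
  isConnected : IsConnected Ω
  lipschitz_boundary : ∀ x ∈ frontier Ω, ∃ (ν : E d) (r : ℝ) (L : ℝ≥0) (γ : E d → ℝ),
    ‖ν‖ = 1 ∧ 0 < r ∧ LipschitzWith L γ ∧
      ∀ y ∈ Metric.ball x r, y ∈ Ω ↔ inner ℝ ν y < γ (y - inner ℝ ν y • ν)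

/-! ### The function spaces `Q(Ω)` and `H¹(Ω)` -/

/-- A vector field together with its divergence and its normal trace on the boundary. -/
structure FluxField (d : ℕ) where
  val : E d → E d
  dv : E d → ℝ
  ntr : E d → ℝ

instance {d : ℕ} : Sub (FluxField d) :=
  ⟨fun p q => ⟨p.val - q.val, p.dv - q.dv, p.ntr - q.ntr⟩⟩

/-- `q ∈ Q(Ω)`: the field `q` is in `L²(Ω)`, its weak divergence `q.dv` is in `L²(Ω)`, and its normal
trace `q.ntr` is in `L²(∂Ω)`. Divergence and normal trace are characterised by Green's formula
against smooth functions (`Ω` is bounded, so no support condition is needed; the test functions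
supported in `Ω` say that `q.dv` is the weak divergence). -/
structure MemQ {d : ℕ} (Ω : Set (E d)) (q : FluxField d) : Prop where
  val_memLp : MemLp q.val 2 (volume.restrict Ω)
  dv_memLp : MemLp q.dv 2 (volume.restrict Ω)
  ntr_memLp : MemLp q.ntr 2 (surf Ω)
  green : ∀ f : E d → ℝ, ContDiff ℝ ∞ f →
    ∫ x in Ω, (inner ℝ (q.val x) (gradient f x) + q.dv x * f x) = ∫ x, q.ntr x * f x ∂(surf Ω)

/-- A scalar function together with its gradient and its trace on the boundary. -/
structure ScalarField (d : ℕ) where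
  val : E d → ℝ
  grad : E d → E d
  tr : E d → ℝ

/-- `u ∈ H¹(Ω)`, with weak gradient `u.grad` and with trace `u.tr`. The trace operator is the continuous
extension of the restriction to the boundary, from functions smooth up to the boundary. -/
structure MemH1 {d : ℕ} (Ω : Set (E d)) (u : ScalarField d) : Prop where
  val_memLp : MemLp u.val 2 (volume.restrict Ω)
  grad_memLp : MemLp u.grad 2 (volume.restrict Ω)
  tr_memLp : MemLp u.tr 2 (surf Ω)
  weak_grad : ∀ f : E d → ℝ, ContDiff ℝ ∞ f → HasCompactSupport f → tsupport f ⊆ Ω →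
    ∫ x in Ω, u.val x • gradient f x = -∫ x in Ω, f x • u.grad x
  trace : ∃ s : ℕ → E d → ℝ, (∀ n, ContDiff ℝ ∞ (s n)) ∧
    Tendsto (fun n => eLpNorm (s n - u.val) 2 (volume.restrict Ω)) atTop (𝓝 0) ∧
    Tendsto (fun n => eLpNorm (gradient (s n) - u.grad) 2 (volume.restrict Ω)) atTop (𝓝 0) ∧
    Tendsto (fun n => eLpNorm (s n - u.tr) 2 (surf Ω)) atTop (𝓝 0)

/-! ### Mesh elements and meshes -/

/-- A mesh element: a nondegenerate simplex given by its vertices, or a rectangle / cuboid given by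
a corner `a`, an orthonormal frame `b` along its edges, and its edge lengths `ℓ`. -/
inductive Element (d : ℕ) : Type
  | simplex (v : Fin (d + 1) → E d) (hv : AffineIndependent ℝ v) : Element d
  | cuboid (a : E d) (b : OrthonormalBasis (Fin d) ℝ (E d)) (ℓ : Fin d → ℝ)
      (hℓ : ∀ i, 0 < ℓ i) : Element d

namespace Element

variable {d : ℕ}

/-- The closed point set of a mesh element. -/
def carrier : Element d → Set (E d)
  | simplex v _ => convexHull ℝ (range v)
  | cuboid a b ℓ _ => {x | ∀ i, inner ℝ (b i) (x - a) ∈ Icc 0 (ℓ i)}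

/-- Labels of the facets: for a simplex the opposite vertex; for a cuboid a coordinate direction
and one of the two sides. -/
def FacetIdx : Element d → Type
  | simplex _ _ => Fin (d + 1)
  | cuboid _ _ _ _ => Fin d × Bool

instance : (K : Element d) → Fintype K.FacetIdx
  | simplex _ _ => inferInstanceAs (Fintype (Fin (d + 1)))
  | cuboid _ _ _ _ => inferInstanceAs (Fintype (Fin d × Bool))

/-- The closed facet with a given label. -/
def facet : (K : Element d) → K.FacetIdx → Set (E d)
  | simplex v _, i => convexHull ℝ (v '' {i}ᶜ)
  | cuboid a b ℓ hℓ, (i, s) =>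
      {x ∈ (cuboid a b ℓ hℓ).carrier | inner ℝ (b i) (x - a) = if s then ℓ i else 0}

/-- The length `h_⊥F` of the altitude of the element over a facet. -/
def altitude : (K : Element d) → K.FacetIdx → ℝ
  | simplex v _, i => Metric.infDist (v i) (affineSpan ℝ (v '' {i}ᶜ) : Set (E d))
  | cuboid _ _ ℓ _, (i, _) => ℓ i

/-- The diameter `h_K`. -/
def diam (K : Element d) : ℝ := Metric.diam K.carrier

/-- The shape-regularity parameter `κ_K = |K| / h_K ^ d`. -/
def shapeReg (K : Element d) : ℝ := volume.real K.carrier / K.diam ^ d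

/-- `f` coincides (almost everywhere) on `K` with a polynomial of total degree at most `m`. -/
def IsPoly (K : Element d) (m : ℕ) (f : E d → ℝ) : Prop :=
  ∃ P : MvPolynomial (Fin d) ℝ, P.totalDegree ≤ m ∧
    ∀ᵐ x ∂(volume.restrict K.carrier), f x = MvPolynomial.eval (fun i => x i) P

/-- Local scalar space of order `k`: `ℙ_k(K)` on a simplex, and `ℚ_k(K)` (degree at most `k` in each
of the coordinates along the edges) on a cuboid. -/
def MemL : Element d → ℕ → (E d → ℝ) → Prop
  | K@(simplex _ _), k, f => K.IsPoly k f
  | K@(cuboid a b _ _), k, f =>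
      ∃ P : MvPolynomial (Fin d) ℝ, (∀ i, P.degreeOf i ≤ k) ∧
        ∀ᵐ x ∂(volume.restrict K.carrier),
          f x = MvPolynomial.eval (fun i => inner ℝ (b i) (x - a)) P

/-- Local Raviart-Thomas-Nédélec space of order `k`: fields `A + B x`, with `A ∈ ℙ_k(K)^d` and
`B ∈ ℙ_k(K)`, on a simplex; on a cuboid, fields whose component along the `i`-th edge has degree at most
`k + 1` in the `i`-th coordinate and at most `k` in each of the other ones. -/
def MemRTN : Element d → ℕ → (E d → E d) → Prop
  | K@(simplex _ _), k, q =>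
      ∃ (A : Fin d → MvPolynomial (Fin d) ℝ) (B : MvPolynomial (Fin d) ℝ),
        (∀ i, (A i).totalDegree ≤ k) ∧ B.totalDegree ≤ k ∧
        ∀ᵐ x ∂(volume.restrict K.carrier), ∀ i, q x i =
          MvPolynomial.eval (fun j => x j) (A i) + MvPolynomial.eval (fun j => x j) B * x i
  | K@(cuboid a b _ _), k, q =>
      ∃ A : Fin d → MvPolynomial (Fin d) ℝ,
        (∀ i j, (A i).degreeOf j ≤ if i = j then k + 1 else k) ∧
        ∀ᵐ x ∂(volume.restrict K.carrier), ∀ i, inner ℝ (b i) (q x) =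
          MvPolynomial.eval (fun j => inner ℝ (b j) (x - a)) (A i)

end Element

/-- A conforming mesh of `Ω` by simplices and cuboids: the elements cover the closure of `Ω`, their
interiors are disjoint, and any two distinct elements meet in a common (possibly empty) face. -/
structure Mesh {d : ℕ} (Ω : Set (E d)) where
  card : ℕ
  elt : Fin card → Element d
  cover : ⋃ K, (elt K).carrier = closure Ω
  disjoint : ∀ K K', K ≠ K' → Disjoint (interior (elt K).carrier) (interior (elt K').carrier)
  conforming : ∀ K K', K ≠ K' →
    IsExposed ℝ (elt K).carrier ((elt K).carrier ∩ (elt K').carrier)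

namespace Mesh

variable {d : ℕ} {Ω : Set (E d)} (T : Mesh Ω)

/-- `F` is a boundary facet of the element `K`. -/
def IsBoundaryFacet (K : Fin T.card) (F : (T.elt K).FacetIdx) : Prop :=
  (T.elt K).facet F ⊆ frontier Ω

/-- The neighbourhood `N(K)`: the elements whose boundary meets that of `K` in a set of Hausdorff
dimension `d - 1` (in particular `K` itself). -/
def nbhd (K : Fin T.card) : Set (Fin T.card) :=
  {K' | dimH (frontier (T.elt K').carrier ∩ frontier (T.elt K).carrier) = ((d - 1 : ℕ) : ℝ≥0∞)}

end Mesh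

/-! ### The multigroup SP_N model -/

/-- Indices (energy group, moment). The `i`-th even (odd) moment has order `2 i` (`2 i + 1`). -/
abbrev Idx (G Nh : ℕ) := Fin G × Fin Nh

/-- `α₀ = 1`, `α_{m+1} = (4 (m+1)² - 1) / ((m+1) α_m)`. -/
def alpha : ℕ → ℝ
  | 0 => 1
  | m + 1 => (4 * ((m : ℝ) + 1) ^ 2 - 1) / (((m : ℝ) + 1) * alpha m)

/-- `t_m = α_m² / (2m+1)`. -/
def tcoef (m : ℕ) : ℝ := alpha m ^ 2 / (2 * (m : ℝ) + 1)

/-- Legendre polynomials, by Bonnet's recursion. -/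
def legendre : ℕ → ℝ → ℝ
  | 0, _ => 1
  | 1, x => x
  | m + 2, x => ((2 * (m : ℝ) + 3) * x * legendre (m + 1) x - ((m : ℝ) + 1) * legendre m x) /
      ((m : ℝ) + 2)

/-- The matrix `ℍ`: block diagonal over the groups, with blocks `δ_{i,j} + δ_{i,j-1}`. -/
def matH (G Nh : ℕ) : Matrix (Idx G Nh) (Idx G Nh) ℝ := fun a b =>
  if a.1 = b.1 then
    (if a.2 = b.2 then 1 else 0) + (if (b.2 : ℕ) = (a.2 : ℕ) + 1 then 1 else 0)
  else 0

/-- The matrix `Γ_e` of the vacuum boundary condition. -/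
def matGamma (G Nh : ℕ) : Matrix (Idx G Nh) (Idx G Nh) ℝ := fun a b =>
  if a.1 = b.1 then
    alpha (2 * a.2) * alpha (2 * b.2) *
      ∫ x in (0 : ℝ)..1, x * legendre (2 * a.2) x * legendre (2 * b.2) x
  else 0

/-- `Γ̃_e = ℍ Γ_e⁻¹ ℍᵀ`. -/
def matGammaT (G Nh : ℕ) : Matrix (Idx G Nh) (Idx G Nh) ℝ :=
  matH G Nh * (matGamma G Nh)⁻¹ * (matH G Nh)ᵀ

/-- Macroscopic cross sections: `total g` is `Σ_t^g`, and `scatter m g' g` is the Legendre moment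
`Σ_{s,m}^{g' → g}` of order `m` of the scattering cross section from group `g'` to group `g`. -/
structure CrossSections (d G : ℕ) where
  total : Fin G → E d → ℝ
  scatter : ℕ → Fin G → Fin G → E d → ℝ

namespace CrossSections

variable {d G : ℕ} (X : CrossSections d G) (Nh : ℕ)

/-- The removal cross section `Σ_{r,m}^g = Σ_t^g - Σ_{s,m}^{g → g}`. -/
def removal (m : ℕ) (g : Fin G) (x : E d) : ℝ := X.total g x - X.scatter m g g x

/-- The matrix with removal terms on the diagonal blocks, minus the scattering terms on the
off-diagonal blocks, and moment orders given by `ord`. -/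
def mat (ord : ℕ → ℕ) (x : E d) : Matrix (Idx G Nh) (Idx G Nh) ℝ := fun a b =>
  if a.2 = b.2 then
    tcoef (ord a.2) *
      if a.1 = b.1 then X.removal (ord a.2) a.1 x else -X.scatter (ord a.2) b.1 a.1 x
  else 0

/-- The even matrix `𝕋_e`. -/
def Te (x : E d) : Matrix (Idx G Nh) (Idx G Nh) ℝ := X.mat Nh (fun i => 2 * i) x

/-- The odd matrix `𝕋_o`. -/
def To (x : E d) : Matrix (Idx G Nh) (Idx G Nh) ℝ := X.mat Nh (fun i => 2 * i + 1) x

/-- The standing positivity and boundedness assumptions on the coefficients, almost everywhere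
in `Ω`. -/
structure Admissible (Ω : Set (E d)) : Prop where
  removal_even : ∃ lo hi : ℝ, 0 < lo ∧ 0 < hi ∧ ∀ (g : Fin G) (i : Fin Nh),
    ∀ᵐ x ∂(volume.restrict Ω),
      tcoef (2 * i) * X.removal (2 * i) g x ∈ Icc lo hi
  removal_odd : ∃ lo hi : ℝ, 0 < lo ∧ 0 < hi ∧ ∀ (g : Fin G) (i : Fin Nh),
    ∀ᵐ x ∂(volume.restrict Ω),
      tcoef (2 * i + 1) * X.removal (2 * i + 1) g x ∈ Icc lo hi
  scatter_small : ∃ ε : ℝ, 0 < ε ∧ ε * ((G : ℝ) - 1) < 1 ∧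
    ∀ m < 2 * Nh, ∀ g g' : Fin G, g' ≠ g → ∀ᵐ x ∂(volume.restrict Ω),
      |X.scatter m g g' x| ≤ ε * X.removal m g x
  odd_inv : ∃ lo hi : ℝ, 0 < lo ∧ 0 < hi ∧ ∀ Y : Idx G Nh → ℝ, ∀ᵐ x ∂(volume.restrict Ω),
    lo * (Y ⬝ᵥ Y) ≤ Y ⬝ᵥ ((X.To Nh x)⁻¹ *ᵥ Y) ∧
    ((X.To Nh x)⁻¹ *ᵥ Y) ⬝ᵥ ((X.To Nh x)⁻¹ *ᵥ Y) ≤ hi ^ 2 * (Y ⬝ᵥ Y)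
  even : ∃ lo hi : ℝ, 0 < lo ∧ 0 < hi ∧ ∀ Y : Idx G Nh → ℝ, ∀ᵐ x ∂(volume.restrict Ω),
    lo * (Y ⬝ᵥ Y) ≤ Y ⬝ᵥ (X.Te Nh x *ᵥ Y) ∧
    (X.Te Nh x *ᵥ Y) ⬝ᵥ (X.Te Nh x *ᵥ Y) ≤ hi ^ 2 * (Y ⬝ᵥ Y)

/-- The maximum of the diagonal entries of `𝕋_e` on `K`. -/
def deltaMaxE (K : Element d) : ℝ :=
  ⨆ a : Idx G Nh, essSup (fun x => X.Te Nh x a a) (volume.restrict K.carrier)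

/-- The minimum of the diagonal entries of `𝕋_e` on `K`. -/
def deltaMinE (K : Element d) : ℝ :=
  ⨅ a : Idx G Nh, essInf (fun x => X.Te Nh x a a) (volume.restrict K.carrier)

/-- The maximum of the diagonal entries of `𝕋_o` on `K`. -/
def deltaMaxO (K : Element d) : ℝ :=
  ⨆ a : Idx G Nh, essSup (fun x => X.To Nh x a a) (volume.restrict K.carrier)

/-- The minimum of the diagonal entries of `𝕋_o` on `K`. -/
def deltaMinO (K : Element d) : ℝ :=
  ⨅ a : Idx G Nh, essInf (fun x => X.To Nh x a a) (volume.restrict K.carrier)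

end CrossSections

/-! ### The mixed formulation -/

/-- A pair `ζ = (p, φ)` of a flux and a scalar unknown, each indexed by groups and moments. -/
structure State (d G Nh : ℕ) where
  flux : Idx G Nh → FluxField d
  scal : Idx G Nh → E d → ℝ

instance {d G Nh : ℕ} : Sub (State d G Nh) :=
  ⟨fun z w => ⟨z.flux - w.flux, z.scal - w.scal⟩⟩

variable {d G Nh : ℕ}

/-- The space `X = Q(Ω) × L²(Ω)` (for every group and moment). -/
def MemX (Ω : Set (E d)) (z : State d G Nh) : Prop :=
  (∀ a, MemQ Ω (z.flux a)) ∧ ∀ a, MemLp (z.scal a) 2 (volume.restrict Ω)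

/-- `(f, g)_{0,Ω}` for scalar-valued families. -/
def ipL2 (Ω : Set (E d)) (f g : Idx G Nh → E d → ℝ) : ℝ :=
  ∫ x in Ω, ∑ a, f a x * g a x

/-- `(𝕋_o p, q)_{0,Ω}`. -/
def formTo (X : CrossSections d G) (Ω : Set (E d)) (p q : Idx G Nh → FluxField d) : ℝ :=
  ∫ x in Ω, ∑ a, inner ℝ (∑ b, X.To Nh x a b • (p b).val x) ((q a).val x)

/-- `(𝕋_e φ, ψ)_{0,Ω}`. -/
def formTe (X : CrossSections d G) (Ω : Set (E d)) (φ ψ : Idx G Nh → E d → ℝ) : ℝ :=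
  ipL2 Ω (fun a x => ∑ b, X.Te Nh x a b * φ b x) ψ

/-- The family `ℍᵀ div p`. -/
def divHT (p : Idx G Nh → FluxField d) (a : Idx G Nh) (x : E d) : ℝ :=
  ∑ b, (matH G Nh)ᵀ a b * (p b).dv x

/-- `(Γ̃_e (p·n), q·n)_{0,∂Ω}`. -/
def formBd (Ω : Set (E d)) (p q : Idx G Nh → FluxField d) : ℝ :=
  ∫ x, (∑ a, (∑ b, matGammaT G Nh a b * (p b).ntr x) * (q a).ntr x) ∂(surf Ω)

/-- The bilinear form `c` of the mixed formulation. -/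
def formC (X : CrossSections d G) (Ω : Set (E d)) (z w : State d G Nh) : ℝ :=
  -formTo X Ω z.flux w.flux + ipL2 Ω z.scal (divHT w.flux) + ipL2 Ω w.scal (divHT z.flux)
    + formTe X Ω z.scal w.scal - formBd Ω z.flux w.flux

/-- The bilinear form `d(ζ, ξ)`; it equals `c(ζ, (-q, ψ))` for `ξ = (q, ψ)`. -/
def formD (X : CrossSections d G) (Ω : Set (E d)) (z w : State d G Nh) : ℝ :=
  formTo X Ω z.flux w.flux + formTe X Ω z.scal w.scal + formBd Ω z.flux w.flux
    + ipL2 Ω w.scal (divHT z.flux) - ipL2 Ω z.scal (divHT w.flux)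

/-- `ζ` is the solution in `X` of the mixed variational formulation with source `S`. -/
def IsSolution (X : CrossSections d G) (Ω : Set (E d)) (S : Idx G Nh → E d → ℝ)
    (z : State d G Nh) : Prop :=
  MemX Ω z ∧ ∀ w : State d G Nh, MemX Ω w → formC X Ω z w = ipL2 Ω S w.scal

/-- The space `L_h` of order `k`. -/
def MemLh {Ω : Set (E d)} (T : Mesh Ω) (k : ℕ) (f : E d → ℝ) : Prop :=
  MemLp f 2 (volume.restrict Ω) ∧ ∀ K, (T.elt K).MemL k f

/-- The space `Q_h` of order `k`. -/
def MemQh {Ω : Set (E d)} (T : Mesh Ω) (k : ℕ) (q : FluxField d) : Prop :=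
  MemQ Ω q ∧ ∀ K, (T.elt K).MemRTN k q.val

/-- The discrete space `X_h = Q_h × L_h` (for every group and moment). -/
def MemXh {Ω : Set (E d)} (T : Mesh Ω) (k : ℕ) (z : State d G Nh) : Prop :=
  (∀ a, MemQh T k (z.flux a)) ∧ ∀ a, MemLh T k (z.scal a)

/-- `ζ_h` is the solution of the discrete mixed formulation. -/
def IsDiscreteSolution (X : CrossSections d G) {Ω : Set (E d)} (T : Mesh Ω) (k : ℕ)
    (S : Idx G Nh → E d → ℝ) (z : State d G Nh) : Prop :=
  MemXh T k z ∧ ∀ w : State d G Nh, MemXh T k w → formC X Ω z w = ipL2 Ω S w.scal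

/-- The reconstruction `(p_h, φ̃_h)` as an element of `X`. -/
def reconstruct (z : State d G Nh) (φ : Idx G Nh → ScalarField d) : State d G Nh :=
  ⟨z.flux, fun a => (φ a).val⟩

/-! ### Norms -/

open Classical in
/-- The norm `‖·‖_S`. The boundary terms are `‖Γ̃_e^{1/2} (p·n)‖²_{0,F} = (Γ̃_e (p·n), p·n)_{0,F}`. -/
def normS (X : CrossSections d G) {Ω : Set (E d)} (T : Mesh Ω) (z : State d G Nh) : ℝ :=
  Real.sqrt (
    (∫ x in Ω, ∑ a, X.To Nh x a a * ‖(z.flux a).val x‖ ^ 2)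
    + (∫ x in Ω, ∑ a, X.Te Nh x a a * z.scal a x ^ 2)
    + (∑ K, X.deltaMaxO Nh (T.elt K) * (T.elt K).diam ^ 2 *
        ∫ x in (T.elt K).carrier, ∑ a, (z.flux a).dv x ^ 2)
    + ∑ K, ∑ F : (T.elt K).FacetIdx,
        if T.IsBoundaryFacet K F then
          X.deltaMaxO Nh (T.elt K) * (T.elt K).altitude F *
            ∫ x in (T.elt K).facet F,
              (∑ a, (∑ b, matGammaT G Nh a b * (z.flux b).ntr x) * (z.flux a).ntr x) ∂(surf Ω)
        else 0)

/-- The local space `X_K`: the pairs `(q, ψ)` in `X` such that `ψ` is supported in `K` and `q` is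
supported in the union of the elements of `N(K)`. -/
def MemXK {Ω : Set (E d)} (T : Mesh Ω) (K : Fin T.card) (z : State d G Nh) : Prop :=
  MemX Ω z ∧
  (∀ a, ∀ᵐ x ∂(volume.restrict Ω), x ∉ (T.elt K).carrier → z.scal a x = 0) ∧
  (∀ a, ∀ᵐ x ∂(volume.restrict Ω), x ∉ ⋃ K' ∈ T.nbhd K, (T.elt K').carrier →
    (z.flux a).val x = 0)

/-- The local norm `|ζ|_{+,K}`, the supremum of `d(ζ, ξ)` over the `ξ` in `X_K` with `‖ξ‖_S ≤ 1`, as an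
extended nonnegative number (the value at `ξ = 0` is `0`, so that discarding negative values does not
change the supremum). -/
def localNorm (X : CrossSections d G) {Ω : Set (E d)} (T : Mesh Ω) (K : Fin T.card)
    (z : State d G Nh) : ℝ≥0∞ :=
  ⨆ (w : State d G Nh) (_ : MemXK T K w ∧ normS X T w ≤ 1), ENNReal.ofReal (formD X Ω z w)

/-! ### Estimators -/

/-- The residual estimator `‖δ_e^{-1/2} (S - ℍᵀ div p - 𝕋_e φ)‖_{0,K}`. -/
def etaR (X : CrossSections d G) (S : Idx G Nh → E d → ℝ) (K : Element d)
    (p : Idx G Nh → FluxField d) (φ : Idx G Nh → ScalarField d) : ℝ :=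
  Real.sqrt (∫ x in K.carrier, ∑ a,
    (S a x - divHT p a x - ∑ b, X.Te Nh x a b * (φ b).val x) ^ 2 / X.Te Nh x a a)

/-- The flux estimator `‖δ_o^{-1/2} (𝕋_o p + ℍ grad φ)‖_{0,K}`. -/
def etaF (X : CrossSections d G) (K : Element d)
    (p : Idx G Nh → FluxField d) (φ : Idx G Nh → ScalarField d) : ℝ :=
  Real.sqrt (∫ x in K.carrier, ∑ a,
    ‖(∑ b, X.To Nh x a b • (p b).val x) + ∑ b, matH G Nh a b • (φ b).grad x‖ ^ 2 /
      X.To Nh x a a)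

/-- The boundary residual `ℍ φ - Γ̃_e (p·n)`. -/
def bdResidual (p : Idx G Nh → FluxField d) (φ : Idx G Nh → ScalarField d) (x : E d)
    (a : Idx G Nh) : ℝ :=
  (∑ b, matH G Nh a b * (φ b).tr x) - ∑ b, matGammaT G Nh a b * (p b).ntr x

/-- The Robin boundary condition estimator
`(δ^max_{o,K} h_⊥F)^{-1/2} ‖Γ̃_e^{-1/2} (ℍ φ - Γ̃_e (p·n))‖_{0,F}`, for a facet `F` of the element `K`,
with `‖Γ̃_e^{-1/2} e‖²_{0,F} = (Γ̃_e⁻¹ e, e)_{0,F}`. -/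
def etaBC (X : CrossSections d G) (Ω : Set (E d)) (K : Element d) (F : K.FacetIdx)
    (p : Idx G Nh → FluxField d) (φ : Idx G Nh → ScalarField d) : ℝ :=
  (Real.sqrt (X.deltaMaxO Nh K * K.altitude F))⁻¹ *
    Real.sqrt (∫ x in K.facet F,
      (((matGammaT G Nh)⁻¹ *ᵥ bdResidual p φ x) ⬝ᵥ bdResidual p φ x) ∂(surf Ω))

end SPN

end

noncomputable section

namespace SPN

section

/-! ### The boundary matrix `Γ̃_e` -/

/-! The error is tested against well-chosen states. Green's formula between `H¹(Ω)` and `Q(Ω)`,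
together with the equation solved by `z`, gives for every (q, ψ) in X (`formD_error`) d(ζ - ζ̃_h,
(q, ψ)) = (R, ψ) - (r, q) + ⟨b, q·n⟩, where R, r, b are the residuals `resR`, `resF`, `bdResidual`.
By homogeneity (`formD_le_of_localNorm`) the left side is at most |ζ - ζ̃_h|_{+,K} ‖(q, ψ)‖_S on
X_K. A residual is therefore controlled as soon as some test state pairs with it to about its
squared norm while having itself about that norm.

For R, take q = 0 and ψ = δ_e⁻¹ R on K (`etaR_le`). For r, take q = -χ r with χ a bubble inside K:
`exists_bubble` recovers the norm of r from that of the weighted r, and bounds h_K div(χ r) by an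
inverse inequality (`exists_etaF_bound`). For b, take q = χ Y ν with ν the normal of F, χ a bubble
around the centre of F, and Y the extension of Γ̃_e⁻¹ b that is constant along ν
(`exists_facet_bubble`). Its squared norm is of order δ h_K ‖b‖², and the volume term (r, q) is
absorbed by the bound on r just obtained (`exists_etaBC_bound`).

The constants come without a reference element. Every element is an intersection of half-spaces
(`Frame`); shape regularity bounds its heights below by a multiple of h_K (`Frame.le_ht`), so that
balls of radius comparable to h_K fit around the centres of the element and of its facets. On balls,
the polynomial estimates follow from finite dimension and scaling (`exists_L2_bound`). The matrix
Γ̃_e is the Kronecker product of an identity with one positive definite block, which makes its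
bounds uniform in the number of groups (`exists_gammaT_bounds`).

Two points need care. The residuals r and b are polynomial only after weak gradients, traces and
normal traces have been identified with those of polynomial representatives on K
(`MemH1.grad_ae_eq`, `MemH1.tr_ae_eq`, `MemQ.ntr_ae_eq`). And the boundary part of ‖·‖_S sees only F
in the last test, because the relative interior of a boundary facet meets no other element
(`Mesh.notMem_of_relint`). -/

lemma alpha_pos : ∀ m, 0 < alpha m
  | 0 => by simp [alpha]
  | m + 1 => by
    have := alpha_pos m
    rw [alpha]
    apply div_pos
    · have : (0 : ℝ) ≤ m := m.cast_nonneg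
      nlinarith
    · positivity

/-- The Legendre polynomials as elements of `ℝ[X]`. -/
def legendrePoly : ℕ → Polynomial ℝ
  | 0 => 1
  | 1 => Polynomial.X
  | m + 2 => Polynomial.C ((2 * (m : ℝ) + 3) / (m + 2)) * (Polynomial.X * legendrePoly (m + 1)) +
      Polynomial.C (-((m : ℝ) + 1) / (m + 2)) * legendrePoly m

lemma eval_legendrePoly (x : ℝ) : ∀ m, (legendrePoly m).eval x = legendre m x
  | 0 => by simp [legendrePoly, legendre]
  | 1 => by simp [legendrePoly, legendre]
  | m + 2 => by
    have : (m : ℝ) + 2 ≠ 0 := by positivity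
    simp only [legendrePoly, legendre, Polynomial.eval_add, Polynomial.eval_mul,
      Polynomial.eval_C, Polynomial.eval_X, eval_legendrePoly x m, eval_legendrePoly x (m + 1)]
    field_simp
    ring

/-- The term `X * legendrePoly (m + 1)` of the recursion has a nonzero coefficient and dominates.
Distinct degrees then yield linear independence. -/
lemma degree_legendrePoly : ∀ m, (legendrePoly m).degree = m
  | 0 => by simp [legendrePoly]
  | 1 => by simp [legendrePoly]
  | m + 2 => by
    have h1 := degree_legendrePoly (m + 1)
    have h0 := degree_legendrePoly m
    have hc : (2 * (m : ℝ) + 3) / (m + 2) ≠ 0 := by positivity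
    have hd : (Polynomial.C ((2 * (m : ℝ) + 3) / (m + 2)) *
        (Polynomial.X * legendrePoly (m + 1))).degree = ((m + 2 : ℕ) : WithBot ℕ) := by
      rw [Polynomial.degree_C_mul hc, mul_comm, Polynomial.degree_mul, h1, Polynomial.degree_X]
      norm_cast
    rw [legendrePoly, Polynomial.degree_add_eq_left_of_degree_lt, hd]
    rw [hd]
    have hc' : -((m : ℝ) + 1) / (m + 2) ≠ 0 := by
      rw [neg_div, neg_ne_zero]
      positivity
    rw [Polynomial.degree_C_mul hc', h0]
    exact_mod_cast (by omega : m < m + 2)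

lemma linearIndependent_legendrePoly : LinearIndependent ℝ legendrePoly :=
  (⟨legendrePoly, degree_legendrePoly⟩ : Polynomial.Sequence ℝ).linearIndependent

/-- One group block of `ℍ`. -/
def blockH (Nh : ℕ) : Matrix (Fin Nh) (Fin Nh) ℝ := fun i j =>
  (if i = j then 1 else 0) + (if (j : ℕ) = (i : ℕ) + 1 then 1 else 0)

/-- One group block of `Γ_e`. -/
def blockGamma (Nh : ℕ) : Matrix (Fin Nh) (Fin Nh) ℝ := fun i j =>
  alpha (2 * i) * alpha (2 * j) *
    ∫ x in (0 : ℝ)..1, x * legendre (2 * i) x * legendre (2 * j) x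

/-- One group block of `Γ̃_e`. -/
def blockGammaT (Nh : ℕ) : Matrix (Fin Nh) (Fin Nh) ℝ :=
  blockH Nh * (blockGamma Nh)⁻¹ * (blockH Nh)ᵀ

-- The form 1 ⊗ block lets inverses and quadratic forms be computed group by group, so that no
-- constant depends on G.
open scoped Kronecker in
lemma matH_eq (G Nh : ℕ) : matH G Nh = (1 : Matrix (Fin G) (Fin G) ℝ) ⊗ₖ blockH Nh := by
  ext a b
  simp [matH, blockH, Matrix.kroneckerMap_apply, Matrix.one_apply, ite_mul]

open scoped Kronecker in
lemma matGamma_eq (G Nh : ℕ) :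
    matGamma G Nh = (1 : Matrix (Fin G) (Fin G) ℝ) ⊗ₖ blockGamma Nh := by
  ext a b
  simp [matGamma, blockGamma, Matrix.kroneckerMap_apply, Matrix.one_apply, ite_mul]

open scoped Kronecker in
lemma matGammaT_eq (G Nh : ℕ) :
    matGammaT G Nh = (1 : Matrix (Fin G) (Fin G) ℝ) ⊗ₖ blockGammaT Nh := by
  rw [matGammaT, matH_eq, matGamma_eq, Matrix.inv_kronecker, inv_one, ← Matrix.kroneckerMap_transpose,
    ← Matrix.mul_kronecker_mul, ← Matrix.mul_kronecker_mul]
  simp [blockGammaT]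

/-- Γ_e is a Gram matrix for the weight x on (0, 1), so its quadratic form is the weighted integral
of a square. -/
lemma blockGamma_dotProduct {Nh : ℕ} (Y : Fin Nh → ℝ) :
    Y ⬝ᵥ (blockGamma Nh *ᵥ Y) = ∫ x in (0 : ℝ)..1,
      x * ((∑ i : Fin Nh, (Y i * alpha (2 * i)) • legendrePoly (2 * i)).eval x) ^ 2 := by
  have : ∀ x : ℝ, x * ((∑ i : Fin Nh, (Y i * alpha (2 * i)) • legendrePoly (2 * i)).eval x) ^ 2 =
      ∑ i : Fin Nh, ∑ j : Fin Nh, (Y i * Y j * alpha (2 * i) * alpha (2 * j)) *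
        (x * (legendrePoly (2 * i)).eval x * (legendrePoly (2 * j)).eval x) := by
    intro x
    simp only [Polynomial.eval_finsetSum, Polynomial.eval_smul, smul_eq_mul]
    rw [sq, Finset.sum_mul_sum, Finset.mul_sum]
    simp only [Finset.mul_sum]
    exact Finset.sum_congr rfl fun i _ => Finset.sum_congr rfl fun j _ => by ring
  simp_rw [this]
  have hc : ∀ i j : ℕ, Continuous fun x : ℝ =>
      x * (legendrePoly i).eval x * (legendrePoly j).eval x := fun i j => by fun_prop
  rw [intervalIntegral.integral_finsetSum]
  · simp only [dotProduct, Matrix.mulVec, Finset.mul_sum]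
    refine Finset.sum_congr rfl fun i _ => ?_
    rw [intervalIntegral.integral_finsetSum]
    · refine Finset.sum_congr rfl fun j _ => ?_
      rw [intervalIntegral.integral_const_mul, blockGamma]
      simp_rw [eval_legendrePoly]
      ring
    · intro j _
      exact ((hc _ _).const_smul (Y i * Y j * alpha (2 * i) * alpha (2 * j))).intervalIntegrable _ _
  · intro i _
    refine Continuous.intervalIntegrable ?_ _ _
    exact continuous_finsetSum _ fun j _ => continuous_const.mul (hc _ _)

/-- A nonzero Y gives a nonzero polynomial, since the α's are positive and the Legendre polynomials
independent; its square has a positive integral against the weight x. -/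
lemma blockGamma_posDef (Nh : ℕ) : (blockGamma Nh).PosDef := by
  refine Matrix.PosDef.of_dotProduct_mulVec_pos ?_ fun Y hY => ?_
  · ext i j
    simp only [Matrix.conjTranspose_apply, blockGamma, star_trivial]
    rw [mul_comm (alpha (2 * j))]
    congr 2
    ext x
    ring
  rw [star_trivial, blockGamma_dotProduct]
  set p := ∑ i : Fin Nh, (Y i * alpha (2 * i)) • legendrePoly (2 * i) with hp
  have hp0 : p ≠ 0 := by
    intro h
    apply hY
    have hinj : Function.Injective fun i : Fin Nh => 2 * (i : ℕ) := fun i j hij => by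
      ext; simpa using hij
    have := Fintype.linearIndependent_iff.1
      (linearIndependent_legendrePoly.comp _ hinj) (fun i => Y i * alpha (2 * i)) h
    ext i
    exact (mul_eq_zero.1 (this i)).resolve_right (alpha_pos _).ne'
  refine intervalIntegral.integral_pos (by norm_num) (by fun_prop) ?_ ?_
  · intro x hx
    exact mul_nonneg hx.1.le (sq_nonneg _)
  -- The integrand is continuous and nonnegative, so one point of (0, 1] off the finitely many roots
  -- is enough.
  · have hinf : (Ioc (0 : ℝ) 1 \ (p.roots.toFinset : Set ℝ)).Nonempty :=
      ((Ioc_infinite (by norm_num)).sdiff (Finset.finite_toSet _)).nonempty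
    obtain ⟨x, hx, hr⟩ := hinf
    refine ⟨x, ⟨hx.1.le, hx.2⟩, mul_pos hx.1 (pow_pos_of_ne_zero ?_)⟩
    intro h
    exact hr (by simp [hp0, h])
where
  pow_pos_of_ne_zero {a : ℝ} (h : a ≠ 0) : 0 < a ^ 2 := by positivity

/-- The block is upper triangular with ones on the diagonal. -/
lemma blockH_isUnit (Nh : ℕ) : IsUnit (blockH Nh) := by
  rw [Matrix.isUnit_iff_isUnit_det, Matrix.det_of_isUpperTriangular]
  · simp [blockH]
  · intro i j hij
    have h : (j : ℕ) < i := hij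
    have h1 : i ≠ j := by rintro rfl; omega
    have h2 : (j : ℕ) ≠ i + 1 := by omega
    simp [blockH, h1, h2]

/-- Γ̃_e is congruent, through the invertible ℍ, to the inverse of a positive definite matrix. -/
lemma blockGammaT_posDef (Nh : ℕ) : (blockGammaT Nh).PosDef := by
  have h := (blockGamma_posDef Nh).inv.mul_mul_conjTranspose_same (B := blockH Nh)
    (Matrix.vecMul_injective_iff_isUnit.2 (blockH_isUnit Nh))
  rwa [Matrix.conjTranspose_eq_transpose_of_trivial] at h

/-- Coercivity of a positive definite matrix. -/
lemma exists_coercive {N : ℕ} {A : Matrix (Fin N) (Fin N) ℝ} (hA : A.PosDef) :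
    ∃ l : ℝ, 0 < l ∧ ∀ Y : Fin N → ℝ, l * (Y ⬝ᵥ Y) ≤ (A *ᵥ Y) ⬝ᵥ Y := by
  rcases Nat.eq_zero_or_pos N with rfl | hN
  · exact ⟨1, one_pos, fun Y => by simp [dotProduct]⟩
  have : Nonempty (Fin N) := ⟨⟨0, hN⟩⟩
  obtain ⟨Y0, hY0, hmin⟩ := (isCompact_sphere (0 : Fin N → ℝ) 1).exists_isMinOn
    (NormedSpace.sphere_nonempty.2 zero_le_one)
    (f := fun Y => (A *ᵥ Y) ⬝ᵥ Y)
    (Continuous.continuousOn (by unfold Matrix.mulVec dotProduct; fun_prop))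
  have hpos : 0 < (A *ᵥ Y0) ⬝ᵥ Y0 := by
    have h0 : Y0 ≠ 0 := by
      rintro rfl
      simp at hY0
    have := hA.dotProduct_mulVec_pos h0
    rwa [star_trivial, dotProduct_comm] at this
  set m := (A *ᵥ Y0) ⬝ᵥ Y0
  -- The minimum m was taken over the sphere of the sup norm, and Y ⬝ᵥ Y ≤ N ‖Y‖² in that norm;
  -- hence the division by N.
  refine ⟨m / N, by positivity, fun Y => ?_⟩
  rcases eq_or_ne Y 0 with rfl | hY
  · simp
  have hn : 0 < ‖Y‖ := norm_pos_iff.2 hY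
  have h1 : m ≤ (A *ᵥ (‖Y‖⁻¹ • Y)) ⬝ᵥ (‖Y‖⁻¹ • Y) := hmin (by simp [norm_smul, hn.ne'])
  rw [Matrix.mulVec_smul, smul_dotProduct, dotProduct_smul, smul_eq_mul, smul_eq_mul] at h1
  have h2 : Y ⬝ᵥ Y ≤ N * ‖Y‖ ^ 2 := by
    calc Y ⬝ᵥ Y ≤ ∑ i : Fin N, ‖Y‖ ^ 2 := by
          refine Finset.sum_le_sum fun i _ => ?_
          have := norm_le_pi_norm Y i
          rw [Real.norm_eq_abs] at this
          nlinarith [abs_mul_abs_self (Y i), abs_nonneg (Y i)]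
      _ = N * ‖Y‖ ^ 2 := by simp
  have h3 : m * ‖Y‖ ^ 2 ≤ (A *ᵥ Y) ⬝ᵥ Y := by
    calc m * ‖Y‖ ^ 2 ≤ (‖Y‖⁻¹ * (‖Y‖⁻¹ * (A *ᵥ Y) ⬝ᵥ Y)) * ‖Y‖ ^ 2 := by gcongr
      _ = _ := by field_simp
  calc m / N * (Y ⬝ᵥ Y) ≤ m / N * (N * ‖Y‖ ^ 2) := by gcongr
    _ = m * ‖Y‖ ^ 2 := by field_simp
    _ ≤ _ := h3

/-- Cauchy-Schwarz on each row: the operator norm is at most the Frobenius norm. -/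
lemma dotProduct_self_mulVec_le {ι : Type*} [Fintype ι] (A : Matrix ι ι ℝ) (Y : ι → ℝ) :
    (A *ᵥ Y) ⬝ᵥ (A *ᵥ Y) ≤ (∑ i, ∑ j, A i j ^ 2) * (Y ⬝ᵥ Y) := by
  simp only [dotProduct, Matrix.mulVec, Finset.sum_mul]
  refine Finset.sum_le_sum fun i _ => ?_
  have := Finset.sum_mul_sq_le_sq_mul_sq Finset.univ (A i) Y
  simpa [sq, Finset.sum_mul] using this

open scoped Kronecker in
lemma one_kronecker_mulVec {G Nh : ℕ} (A : Matrix (Fin Nh) (Fin Nh) ℝ) (Y : Idx G Nh → ℝ)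
    (a : Idx G Nh) :
    (((1 : Matrix (Fin G) (Fin G) ℝ) ⊗ₖ A) *ᵥ Y) a = (A *ᵥ fun j => Y (a.1, j)) a.2 := by
  simp only [Matrix.mulVec, dotProduct, Fintype.sum_prod_type, Matrix.kroneckerMap_apply,
    Matrix.one_apply, ite_mul, one_mul, zero_mul]
  rw [Finset.sum_eq_single a.1]
  · simp
  · intro g _ hg
    simp [hg.symm]
  · simp

/-- Spectral bounds for `Γ̃_e⁻¹`, uniform in the number of groups. -/
lemma exists_gammaT_bounds (Nh : ℕ) : ∃ l M : ℝ, 0 < l ∧ 0 < M ∧ ∀ (G : ℕ) (Y : Idx G Nh → ℝ),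
    l * (Y ⬝ᵥ Y) ≤ ((matGammaT G Nh)⁻¹ *ᵥ Y) ⬝ᵥ Y ∧
    ((matGammaT G Nh)⁻¹ *ᵥ Y) ⬝ᵥ Y ≤ M * (Y ⬝ᵥ Y) ∧
    ((matGammaT G Nh)⁻¹ *ᵥ Y) ⬝ᵥ ((matGammaT G Nh)⁻¹ *ᵥ Y) ≤ M * (Y ⬝ᵥ Y) ∧
    matGammaT G Nh *ᵥ ((matGammaT G Nh)⁻¹ *ᵥ Y) = Y := by
  set A := (blockGammaT Nh)⁻¹ with hA
  obtain ⟨l, hl, hl'⟩ := exists_coercive (blockGammaT_posDef Nh).inv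
  set S := ∑ i, ∑ j, A i j ^ 2 with hS
  have hS0 : 0 ≤ S := Finset.sum_nonneg fun i _ => Finset.sum_nonneg fun j _ => sq_nonneg _
  -- S is the squared Frobenius norm of the inverse block; S + 1 serves for both upper bounds and is
  -- positive.
  refine ⟨l, S + 1, hl, by positivity, fun G Y => ?_⟩
  have key : ∀ Z W : Idx G Nh → ℝ, Z ⬝ᵥ W =
      ∑ g, (fun j => Z (g, j)) ⬝ᵥ (fun j => W (g, j)) := fun Z W => by
    simp only [dotProduct, Fintype.sum_prod_type]
  have hinv : ∀ g, (fun j => ((matGammaT G Nh)⁻¹ *ᵥ Y) (g, j)) = A *ᵥ fun j => Y (g, j) := by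
    intro g
    ext j
    rw [matGammaT_eq, Matrix.inv_kronecker, inv_one, one_kronecker_mulVec]
  have h3 : ∀ g : Fin G, (A *ᵥ fun j => Y (g, j)) ⬝ᵥ (A *ᵥ fun j => Y (g, j)) ≤
      S * ((fun j => Y (g, j)) ⬝ᵥ fun j => Y (g, j)) := fun g => dotProduct_self_mulVec_le A _
  have hnn : ∀ g : Fin G, 0 ≤ (fun j => Y (g, j)) ⬝ᵥ fun j => Y (g, j) := fun g =>
    Finset.sum_nonneg fun i _ => mul_self_nonneg _
  refine ⟨?_, ?_, ?_, ?_⟩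
  · rw [key, key, Finset.mul_sum]
    exact Finset.sum_le_sum fun g _ => by rw [hinv]; exact hl' _
  · rw [key, key, Finset.mul_sum]
    refine Finset.sum_le_sum fun g _ => ?_
    rw [hinv]
    set u := A *ᵥ fun j => Y (g, j)
    set v := fun j => Y (g, j)
    -- This gives 2 u·v ≤ |u|² + |v|² ≤ (S + 1) |v|².
    have h4 : 0 ≤ (u - v) ⬝ᵥ (u - v) := Finset.sum_nonneg fun i _ => mul_self_nonneg _
    rw [sub_dotProduct, dotProduct_sub, dotProduct_sub, dotProduct_comm v u] at h4
    nlinarith [h3 g, hnn g, mul_nonneg hS0 (hnn g)]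
  · rw [key, key, Finset.mul_sum]
    refine Finset.sum_le_sum fun g _ => ?_
    rw [hinv]
    nlinarith [h3 g, hnn g]
  · rw [Matrix.mulVec_mulVec, Matrix.mul_nonsing_inv, Matrix.one_mulVec]
    rw [matGammaT_eq, Matrix.det_kronecker]
    simpa using ((Matrix.isUnit_iff_isUnit_det _).1 (blockGammaT_posDef Nh).isUnit).pow _

end

section

/-! ### Polynomial functions and norm equivalence -/

/-- A linear map of a finite-dimensional space into `L²`, dominated by an injective one. -/
lemma exists_L2_bound {V α β : Type*} [AddCommGroup V] [Module ℝ V] [FiniteDimensional ℝ V]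
    [MeasurableSpace α] [MeasurableSpace β] {μ : Measure α} {ν : Measure β}
    (f : V →ₗ[ℝ] (α → ℝ)) (g : V →ₗ[ℝ] (β → ℝ)) (hf : ∀ v, MemLp (f v) 2 μ)
    (hg : ∀ v, MemLp (g v) 2 ν) (hinj : ∀ v, f v =ᵐ[μ] 0 → v = 0) :
    ∃ C : ℝ, 0 < C ∧ ∀ v, ∫ y, g v y ^ 2 ∂ν ≤ C * ∫ x, f v x ^ 2 ∂μ := by
  let F : V →ₗ[ℝ] Lp ℝ 2 μ :=
    { toFun := fun v => (hf v).toLp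
      map_add' := fun u v => by
        rw [← MemLp.toLp_add]
        exact MemLp.toLp_congr _ _ (by rw [map_add])
      map_smul' := fun c v => by
        rw [RingHom.id_apply, ← MemLp.toLp_const_smul]
        exact MemLp.toLp_congr _ _ (by rw [map_smul]) }
  let H : V →ₗ[ℝ] Lp ℝ 2 ν :=
    { toFun := fun v => (hg v).toLp
      map_add' := fun u v => by
        rw [← MemLp.toLp_add]
        exact MemLp.toLp_congr _ _ (by rw [map_add])
      map_smul' := fun c v => by
        rw [RingHom.id_apply, ← MemLp.toLp_const_smul]
        exact MemLp.toLp_congr _ _ (by rw [map_smul]) }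
  have hF : Function.Injective F := by
    rw [injective_iff_map_eq_zero]
    intro v hv
    exact hinj v ((MemLp.toLp_eq_toLp_iff (hf v) MemLp.zero).1 (by rw [MemLp.toLp_zero]; exact hv))
  let e := LinearEquiv.ofInjective F hF
  -- The second map factors through the range of the first, which is finite-dimensional; the factor
  -- is thus continuous, and its operator norm provides the constant.
  let T : LinearMap.range F →L[ℝ] Lp ℝ 2 ν :=
    LinearMap.toContinuousLinearMap (H ∘ₗ e.symm.toLinearMap)
  refine ⟨‖T‖ ^ 2 + 1, by positivity, fun v => ?_⟩
  have h1 : ‖H v‖ ≤ ‖T‖ * ‖F v‖ := by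
    have := T.le_opNorm (e v)
    simpa [T, e] using this
  have hF2 : ‖F v‖ ^ 2 = ∫ x, f v x ^ 2 ∂μ := by
    rw [← real_inner_self_eq_norm_sq, L2.inner_def]
    refine integral_congr_ae ?_
    filter_upwards [(hf v).coeFn_toLp] with x hx
    change inner ℝ ((hf v).toLp (f v) x) ((hf v).toLp (f v) x) = _
    rw [hx]; simp [sq]
  have hH2 : ‖H v‖ ^ 2 = ∫ x, g v x ^ 2 ∂ν := by
    rw [← real_inner_self_eq_norm_sq, L2.inner_def]
    refine integral_congr_ae ?_
    filter_upwards [(hg v).coeFn_toLp] with x hx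
    change inner ℝ ((hg v).toLp (g v) x) ((hg v).toLp (g v) x) = _
    rw [hx]; simp [sq]
  rw [← hF2, ← hH2]
  have h0 := norm_nonneg (H v)
  have h2 : ‖H v‖ ^ 2 ≤ (‖T‖ * ‖F v‖) ^ 2 := by gcongr
  nlinarith [sq_nonneg ‖F v‖]

/-- Evaluation of multivariate polynomials, as a linear map into the functions on `ℝⁿ`. -/
def polyEval (n : ℕ) : MvPolynomial (Fin n) ℝ →ₗ[ℝ] (E n → ℝ) where
  toFun P x := MvPolynomial.eval (fun i => x i) P
  map_add' P Q := by ext; simp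
  map_smul' c P := by ext; simp [MvPolynomial.smul_eval]

/-- The space of polynomial functions of total degree at most `m` on `ℝⁿ`. -/
def PF (n m : ℕ) : Submodule ℝ (E n → ℝ) :=
  (MvPolynomial.restrictTotalDegree (Fin n) ℝ m).map (polyEval n)

instance (n m : ℕ) : FiniteDimensional ℝ (PF n m) :=
  inferInstanceAs (FiniteDimensional ℝ
    ((MvPolynomial.restrictTotalDegree (Fin n) ℝ m).map (polyEval n)))

/-- `f` is a polynomial function of total degree at most `m`. -/
def IsPF {n : ℕ} (m : ℕ) (f : E n → ℝ) : Prop :=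
  ∃ P : MvPolynomial (Fin n) ℝ, P.totalDegree ≤ m ∧
    f = fun x : E n => MvPolynomial.eval (fun i => x i) P

lemma mem_PF {n m : ℕ} {f : E n → ℝ} : f ∈ PF n m ↔ IsPF m f := by
  constructor
  · rintro ⟨P, hP, rfl⟩
    exact ⟨P, (MvPolynomial.mem_restrictTotalDegree _ _ _).1 hP, rfl⟩
  · rintro ⟨P, hP, rfl⟩
    exact ⟨P, (MvPolynomial.mem_restrictTotalDegree _ _ _).2 hP, rfl⟩

lemma isPF_coe {n m : ℕ} (f : PF n m) : IsPF m (f : E n → ℝ) := mem_PF.1 f.2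

namespace IsPF

variable {n m m' : ℕ} {f g : E n → ℝ}

lemma mono (hf : IsPF m f) (h : m ≤ m') : IsPF m' f := by
  obtain ⟨P, hP, rfl⟩ := hf
  exact ⟨P, hP.trans h, rfl⟩

lemma const (c : ℝ) : IsPF m (fun _ : E n => c) :=
  ⟨MvPolynomial.C c, by simp, by simp⟩

lemma coord (i : Fin n) : IsPF 1 (fun x : E n => x i) :=
  ⟨MvPolynomial.X i, by simp, by simp⟩

lemma mul (hf : IsPF m f) (hg : IsPF m' g) : IsPF (m + m') (fun x => f x * g x) := by
  obtain ⟨P, hP, rfl⟩ := hf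
  obtain ⟨Q, hQ, rfl⟩ := hg
  exact ⟨P * Q, (MvPolynomial.totalDegree_mul _ _).trans (add_le_add hP hQ), by simp⟩

lemma add (hf : IsPF m f) (hg : IsPF m g) : IsPF m (fun x => f x + g x) :=
  mem_PF.1 ((PF n m).add_mem (mem_PF.2 hf) (mem_PF.2 hg))

lemma const_mul (c : ℝ) (hf : IsPF m f) : IsPF m (fun x => c * f x) :=
  mem_PF.1 ((PF n m).smul_mem c (mem_PF.2 hf))

lemma sub (hf : IsPF m f) (hg : IsPF m g) : IsPF m (fun x => f x - g x) :=
  mem_PF.1 ((PF n m).sub_mem (mem_PF.2 hf) (mem_PF.2 hg))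

lemma sum {ι : Type*} {s : Finset ι} {F : ι → E n → ℝ} (h : ∀ i ∈ s, IsPF m (F i)) :
    IsPF m (fun x => ∑ i ∈ s, F i x) := by
  have := mem_PF.1 ((PF n m).sum_mem fun i hi => mem_PF.2 (h i hi))
  convert this using 1
  ext x
  simp

lemma pow (hf : IsPF m f) : ∀ r : ℕ, IsPF (r * m) (fun x => f x ^ r)
  | 0 => by simpa using const 1
  | r + 1 => by
    have := (pow hf r).mul hf
    simpa [pow_succ, add_mul] using this

lemma prod {ι : Type*} (s : Finset ι) {F : ι → E n → ℝ} {e : ι → ℕ}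
    (h : ∀ i ∈ s, IsPF (e i) (F i)) :
    IsPF (∑ i ∈ s, e i) (fun x => ∏ i ∈ s, F i x) := by
  classical
  induction s using Finset.induction_on with
  | empty => simpa using const 1
  | insert a s ha ih =>
    simp only [Finset.prod_insert ha, Finset.sum_insert ha]
    exact (h a (Finset.mem_insert_self _ _)).mul
      (ih fun i hi => h i (Finset.mem_insert_of_mem hi))

/-- Substitution of affine functions into a polynomial. -/
lemma eval_comp {r : ℕ} {P : MvPolynomial (Fin r) ℝ} {G : Fin r → E n → ℝ}
    (hG : ∀ i, IsPF 1 (G i)) (hP : ∀ s ∈ P.support, ∑ i, s i ≤ m) :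
    IsPF m (fun x => MvPolynomial.eval (fun i => G i x) P) := by
  simp only [MvPolynomial.eval_eq']
  refine sum fun s hs => const_mul _ ?_
  refine mono (prod Finset.univ (e := fun i => s i) fun i _ => ?_) (hP s hs)
  simpa using (hG i).pow (s i)

lemma comp {r : ℕ} {f : E r → ℝ} (hf : IsPF m f) {G : E n → E r}
    (hG : ∀ i, IsPF 1 (fun x => G x i)) : IsPF m (fun x => f (G x)) := by
  obtain ⟨P, hP, rfl⟩ := hf
  refine eval_comp hG fun s hs => ?_
  have := MvPolynomial.le_totalDegree hs
  rw [Finsupp.sum_fintype _ _ (fun _ => rfl)] at this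
  exact this.trans hP

/-- Analyticity, and not only smoothness, is what turns vanishing on a ball into vanishing
everywhere. -/
lemma analyticOnNhd (hf : IsPF m f) : AnalyticOnNhd ℝ f univ := by
  obtain ⟨P, -, rfl⟩ := hf
  have := AnalyticOnNhd.aeval_mvPolynomial (𝕜 := ℝ) (f := fun (x : E n) (i : Fin n) => x i)
    (s := univ) (fun i x _ => (EuclideanSpace.proj i : E n →L[ℝ] ℝ).analyticAt x) P
  simpa [MvPolynomial.aeval_eq_eval] using this

lemma contDiff (hf : IsPF m f) : ContDiff ℝ ∞ f :=
  contDiffOn_univ.1 (hf.analyticOnNhd.contDiffOn uniqueDiffOn_univ)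

lemma continuous (hf : IsPF m f) : Continuous f := (contDiff hf).continuous

lemma affine (v : E n) (c : ℝ) : IsPF 1 (fun x => c + inner ℝ v x) := by
  have : (fun x : E n => inner ℝ v x) = fun x => ∑ i, v i * x i := by
    ext x
    simp [PiLp.inner_apply, mul_comm]
  refine add (f := fun _ => c) (g := fun x => inner ℝ v x) (const c) ?_
  rw [this]
  exact sum fun i _ => const_mul _ (coord i)

/-- A polynomial function that vanishes almost everywhere on a ball is zero. -/
lemma eq_zero_of_ae (hf : IsPF m f) {c : E n} {r : ℝ} (hr : 0 < r)
    (h : f =ᵐ[volume.restrict (Metric.ball c r)] 0) : f = 0 := by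
  have h1 : EqOn f 0 (Metric.ball c r) :=
    Measure.eqOn_of_ae_eq h hf.continuous.continuousOn continuousOn_const (by
      rw [Metric.isOpen_ball.interior_eq]
      exact subset_closure)
  have := hf.analyticOnNhd.eq_of_eventuallyEq (z₀ := c) (g := 0) (fun _ _ => analyticAt_const)
    (Filter.eventually_of_mem (Metric.ball_mem_nhds c hr) h1)
  exact this

end IsPF

lemma memLp_two_ball {n : ℕ} {f : E n → ℝ} (hf : Continuous f) (c : E n) (r : ℝ) :
    MemLp f 2 (volume.restrict (Metric.ball c r)) := by
  have : IsFiniteMeasure (volume.restrict (Metric.closedBall c r)) :=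
    ⟨by simpa using (isCompact_closedBall c r).measure_lt_top⟩
  obtain ⟨C, hC⟩ := (isCompact_closedBall c r).exists_bound_of_continuousOn hf.continuousOn
  refine MemLp.mono_measure (μ := volume.restrict (Metric.closedBall c r))
    (Measure.restrict_mono Metric.ball_subset_closedBall le_rfl) ?_
  exact MemLp.of_bound hf.aestronglyMeasurable C
    ((ae_restrict_iff' Metric.isClosed_closedBall.measurableSet).2 (ae_of_all _ hC))

/-- Domination of a linear operation on polynomials by the `L²` norm on a small ball. -/
lemma exists_poly_bound {n r : ℕ} (m : ℕ) (g : PF n m →ₗ[ℝ] (E r → ℝ))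
    (hg : ∀ f, Continuous (g f)) (M : ℝ) :
    ∃ C : ℝ, 0 < C ∧ ∀ f : PF n m, ∫ x in Metric.ball (0 : E r) M, g f x ^ 2 ≤
      C * ∫ x in Metric.ball (0 : E n) (1 / 2), (f : E n → ℝ) x ^ 2 :=
  exists_L2_bound (PF n m).subtype g (fun f => memLp_two_ball (isPF_coe f).continuous _ _)
    (fun f => memLp_two_ball (hg f) _ _)
    (fun f hf => Subtype.ext ((isPF_coe f).eq_zero_of_ae (by norm_num) hf))

/-- Rescaling of an integral over a ball to the unit scale. -/
lemma integral_ball_scale {n : ℕ} (f : E n → ℝ) (x0 : E n) {s : ℝ} (hs : 0 < s) (r : ℝ) :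
    ∫ x in Metric.ball x0 (r * s), f x =
      s ^ n * ∫ y in Metric.ball (0 : E n) r, f (x0 + s • y) := by
  have h1 : ∫ x in Metric.ball x0 (r * s), f x =
      ∫ x in Metric.ball (0 : E n) (r * s), f (x0 + x) := by
    rw [← integral_indicator Metric.isOpen_ball.measurableSet,
      ← integral_indicator Metric.isOpen_ball.measurableSet, ← integral_add_left_eq_self _ x0]
    congr 1
    ext x
    simp [indicator, Metric.mem_ball, dist_eq_norm]
  have h2 := Measure.setIntegral_comp_smul_of_pos (volume : Measure (E n))
    (fun x => f (x0 + x)) (Metric.ball 0 r) hs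
  rw [h1, h2, smul_ball hs.ne', smul_zero, Real.norm_of_nonneg hs.le, mul_comm r s]
  have : s ^ n ≠ 0 := by positivity
  simp [finrank_euclideanSpace, this]

/-- The `L²` norm of a polynomial on a ball is controlled by the one on a smaller concentric ball. -/
lemma exists_ball_bound (n m : ℕ) (M : ℝ) :
    ∃ C : ℝ, 0 < C ∧ ∀ f : E n → ℝ, IsPF m f → ∀ (x0 : E n) (s : ℝ), 0 < s →
      ∫ x in Metric.ball x0 (M * s), f x ^ 2 ≤ C * ∫ x in Metric.ball x0 (1 / 2 * s), f x ^ 2 := by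
  obtain ⟨C, hC, h⟩ := exists_poly_bound m (PF n m).subtype (fun f => (isPF_coe f).continuous) M
  refine ⟨C, hC, fun f hf x0 s hs => ?_⟩
  -- Pulling back to the unit scale keeps the degree, and both sides acquire the same factor s ^ n.
  have hg : IsPF m (fun y => f (x0 + s • y)) := hf.comp fun i => by
    simpa using (IsPF.const (x0 i)).add ((IsPF.coord i).const_mul s)
  rw [integral_ball_scale _ _ hs, integral_ball_scale _ _ hs, mul_left_comm]
  exact mul_le_mul_of_nonneg_left (h ⟨_, mem_PF.2 hg⟩) (by positivity)

/-- The inverse inequality on balls. -/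
lemma exists_inverse_bound (n m : ℕ) :
    ∃ C : ℝ, 0 < C ∧ ∀ f : E n → ℝ, IsPF m f → ∀ (x0 : E n) (s : ℝ), 0 < s → ∀ v : E n, ‖v‖ = 1 →
      s ^ 2 * ∫ x in Metric.ball x0 s, fderiv ℝ f x v ^ 2 ≤
        C * ∫ x in Metric.ball x0 (1 / 2 * s), f x ^ 2 := by
  have hex : ∀ i : Fin n, ∃ C : ℝ, 0 < C ∧ ∀ f : PF n m,
      ∫ x in Metric.ball (0 : E n) 1, fderiv ℝ f x (EuclideanSpace.single i 1) ^ 2 ≤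
      C * ∫ x in Metric.ball (0 : E n) (1 / 2), (f : E n → ℝ) x ^ 2 := fun i => by
    -- A partial derivative is a linear operation on a finite-dimensional space, so the unit-scale
    -- estimate is an instance of `exists_poly_bound`.
    let g : PF n m →ₗ[ℝ] (E n → ℝ) :=
      { toFun := fun f x => fderiv ℝ (f : E n → ℝ) x (EuclideanSpace.single i 1)
        map_add' := fun f f' => by
          ext x
          have h1 := ((isPF_coe f).contDiff.differentiable (by simp)) x
          have h2 := ((isPF_coe f').contDiff.differentiable (by simp)) x
          simp only [Submodule.coe_add, fderiv_add h1 h2]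
          rfl
        map_smul' := fun c f => by
          ext x
          have h1 := ((isPF_coe f).contDiff.differentiable (by simp)) x
          simp only [Submodule.coe_smul, fderiv_const_smul h1]
          rfl }
    exact exists_poly_bound m g (fun f =>
      ((isPF_coe f).contDiff.continuous_fderiv (by simp)).clm_apply continuous_const) 1
  choose C hC h using hex
  -- The factor n comes from Cauchy-Schwarz over the partial derivatives; the added 1 keeps the
  -- constant positive when n = 0.
  refine ⟨n * ∑ i, C i + 1, by have := Finset.sum_nonneg fun i (_ : i ∈ Finset.univ) => (hC i).le
                               positivity, fun f hf x0 s hs v hv => ?_⟩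
  have hg : IsPF m (fun y => f (x0 + s • y)) := hf.comp fun i => by
    simpa using (IsPF.const (x0 i)).add ((IsPF.coord i).const_mul s)
  set g := fun y => f (x0 + s • y) with hgdef
  have hd : ∀ y w, fderiv ℝ g y w = s * fderiv ℝ f (x0 + s • y) w := fun y w => by
    have h1 : HasFDerivAt (fun y : E n => x0 + s • y) (s • ContinuousLinearMap.id ℝ (E n)) y :=
      ((hasFDerivAt_id y).const_smul s).const_add x0
    have h2 : HasFDerivAt f (fderiv ℝ f (x0 + s • y)) (x0 + s • y) :=
      (hf.contDiff.differentiable (by simp) _).hasFDerivAt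
    have h3 : HasFDerivAt g _ y := h2.comp y h1
    rw [h3.fderiv]
    simp
  have hball := integral_ball_scale (fun x => fderiv ℝ f x v ^ 2) x0 hs 1
  rw [one_mul] at hball
  rw [hball, integral_ball_scale _ _ hs, mul_left_comm, mul_left_comm _ (s ^ n)]
  refine mul_le_mul_of_nonneg_left ?_ (by positivity)
  rw [← integral_const_mul]
  -- The coordinates of a unit vector are at most 1 in modulus, and each derivative at unit scale
  -- carries one factor s.
  have hpt : ∀ y, s ^ 2 * fderiv ℝ f (x0 + s • y) v ^ 2 ≤
      n * ∑ i, fderiv ℝ g y (EuclideanSpace.single i 1) ^ 2 := fun y => by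
    rw [← mul_pow, ← hd]
    have hv' : v = ∑ i, v i • EuclideanSpace.single i (1 : ℝ) := by
      ext j; simp [Finset.sum_apply, Pi.single_apply]
    conv_lhs => rw [hv']
    rw [map_sum]
    refine (sq_sum_le_card_mul_sum_sq).trans ?_
    simp only [Finset.card_univ, Fintype.card_fin]
    refine mul_le_mul_of_nonneg_left (Finset.sum_le_sum fun i _ => ?_) (by positivity)
    rw [map_smul, smul_eq_mul, mul_pow]
    have : v i ^ 2 ≤ 1 := by
      have := EuclideanSpace.norm_sq_eq v
      rw [hv] at this
      have h3 := Finset.single_le_sum (f := fun i => ‖v i‖ ^ 2) (fun i _ => by positivity)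
        (Finset.mem_univ i)
      simp only [Real.norm_eq_abs, sq_abs] at *
      linarith
    nlinarith [sq_nonneg (fderiv ℝ g y (EuclideanSpace.single i 1))]
  have hcont : ∀ i : Fin n, Continuous fun y => fderiv ℝ g y (EuclideanSpace.single i 1) :=
    fun i => (hg.contDiff.continuous_fderiv (by simp)).clm_apply continuous_const
  have hint : ∀ i : Fin n, IntegrableOn (fun y => fderiv ℝ g y (EuclideanSpace.single i 1) ^ 2)
      (Metric.ball 0 1) := fun i => (memLp_two_ball (hcont i) 0 1).integrable_sq
  set J := ∫ x in Metric.ball (0 : E n) (1 / 2), g x ^ 2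
  have hJ : 0 ≤ J := integral_nonneg fun _ => sq_nonneg _
  calc ∫ y in Metric.ball (0 : E n) 1, s ^ 2 * fderiv ℝ f (x0 + s • y) v ^ 2
      ≤ ∫ y in Metric.ball (0 : E n) 1, n * ∑ i, fderiv ℝ g y (EuclideanSpace.single i 1) ^ 2 := by
        refine integral_mono_of_nonneg (ae_of_all _ fun y => by positivity) ?_ (ae_of_all _ hpt)
        exact (integrable_finsetSum _ fun i _ => hint i).const_mul _
    _ = n * ∑ i, ∫ y in Metric.ball (0 : E n) 1, fderiv ℝ g y (EuclideanSpace.single i 1) ^ 2 := by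
        rw [integral_const_mul, integral_finsetSum _ fun i _ => hint i]
    _ ≤ n * ∑ i, C i * J := by
        gcongr with i
        exact h i ⟨g, mem_PF.2 hg⟩
    _ ≤ _ := by
        rw [← Finset.sum_mul]
        nlinarith

end

section

/-! ### The divergence theorem in a half-space -/

variable {n : ℕ}

lemma exists_basis_head {ν : E (n + 1)} (hν : ‖ν‖ = 1) :
    ∃ B : OrthonormalBasis (Fin (n + 1)) ℝ (E (n + 1)), B 0 = ν := by
  obtain ⟨B, hB⟩ := Orthonormal.exists_orthonormalBasis_extension_of_card_eq
    (𝕜 := ℝ) (E := E (n + 1)) (ι := Fin (n + 1)) (by simp) (v := fun _ => ν) (s := {0})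
    ⟨fun i => by simpa using hν, fun i j hij => (hij (Subsingleton.elim _ _)).elim⟩
  exact ⟨B, hB 0 rfl⟩

/-- Coordinates in an orthonormal frame. -/
def frameMap (B : OrthonormalBasis (Fin (n + 1)) ℝ (E (n + 1))) (x0 : E (n + 1))
    (y : Fin (n + 1) → ℝ) : E (n + 1) := x0 + B.repr.symm (WithLp.toLp 2 y)

/-- Coordinates of the hyperplane through `x0` orthogonal to `B 0`. -/
def hypMap (B : OrthonormalBasis (Fin (n + 1)) ℝ (E (n + 1))) (x0 : E (n + 1))
    (y : E n) : E (n + 1) := x0 + ∑ i, y i • B i.succ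

/-- Coordinates, in the hyperplane, of the orthogonal projection of a point. -/
def hypProj (B : OrthonormalBasis (Fin (n + 1)) ℝ (E (n + 1))) (x0 : E (n + 1))
    (x : E (n + 1)) : E n := WithLp.toLp 2 fun i => inner ℝ (B i.succ) (x - x0)

section Frame

variable (B : OrthonormalBasis (Fin (n + 1)) ℝ (E (n + 1))) (x0 : E (n + 1))

lemma frameMap_eq (y : Fin (n + 1) → ℝ) : frameMap B x0 y = x0 + ∑ i, y i • B i := by
  rw [frameMap, ← B.sum_repr_symm]

lemma inner_frameMap (y : Fin (n + 1) → ℝ) (i : Fin (n + 1)) :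
    inner ℝ (B i) (frameMap B x0 y - x0) = y i := by
  rw [frameMap, add_sub_cancel_left, ← B.repr_apply_apply, LinearIsometryEquiv.apply_symm_apply]

lemma measurePreserving_frameMap : MeasurePreserving (frameMap B x0) volume volume :=
  (measurePreserving_add_left volume x0).comp
    (B.measurePreserving_repr_symm.comp (PiLp.volume_preserving_toLp (Fin (n + 1))))

lemma measurableEmbedding_frameMap : MeasurableEmbedding (frameMap B x0) :=
  (measurableEmbedding_addLeft x0).comp
    (B.repr.symm.toHomeomorph.measurableEmbedding.comp
      (MeasurableEquiv.toLp 2 (Fin (n + 1) → ℝ)).measurableEmbedding)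

lemma hypMap_eq_frameMap (y : E n) :
    hypMap B x0 y = frameMap B x0 ((0 : Fin (n + 1)).insertNth 0 y.ofLp) := by
  rw [frameMap_eq, Fin.sum_univ_succ]
  simp [hypMap]

lemma hypMap_sub (y y' : E n) : hypMap B x0 y - hypMap B x0 y' = ∑ i, (y - y') i • B i.succ := by
  simp [hypMap, sub_smul, Finset.sum_sub_distrib]

lemma isometry_hypMap : Isometry (hypMap B x0) := by
  refine Isometry.of_dist_eq fun y y' => ?_
  rw [dist_eq_norm, dist_eq_norm, hypMap_sub]
  have h : Orthonormal ℝ fun i : Fin n => B i.succ := B.orthonormal.comp _ (Fin.succ_injective n)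
  have h1 := h.inner_sum (fun i => (y - y') i) (fun i => (y - y') i) Finset.univ
  rw [real_inner_self_eq_norm_sq] at h1
  have h2 := EuclideanSpace.real_norm_sq_eq (y - y')
  rw [← sq_eq_sq₀ (norm_nonneg _) (norm_nonneg _), h1, h2]
  simp [sq]

lemma inner_zero_hypMap (y : E n) : inner ℝ (B 0) (hypMap B x0 y) = inner ℝ (B 0) x0 := by
  have := inner_frameMap B x0 ((0 : Fin (n + 1)).insertNth 0 y.ofLp) 0
  rw [← hypMap_eq_frameMap, inner_sub_right] at this
  simp at this
  linarith

lemma hypMap_hypProj {x : E (n + 1)} (hx : inner ℝ (B 0) x = inner ℝ (B 0) x0) :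
    hypMap B x0 (hypProj B x0 x) = x := by
  have h := B.sum_repr' (x - x0)
  rw [Fin.sum_univ_succ, inner_sub_right, hx, sub_self, zero_smul, zero_add] at h
  simp only [hypMap, hypProj]
  rw [h]
  abel

lemma range_hypMap : range (hypMap B x0) = {x | inner ℝ (B 0) x = inner ℝ (B 0) x0} := by
  ext x
  refine ⟨?_, fun hx => ⟨_, hypMap_hypProj B x0 hx⟩⟩
  rintro ⟨y, rfl⟩
  exact inner_zero_hypMap B x0 y

lemma continuous_hypMap : Continuous (hypMap B x0) := (isometry_hypMap B x0).continuous

lemma measurableEmbedding_hypMap : MeasurableEmbedding (hypMap B x0) :=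
  (isometry_hypMap B x0).isClosedEmbedding.measurableEmbedding

/-- The Hausdorff measure on a hyperplane is Lebesgue measure. -/
lemma restrict_hyperplane_eq_map :
    (Measure.euclideanHausdorffMeasure n).restrict {x | inner ℝ (B 0) x = inner ℝ (B 0) x0} =
      (volume : Measure (E n)).map (hypMap B x0) := by
  rw [← range_hypMap, ← (isometry_hypMap B x0).map_euclideanHausdorffMeasure,
    EuclideanSpace.euclideanHausdorffMeasure_eq_volume]

end Frame

/-- The classical divergence of a vector field. -/
def dvg {d : ℕ} (V : E d → E d) (x : E d) : ℝ :=
  LinearMap.trace ℝ (E d) (fderiv ℝ V x).toLinearMap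

lemma dvg_eq_sum {d : ℕ} (B : OrthonormalBasis (Fin d) ℝ (E d)) (V : E d → E d) (x : E d) :
    dvg V x = ∑ i, inner ℝ (B i) (fderiv ℝ V x (B i)) :=
  LinearMap.trace_eq_sum_inner _ B

lemma continuous_dvg {d : ℕ} {V : E d → E d} (hV : ContDiff ℝ 1 V) : Continuous (dvg V) := by
  have : dvg V = fun x => ∑ i, inner ℝ (EuclideanSpace.basisFun (Fin d) ℝ i)
      (fderiv ℝ V x (EuclideanSpace.basisFun (Fin d) ℝ i)) := by
    ext x
    exact dvg_eq_sum _ V x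
  rw [this]
  have := hV.continuous_fderiv (by simp)
  fun_prop

lemma dvg_eq_zero_of_notMem {d : ℕ} {V : E d → E d} {x : E d} (hx : x ∉ tsupport V) :
    dvg V x = 0 := by
  have : fderiv ℝ V x = 0 :=
    image_eq_zero_of_notMem_tsupport fun h => hx (tsupport_fderiv_subset ℝ h)
  rw [dvg, this]
  simp

lemma dvg_smul {d : ℕ} {f : E d → ℝ} {V : E d → E d} (hf : ContDiff ℝ 1 f)
    (hV : ContDiff ℝ 1 V) (x : E d) :
    dvg (fun x => f x • V x) x = inner ℝ (V x) (gradient f x) + dvg V x * f x := by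
  have h1 := (hf.differentiable (by simp) x).hasFDerivAt
  have h2 := (hV.differentiable (by simp) x).hasFDerivAt
  have h3 := (h1.smul h2).fderiv
  set B := EuclideanSpace.basisFun (Fin d) ℝ
  change dvg (f • V) x = _
  rw [dvg_eq_sum B, dvg_eq_sum B, h3]
  have hg : ∀ v, fderiv ℝ f x v = inner ℝ (gradient f x) v := fun v => by
    rw [gradient, InnerProductSpace.toDual_symm_apply]
  simp only [add_apply, smul_apply,
    ContinuousLinearMap.smulRight_apply, inner_add_right, inner_smul_right, hg,
    Finset.sum_add_distrib]
  rw [add_comm, ← Finset.mul_sum, mul_comm (f x), ← B.sum_inner_mul_inner (V x) (gradient f x)]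
  congr 1
  exact Finset.sum_congr rfl fun i _ => by
    rw [mul_comm, real_inner_comm (B i) (V x), real_inner_comm (B i) (gradient f x)]

lemma hasCompactSupport_dvg {d : ℕ} {V : E d → E d} (hc : HasCompactSupport V) :
    HasCompactSupport (dvg V) :=
  hc.mono' fun x hx => by
    by_contra h
    exact hx (dvg_eq_zero_of_notMem h)

/-- The divergence theorem in a half-space, for fields of compact support. -/
theorem integral_halfspace_dvg {V : E (n + 1) → E (n + 1)} (hV : ContDiff ℝ 1 V)
    (hc : HasCompactSupport V) {ν : E (n + 1)} (hν : ‖ν‖ = 1) (c : ℝ) :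
    ∫ x in {x | inner ℝ ν x ≤ c}, dvg V x =
      ∫ x in {x | inner ℝ ν x = c}, inner ℝ ν (V x) ∂(Measure.euclideanHausdorffMeasure n) := by
  obtain ⟨B, rfl⟩ := exists_basis_head hν
  set x0 := c • B 0
  have hx0 : inner ℝ (B 0) x0 = c := by simp [x0, inner_smul_right]
  set Φ := frameMap B x0 with hΦ
  obtain ⟨R0, hR0⟩ := hc.isCompact.isBounded.subset_closedBall 0
  -- A point with some frame coordinate at least R in modulus lies at distance more than R0 from the
  -- origin, hence off the support.
  set R := |R0| + ‖x0‖ + 1 with hR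
  have hR1 : 0 < R := by positivity
  have hΦR : ∀ y i, R ≤ |y i| → Φ y ∉ tsupport V := by
    intro y i hi hy
    have h1 : ‖Φ y‖ ≤ R0 := by simpa using hR0 hy
    have h2 : |y i| ≤ ‖Φ y - x0‖ := by
      rw [← inner_frameMap B x0 y i]
      refine (abs_real_inner_le_norm _ _).trans ?_
      simp [Φ]
    have h3 := norm_sub_le (Φ y) x0
    have h4 := le_abs_self R0
    linarith
  -- The top face of the box lies in the hyperplane, where coordinate 0 vanishes; every other face
  -- is beyond the support. Of the boundary terms in the box formula, only the top one survives.
  set b : Fin (n + 1) → ℝ := fun i => if i = 0 then 0 else R with hb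
  set a : Fin (n + 1) → ℝ := fun _ => -R with ha
  have hab : a ≤ b := fun i => by
    simp only [ha, hb]
    split_ifs <;> linarith
  have hinn : ∀ y, inner ℝ (B 0) (Φ y) = y 0 + c := fun y => by
    have := inner_frameMap B x0 y 0
    rw [inner_sub_right, hx0] at this
    linarith
  have hΦlin : ∀ y, HasFDerivAt Φ (B.repr.symm.toContinuousLinearEquiv.toContinuousLinearMap ∘L
      (PiLp.continuousLinearEquiv 2 ℝ fun _ : Fin (n + 1) => ℝ).symm.toContinuousLinearMap) y :=
    fun y => ((B.repr.symm.toContinuousLinearEquiv.toContinuousLinearMap ∘L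
      (PiLp.continuousLinearEquiv 2 ℝ fun _ : Fin (n + 1) => ℝ).symm.toContinuousLinearMap
        ).hasFDerivAt (x := y)).const_add x0
  have hΦcont : Continuous Φ := continuous_iff_continuousAt.2 fun y => (hΦlin y).continuousAt
  have hVd : ∀ x, HasFDerivAt V (fderiv ℝ V x) x := fun x =>
    (hV.differentiable (by simp) x).hasFDerivAt
  have hdv : ∀ y, ∑ i, (innerSL ℝ (B i) ∘L (fderiv ℝ V (Φ y) ∘L
      (B.repr.symm.toContinuousLinearEquiv.toContinuousLinearMap ∘L
      (PiLp.continuousLinearEquiv 2 ℝ fun _ : Fin (n + 1) => ℝ).symm.toContinuousLinearMap)))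
        (Pi.single i 1) = dvg V (Φ y) := by
    intro y
    rw [dvg_eq_sum B]
    refine Finset.sum_congr rfl fun i _ => ?_
    have : B.repr.symm (WithLp.toLp 2 (Pi.single i (1 : ℝ))) = B i := by
      rw [← B.repr_symm_single]
      rfl
    simp
  have key := integral_divergence_of_hasFDerivAt_off_countable' a b hab
    (fun i y => inner ℝ (B i) (V (Φ y)))
    (fun i y => innerSL ℝ (B i) ∘L (fderiv ℝ V (Φ y) ∘L
      (B.repr.symm.toContinuousLinearEquiv.toContinuousLinearMap ∘L
      (PiLp.continuousLinearEquiv 2 ℝ fun _ : Fin (n + 1) => ℝ).symm.toContinuousLinearMap)))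
    ∅ countable_empty
    (fun i => (continuous_const.inner (hV.continuous.comp hΦcont)).continuousOn)
    (fun y _ i => (innerSL ℝ (B i)).hasFDerivAt.comp y ((hVd (Φ y)).comp y (hΦlin y)))
    (by
      simp only [hdv]
      exact ((continuous_dvg hV).comp hΦcont).continuousOn.integrableOn_compact isCompact_Icc)
  simp only [hdv] at key
  have hleft : ∫ y in Icc a b, dvg V (Φ y) = ∫ x in {x | inner ℝ (B 0) x ≤ c}, dvg V x := by
    have hH : MeasurableSet {x : E (n + 1) | inner ℝ (B 0) x ≤ c} :=
      (isClosed_le (by fun_prop) continuous_const).measurableSet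
    rw [← integral_indicator hH, ← (measurePreserving_frameMap B x0).integral_comp
      (measurableEmbedding_frameMap B x0), ← integral_indicator measurableSet_Icc]
    congr 1
    ext y
    by_cases hy : y ∈ Icc a b
    · have : Φ y ∈ {x | inner ℝ (B 0) x ≤ c} := by
        have := hy.2 0
        simp only [hb, if_true] at this
        simp only [mem_ofPred_eq, hinn]
        linarith
      rw [indicator_of_mem hy, indicator_of_mem this]
    · rw [indicator_of_notMem hy]
      by_cases hy2 : Φ y ∈ {x | inner ℝ (B 0) x ≤ c}
      · rw [indicator_of_mem hy2, dvg_eq_zero_of_notMem]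
        have hy0 : y 0 ≤ 0 := by
          simp only [mem_ofPred_eq, hinn] at hy2
          linarith
        by_contra hsupp
        apply hy
        have hlt : ∀ i, |y i| < R := fun i => by
          by_contra h
          exact hΦR y i (not_lt.1 h) hsupp
        refine ⟨fun i => (abs_lt.1 (hlt i)).1.le, fun i => ?_⟩
        simp only [hb]
        split_ifs with h
        · rw [h]; exact hy0
        · exact (abs_lt.1 (hlt i)).2.le
      · rw [indicator_of_notMem hy2]
  have hV0 : ∀ y i, R ≤ |y i| → V (Φ y) = 0 := fun y i h =>
    image_eq_zero_of_notMem_tsupport (hΦR y i h)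
  rw [← hleft, key, Finset.sum_eq_single 0]
  · have hback : ∀ y : Fin n → ℝ, V (Φ ((0 : Fin (n + 1)).insertNth (a 0) y)) = 0 := fun y =>
      hV0 _ 0 (by simp [ha, abs_of_pos hR1])
    simp only [hback, inner_zero_right, integral_zero, sub_zero]
    have hm := restrict_hyperplane_eq_map B x0
    rw [hx0] at hm
    rw [hm, (measurableEmbedding_hypMap B x0).integral_map,
      ← (PiLp.volume_preserving_toLp (Fin n)).integral_comp
        (MeasurableEquiv.toLp 2 (Fin n → ℝ)).measurableEmbedding,
      ← integral_indicator measurableSet_Icc]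
    congr 1
    ext y
    have hb0 : b 0 = 0 := by simp [hb]
    rw [hypMap_eq_frameMap, hb0]
    by_cases hy : y ∈ Icc (a ∘ (0 : Fin (n + 1)).succAbove) (b ∘ (0 : Fin (n + 1)).succAbove)
    · rw [indicator_of_mem hy]
    · rw [indicator_of_notMem hy]
      obtain ⟨i, hi⟩ : ∃ i, R ≤ |y i| := by
        by_contra! h
        exact hy ⟨fun i => (abs_lt.1 (h i)).1.le, fun i => by
          simpa [hb] using (abs_lt.1 (h i)).2.le⟩
      have := hV0 ((0 : Fin (n + 1)).insertNth 0 y) i.succ (by simpa using hi)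
      simp only [Φ] at this
      rw [this, inner_zero_right]
  · intro i _ hi
    have h1 : ∀ y : Fin n → ℝ, V (Φ (i.insertNth (a i) y)) = 0 := fun y =>
      hV0 _ i (by simp [ha, abs_of_pos hR1])
    have h2 : ∀ y : Fin n → ℝ, V (Φ (i.insertNth (b i) y)) = 0 := fun y =>
      hV0 _ i (by simp [hb, hi, abs_of_pos hR1])
    simp [h1, h2]
  · simp

end

section

/-! ### Geometry of mesh elements -/

variable {n : ℕ}

/-- The description of an element of `ℝⁿ⁺¹` as an intersection of half-spaces, one for each facet,
with an interior point and a relative interior point of each facet. -/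
structure Frame (K : Element (n + 1)) where
  nrm : K.FacetIdx → E (n + 1)
  off : K.FacetIdx → ℝ
  ht : K.FacetIdx → ℝ
  ctr : E (n + 1)
  fctr : K.FacetIdx → E (n + 1)
  norm_nrm : ∀ F, ‖nrm F‖ = 1
  mem_carrier : ∀ x, x ∈ K.carrier ↔ ∀ F, inner ℝ (nrm F) x ≤ off F
  mem_facet : ∀ F x, x ∈ K.facet F ↔ x ∈ K.carrier ∧ inner ℝ (nrm F) x = off F
  ht_pos : ∀ F, 0 < ht F
  ht_le : ∀ F, ht F ≤ K.altitude F
  slab : ∀ F, ∀ x ∈ K.carrier, off F - ht F ≤ inner ℝ (nrm F) x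
  ctr_le : ∀ F, inner ℝ (nrm F) ctr + ht F / (n + 2) ≤ off F
  fctr_eq : ∀ F, inner ℝ (nrm F) (fctr F) = off F
  fctr_le : ∀ F F', F' ≠ F → inner ℝ (nrm F') (fctr F) + ht F' / (n + 2) ≤ off F'

lemma Element.isCompact_carrier : ∀ K : Element (n + 1), IsCompact K.carrier
  | .simplex v hv =>
    show IsCompact (convexHull ℝ (range v)) from
      Set.Finite.isCompact_convexHull (𝕜 := ℝ) (finite_range v)
  | .cuboid a b ℓ hℓ => by
    have : (Element.cuboid a b ℓ hℓ).carrier = frameMap b a '' Icc 0 ℓ := by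
      ext x
      constructor
      · intro hx
        refine ⟨fun i => inner ℝ (b i) (x - a), ⟨fun i => (hx i).1, fun i => (hx i).2⟩, ?_⟩
        rw [frameMap_eq, b.sum_repr']
        abel
      · rintro ⟨y, hy, rfl⟩ i
        rw [inner_frameMap]
        exact ⟨hy.1 i, hy.2 i⟩
    rw [this]
    refine isCompact_Icc.image ?_
    unfold frameMap
    exact continuous_const.add (b.repr.symm.continuous.comp (PiLp.continuous_toLp 2 _))

lemma Element.convex_carrier : ∀ K : Element (n + 1), Convex ℝ K.carrier
  | .simplex v hv => convex_convexHull _ _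
  | .cuboid a b ℓ hℓ => by
    intro x hx y hy s t hs ht hst i
    have h : inner ℝ (b i) (s • x + t • y - a) =
        s * inner ℝ (b i) (x - a) + t * inner ℝ (b i) (y - a) := by
      simp only [inner_sub_right, inner_add_right, inner_smul_right]
      linear_combination inner ℝ (b i) a * hst
    rw [h]
    exact (convex_Icc 0 (ℓ i)) (hx i) (hy i) hs ht hst

/-- For a simplex, any other vertex lies in the span of the opposite facet; for a cuboid, the
altitude is the length of an edge. This allows h_⊥F to be replaced by h_K in the boundary part of
the norm. -/
lemma Element.altitude_le_diam : ∀ (K : Element (n + 1)) (F : K.FacetIdx), K.altitude F ≤ K.diam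
  | .simplex v hv, (i : Fin (n + 1 + 1)) => by
    obtain ⟨j, hj⟩ := exists_ne i
    have hmem : ∀ k, v k ∈ (Element.simplex v hv).carrier := fun k =>
      subset_convexHull ℝ _ (mem_range_self k)
    calc Metric.infDist (v i) (affineSpan ℝ (v '' {i}ᶜ) : Set (E (n + 1)))
        ≤ dist (v i) (v j) := Metric.infDist_le_dist_of_mem
          (subset_affineSpan ℝ _ (mem_image_of_mem v hj))
      _ ≤ _ := Metric.dist_le_diam_of_mem (Element.isCompact_carrier _).isBounded
        (hmem i) (hmem j)
  | .cuboid a b ℓ hℓ, (i, s) => by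
    have h0 : a ∈ (Element.cuboid a b ℓ hℓ).carrier := fun j => by
      simpa using (hℓ j).le
    have h1 : a + ℓ i • b i ∈ (Element.cuboid a b ℓ hℓ).carrier := fun j => by
      rw [add_sub_cancel_left, inner_smul_right, orthonormal_iff_ite.1 b.orthonormal]
      split_ifs with h
      · subst h; simpa using (hℓ j).le
      · simpa using (hℓ j).le
    have := Metric.dist_le_diam_of_mem (Element.isCompact_carrier _).isBounded h1 h0
    rw [dist_eq_norm, add_sub_cancel_left, norm_smul, b.orthonormal.1 i, mul_one,
      Real.norm_of_nonneg (hℓ i).le] at this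
    exact this

/-- The half-space description of a cuboid. -/
def cuboidFrame (a : E (n + 1)) (b : OrthonormalBasis (Fin (n + 1)) ℝ (E (n + 1)))
    (ℓ : Fin (n + 1) → ℝ) (hℓ : ∀ i, 0 < ℓ i) : Frame (.cuboid a b ℓ hℓ) :=
  have key : ∀ (c : Fin (n + 1) → ℝ) i, inner ℝ (b i) (frameMap b a c) = inner ℝ (b i) a + c i :=
    fun c i => by
      have := inner_frameMap b a c i
      rw [inner_sub_right] at this
      linarith
  have hn : (0 : ℝ) ≤ n := n.cast_nonneg
  -- The fraction 1/(n + 2) is dictated by the barycentre of a simplex. The centre of a cuboid has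
  -- relative distance 1/2 to every face, which is no worse.
  have half : ∀ i, ℓ i / (n + 2) ≤ ℓ i / 2 := fun i =>
    div_le_div_of_nonneg_left (hℓ i).le (by norm_num) (by linarith)
  { nrm := fun F : Fin (n + 1) × Bool => if F.2 then b F.1 else -b F.1
    off := fun F : Fin (n + 1) × Bool =>
      if F.2 then inner ℝ (b F.1) a + ℓ F.1 else -inner ℝ (b F.1) a
    ht := fun F : Fin (n + 1) × Bool => ℓ F.1
    ctr := frameMap b a fun i => ℓ i / 2
    fctr := fun F : Fin (n + 1) × Bool =>
      frameMap b a fun i => if i = F.1 then (if F.2 then ℓ i else 0) else ℓ i / 2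
    norm_nrm := by
      rintro ⟨i, s⟩
      cases s <;> simp
    mem_carrier := by
      intro x
      change (∀ i, inner ℝ (b i) (x - a) ∈ Icc 0 (ℓ i)) ↔ ∀ F : Fin (n + 1) × Bool, _
      simp only [Prod.forall, Bool.forall_bool, inner_sub_right, mem_Icc]
      refine forall_congr' fun i => ?_
      simp only [Bool.false_eq_true, if_false, if_true, inner_neg_left]
      constructor
      · rintro ⟨h1, h2⟩; constructor <;> linarith
      · rintro ⟨h1, h2⟩; constructor <;> linarith
    mem_facet := by
      rintro ⟨i, s⟩ x
      change _ ∧ inner ℝ (b i) (x - a) = (if s then ℓ i else 0) ↔ _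
      refine and_congr_right fun _ => ?_
      cases s
      · simp only [Bool.false_eq_true, if_false, inner_neg_left, inner_sub_right]
        constructor <;> intro h <;> linarith
      · simp only [if_true, inner_sub_right]
        constructor <;> intro h <;> linarith
    ht_pos := by rintro ⟨i, s⟩; exact hℓ i
    ht_le := by rintro ⟨i, s⟩; exact le_rfl
    slab := by
      rintro ⟨i, s⟩ x hx
      have := hx i
      rw [inner_sub_right] at this
      obtain ⟨h1, h2⟩ := this
      cases s
      · simp only [Bool.false_eq_true, if_false, inner_neg_left]; linarith
      · simp only [if_true]; linarith
    ctr_le := by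
      rintro ⟨i, s⟩
      have := half i
      cases s
      · simp only [Bool.false_eq_true, if_false, inner_neg_left, key]; linarith
      · simp only [if_true, key]; linarith
    fctr_eq := by
      rintro ⟨i, s⟩
      cases s
      · simp only [Bool.false_eq_true, if_false, inner_neg_left, key, if_true]; linarith
      · simp only [if_true, key]
    fctr_le := by
      rintro ⟨i, s⟩ ⟨j, t⟩ hne
      have h1 := half j
      have h2 := hℓ j
      -- The face opposite to the given one is at the full distance ℓ; the faces in the other
      -- directions are at half of it.
      by_cases hij : j = i
      · subst hij
        cases s <;> cases t
        · exact (hne rfl).elim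
        · simp only [if_true, if_false, Bool.false_eq_true, key]; linarith
        · simp only [if_true, if_false, Bool.false_eq_true, key, inner_neg_left]; linarith
        · exact (hne rfl).elim
      · cases t
        · simp only [if_false, Bool.false_eq_true, key, inner_neg_left, hij]; linarith
        · simp only [if_true, if_false, key, hij]; linarith }

/-- The affine basis given by the vertices of a simplex. -/
def simplexBasis (v : Fin (n + 1 + 1) → E (n + 1)) (hv : AffineIndependent ℝ v) :
    AffineBasis (Fin (n + 1 + 1)) ℝ (E (n + 1)) :=
  ⟨v, hv, hv.affineSpan_eq_top_iff_card_eq_finrank_add_one.2 (by simp)⟩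

/-- The gradient of a barycentric coordinate. -/
def baryGrad (v : Fin (n + 1 + 1) → E (n + 1)) (hv : AffineIndependent ℝ v)
    (i : Fin (n + 1 + 1)) : E (n + 1) :=
  (InnerProductSpace.toDual ℝ (E (n + 1))).symm
    (LinearMap.toContinuousLinearMap ((simplexBasis v hv).coord i).linear)

section Simplex

variable (v : Fin (n + 1 + 1) → E (n + 1)) (hv : AffineIndependent ℝ v)

lemma coord_sub (i : Fin (n + 1 + 1)) (x y : E (n + 1)) :
    (simplexBasis v hv).coord i x - (simplexBasis v hv).coord i y =
      inner ℝ (baryGrad v hv i) (x - y) := by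
  rw [baryGrad, InnerProductSpace.toDual_symm_apply, ← vsub_eq_sub, ← AffineMap.linearMap_vsub]
  rfl

lemma coord_vertex (i j : Fin (n + 1 + 1)) :
    (simplexBasis v hv).coord i (v j) = if i = j then 1 else 0 :=
  (simplexBasis v hv).coord_apply i j

lemma norm_baryGrad_pos (i : Fin (n + 1 + 1)) : 0 < ‖baryGrad v hv i‖ := by
  rw [norm_pos_iff]
  intro h
  obtain ⟨j, hj⟩ := exists_ne i
  have := coord_sub v hv i (v i) (v j)
  rw [h, inner_zero_left, coord_vertex, coord_vertex, if_pos rfl, if_neg hj.symm] at this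
  norm_num at this

lemma coord_eq_offset (i : Fin (n + 1 + 1)) (x : E (n + 1)) :
    (simplexBasis v hv).coord i x =
      (simplexBasis v hv).coord i 0 + inner ℝ (baryGrad v hv i) x := by
  have := coord_sub v hv i x 0
  rw [sub_zero] at this
  linarith

/-- The barycentric coordinate is 1 at the vertex and 0 on the opposite span, and varies at rate at
most the norm of its gradient. -/
lemma one_div_le_infDist (i : Fin (n + 1 + 1)) : ‖baryGrad v hv i‖⁻¹ ≤
    Metric.infDist (v i) (affineSpan ℝ (v '' {i}ᶜ) : Set (E (n + 1))) := by
  obtain ⟨j, hj⟩ := exists_ne i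
  rw [Metric.le_infDist ⟨v j, subset_affineSpan ℝ _ (mem_image_of_mem v hj)⟩]
  intro y hy
  have hle : affineSpan ℝ (v '' {i}ᶜ) ≤
      (affineSpan ℝ {(0 : ℝ)}).comap ((simplexBasis v hv).coord i) := by
    rw [affineSpan_le]
    rintro _ ⟨k, hk, rfl⟩
    have : (simplexBasis v hv).coord i (v k) = 0 := by
      rw [coord_vertex, if_neg (Ne.symm hk)]
    simp [this]
  have h0 : (simplexBasis v hv).coord i y = 0 := by simpa using hle hy
  have h1 := coord_sub v hv i (v i) y
  rw [h0, coord_vertex, if_pos rfl, sub_zero] at h1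
  have h2 := real_inner_le_norm (baryGrad v hv i) (v i - y)
  rw [inv_eq_one_div, div_le_iff₀' (norm_baryGrad_pos v hv i), dist_eq_norm]
  linarith

/-- The half-space description of a simplex. -/
def simplexFrame : Frame (.simplex v hv) :=
  have hg := norm_baryGrad_pos v hv
  -- The outward normal is minus the normalised gradient of the barycentric coordinate, so each
  -- half-space condition says that this coordinate is nonnegative.
  have hL : ∀ i x, inner ℝ (-‖baryGrad v hv i‖⁻¹ • baryGrad v hv i) x =
      ‖baryGrad v hv i‖⁻¹ * (simplexBasis v hv).coord i 0 -
      ‖baryGrad v hv i‖⁻¹ * (simplexBasis v hv).coord i x := fun i x => by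
    rw [coord_eq_offset v hv i x, inner_smul_left]
    simp
    ring
  have hcar : ∀ x, x ∈ (Element.simplex v hv).carrier ↔
      ∀ i, 0 ≤ (simplexBasis v hv).coord i x := fun x => by
    have := (simplexBasis v hv).convexHull_eq_nonneg_coord
    exact (Set.ext_iff.1 this x)
  have hsum : ∀ x, ∑ i, (simplexBasis v hv).coord i x = 1 :=
    (simplexBasis v hv).sum_coord_apply_eq_one
  { nrm := fun i : Fin (n + 1 + 1) => -‖baryGrad v hv i‖⁻¹ • baryGrad v hv i
    off := fun i : Fin (n + 1 + 1) => ‖baryGrad v hv i‖⁻¹ * (simplexBasis v hv).coord i 0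
    ht := fun i : Fin (n + 1 + 1) => ‖baryGrad v hv i‖⁻¹
    ctr := Finset.univ.centroid ℝ v
    fctr := fun i : Fin (n + 1 + 1) => (Finset.univ.erase i).centroid ℝ v
    norm_nrm := fun i : Fin (n + 1 + 1) => by
      rw [norm_smul, norm_neg, norm_inv, norm_norm, inv_mul_cancel₀ (hg i).ne']
    mem_carrier := fun x => by
      rw [hcar]
      change _ ↔ ∀ i : Fin (n + 1 + 1), _
      refine forall_congr' fun i => ?_
      rw [hL]
      have := inv_pos.2 (hg i)
      constructor
      · intro h
        have := mul_nonneg this.le h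
        linarith
      · intro h
        exact nonneg_of_mul_nonneg_right (by linarith) this
    mem_facet := fun (i : Fin (n + 1 + 1)) x => by
      rw [hL, sub_eq_self, mul_eq_zero, or_iff_right (inv_pos.2 (hg i)).ne', hcar]
      constructor
      · intro hx
        have hsub : convexHull ℝ (v '' {i}ᶜ) ⊆
            (Element.simplex v hv).carrier ∩ {x | (simplexBasis v hv).coord i x = 0} := by
          refine convexHull_min ?_ ((convex_convexHull _ _).inter ?_)
          · rintro _ ⟨k, hk, rfl⟩
            exact ⟨subset_convexHull ℝ _ (mem_range_self k), by
              rw [mem_ofPred_eq, coord_vertex, if_neg (Ne.symm hk)]⟩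
          · exact (convex_singleton (0 : ℝ)).affine_preimage _
        exact ⟨(hcar x).1 (hsub hx).1, (hsub hx).2⟩
      · rintro ⟨h1, h2⟩
        -- With coordinate i equal to zero, the barycentric expansion is a convex combination of the
        -- remaining vertices.
        have hx : x = ∑ j ∈ Finset.univ.erase i, (simplexBasis v hv).coord j x • v j := by
          conv_lhs => rw [← (simplexBasis v hv).linear_combination_coord_eq_self x]
          rw [← Finset.add_sum_erase _ _ (Finset.mem_univ i), h2, zero_smul, zero_add]
          rfl
        rw [hx]
        refine (convex_convexHull ℝ _).sum_mem (fun j _ => h1 j) ?_ fun j hj => ?_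
        · have := hsum x
          rwa [← Finset.add_sum_erase _ _ (Finset.mem_univ i), h2, zero_add] at this
        · exact subset_convexHull ℝ _ (mem_image_of_mem v (Finset.ne_of_mem_erase hj))
    ht_pos := fun i : Fin (n + 1 + 1) => inv_pos.2 (hg i)
    ht_le := fun i : Fin (n + 1 + 1) => one_div_le_infDist v hv i
    slab := fun (i : Fin (n + 1 + 1)) x hx => by
      rw [hL]
      have h0 := (hcar x).1 hx
      have h1 : (simplexBasis v hv).coord i x ≤ 1 := by
        rw [← hsum x]
        exact Finset.single_le_sum (f := fun i => (simplexBasis v hv).coord i x)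
          (fun j _ => h0 j) (Finset.mem_univ i)
      have := inv_pos.2 (hg i)
      nlinarith
    -- All n + 2 barycentric coordinates of the centroid are equal.
    ctr_le := fun i : Fin (n + 1 + 1) => by
      have h : (simplexBasis v hv).coord i (Finset.univ.centroid ℝ v) = ((n : ℝ) + 2)⁻¹ := by
        have := (simplexBasis v hv).coord_apply_centroid (Finset.mem_univ i)
        rw [Finset.card_univ, Fintype.card_fin] at this
        push_cast at this
        rw [show (n : ℝ) + 2 = n + 1 + 1 by ring]
        exact this
      rw [hL, h, div_eq_mul_inv]
      linarith
    fctr_eq := fun i : Fin (n + 1 + 1) => by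
      have h : (simplexBasis v hv).coord i ((Finset.univ.erase i).centroid ℝ v) = 0 := by
        rw [Finset.centroid_def]
        exact (simplexBasis v hv).coord_apply_combination_of_notMem (Finset.notMem_erase i _)
          (Finset.sum_centroidWeights_eq_one_of_card_ne_zero ℝ _ (by simp))
      rw [hL, h, mul_zero, sub_zero]
    -- A facet has only n + 1 vertices; the resulting 1/(n + 1) is weakened to the common fraction
    -- 1/(n + 2).
    fctr_le := fun (i j : Fin (n + 1 + 1)) hij => by
      have h : (simplexBasis v hv).coord j ((Finset.univ.erase i).centroid ℝ v) =
          ((n : ℝ) + 1)⁻¹ := by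
        have := (simplexBasis v hv).coord_apply_centroid
          (Finset.mem_erase.2 ⟨hij, Finset.mem_univ j⟩)
        rw [Finset.card_erase_of_mem (Finset.mem_univ i), Finset.card_univ, Fintype.card_fin] at this
        push_cast at this
        exact this
      rw [hL, h, div_eq_mul_inv]
      have h1 : ((n : ℝ) + 2)⁻¹ ≤ ((n : ℝ) + 1)⁻¹ := by
        gcongr
        norm_num
      have h2 := mul_le_mul_of_nonneg_left h1 (inv_pos.2 (hg j)).le
      linarith }

end Simplex

/-- The half-space description of an element. -/
def Element.frame : (K : Element (n + 1)) → Frame K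
  | .simplex v hv => simplexFrame v hv
  | .cuboid a b ℓ hℓ => cuboidFrame a b ℓ hℓ

/-- The volume of a bounded set contained in a slab. -/
lemma volume_slab_le {s : Set (E (n + 1))} {ν : E (n + 1)} (hν : ‖ν‖ = 1) {c t h : ℝ}
    (ht : 0 ≤ t) (hh : 0 ≤ h) (hs : ∀ x ∈ s, c - t ≤ inner ℝ ν x ∧ inner ℝ ν x ≤ c)
    (hd : ∀ x ∈ s, ∀ y ∈ s, dist x y ≤ h) : volume.real s ≤ t * (2 * h) ^ n := by
  rcases s.eq_empty_or_nonempty with rfl | ⟨x0, hx0⟩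
  · simp only [measureReal_empty]; positivity
  obtain ⟨B, rfl⟩ := exists_basis_head hν
  set e := inner ℝ (B 0) x0
  -- In a frame starting with ν, the slab limits coordinate 0 to an interval of length t, and the
  -- diameter limits each of the n others to length 2h.
  set lo : Fin (n + 1) → ℝ := fun i => if i = 0 then c - t - e else -h
  set hi : Fin (n + 1) → ℝ := fun i => if i = 0 then c - e else h
  have hle : lo ≤ hi := fun i => by
    simp only [lo, hi]
    split_ifs <;> linarith
  have hsub : frameMap B x0 ⁻¹' s ⊆ Icc lo hi := by
    intro y hy
    have h0 := hs _ hy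
    have hy0 := inner_frameMap B x0 y 0
    rw [inner_sub_right] at hy0
    have habs : ∀ i, |y i| ≤ h := fun i => by
      rw [← inner_frameMap B x0 y i]
      refine (abs_real_inner_le_norm _ _).trans ?_
      rw [B.orthonormal.1 i, one_mul, ← dist_eq_norm]
      exact hd _ hy _ hx0
    refine ⟨fun i => ?_, fun i => ?_⟩
    · simp only [lo]
      split_ifs with hi0
      · subst hi0; linarith [h0.1]
      · exact (abs_le.1 (habs i)).1
    · simp only [hi]
      split_ifs with hi0
      · subst hi0; linarith [h0.2]
      · exact (abs_le.1 (habs i)).2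
  have h1 : volume s = volume (frameMap B x0 ⁻¹' s) :=
    ((measurePreserving_frameMap B x0).measure_preimage_emb
      (measurableEmbedding_frameMap B x0) s).symm
  have h2 : (volume (Icc lo hi)).toReal = t * (2 * h) ^ n := by
    rw [Real.volume_Icc_pi_toReal hle, Fin.prod_univ_succ]
    simp [lo, hi]
    left; ring
  rw [measureReal_def, h1, ← h2]
  exact ENNReal.toReal_mono (isCompact_Icc.measure_lt_top.ne) (measure_mono hsub)

lemma Frame.diam_pos {K : Element (n + 1)} (f : Frame K) (F : K.FacetIdx) : 0 < K.diam :=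
  (f.ht_pos F).trans_le ((f.ht_le F).trans (K.altitude_le_diam F))

/-- Shape regularity bounds the heights from below. -/
lemma Frame.le_ht {K : Element (n + 1)} (f : Frame K) {κ : ℝ} (hκ : κ ≤ K.shapeReg)
    (F : K.FacetIdx) : κ / 2 ^ n * K.diam ≤ f.ht F := by
  have hd := f.diam_pos F
  -- The element lies in a slab of thickness `ht`, so |K| ≤ ht (2 h_K)^n, whereas shape regularity
  -- gives |K| ≥ κ h_K^(n+1).
  have h := volume_slab_le (s := K.carrier) (f.norm_nrm F) (f.ht_pos F).le hd.le
    (fun x hx => ⟨f.slab F x hx, (f.mem_carrier x).1 hx F⟩)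
    (fun x hx y hy => Metric.dist_le_diam_of_mem K.isCompact_carrier.isBounded hx hy)
  rw [Element.shapeReg, le_div_iff₀ (by positivity)] at hκ
  have h1 := hκ.trans h
  rw [mul_pow, pow_succ] at h1
  have h2 : (0 : ℝ) < K.diam ^ n := by positivity
  rw [div_mul_eq_mul_div, div_le_iff₀ (by positivity)]
  nlinarith

end

section

/-! ### Elements of a mesh near the boundary -/

/-- A Lipschitz domain is regular open. -/
lemma IsLipschitzDomain.interior_closure_subset {d : ℕ} {Ω : Set (E d)}
    (hΩ : IsLipschitzDomain Ω) : interior (closure Ω) ⊆ Ω := by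
  intro x hx
  by_contra hxΩ
  have hfr : x ∈ frontier Ω :=
    ⟨interior_subset hx, fun h => hxΩ (interior_subset h)⟩
  obtain ⟨ν, r, L, γ, hν, hr, hγ, hiff⟩ := hΩ.lipschitz_boundary x hfr
  -- Near a boundary point inside the interior of the closure, a small move along ν enters the open
  -- strict supergraph. Points of Ω are arbitrarily close to the point reached, but none of them can
  -- lie in the supergraph.
  have hcont : Continuous fun t : ℝ => x + t • ν := by fun_prop
  have h1 : ∀ᶠ t in 𝓝 (0 : ℝ), x + t • ν ∈ interior (closure Ω) ∩ Metric.ball x r := by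
    refine hcont.continuousAt.eventually_mem ?_
    rw [zero_smul, add_zero]
    exact (isOpen_interior.inter Metric.isOpen_ball).mem_nhds ⟨hx, Metric.mem_ball_self hr⟩
  obtain ⟨t, ⟨ht1, ht2⟩, ht0⟩ :=
    ((h1.filter_mono nhdsWithin_le_nhds).and (self_mem_nhdsWithin (s := Ioi (0 : ℝ)))).exists
  have ht0' : 0 < t := ht0
  have hxγ : γ (x - inner ℝ ν x • ν) ≤ inner ℝ ν x :=
    not_lt.1 fun h => hxΩ ((hiff x (Metric.mem_ball_self hr)).2 h)
  have hinn : inner ℝ ν (x + t • ν) = inner ℝ ν x + t := by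
    rw [inner_add_right, inner_smul_right, real_inner_self_eq_norm_sq, hν]
    ring
  have hproj : x + t • ν - inner ℝ ν (x + t • ν) • ν = x - inner ℝ ν x • ν := by
    rw [hinn, add_smul]
    abel
  have hopen : IsOpen {z : E d | γ (z - inner ℝ ν z • ν) < inner ℝ ν z} := by
    have := hγ.continuous
    exact isOpen_lt (this.comp (by fun_prop)) (by fun_prop)
  have hy : x + t • ν ∈ Metric.ball x r ∩ {z : E d | γ (z - inner ℝ ν z • ν) < inner ℝ ν z} := by
    refine ⟨ht2, ?_⟩
    rw [mem_ofPred_eq, hproj, hinn]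
    linarith
  obtain ⟨z, ⟨hz1, hz2⟩, hz3⟩ := mem_closure_iff.1 (interior_subset ht1) _
    (Metric.isOpen_ball.inter hopen) hy
  exact lt_asymm ((hiff z hz1).1 hz3) hz2

variable {n : ℕ}

namespace Frame

variable {K : Element (n + 1)} (f : Frame K)

lemma isOpen_strict (s : Set K.FacetIdx) : IsOpen {x | ∀ F ∈ s, inner ℝ (f.nrm F) x < f.off F} := by
  have : {x | ∀ F ∈ s, inner ℝ (f.nrm F) x < f.off F} =
      ⋂ F ∈ s, {x | inner ℝ (f.nrm F) x < f.off F} := by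
    ext; simp
  rw [this]
  exact s.toFinite.isOpen_biInter fun F _ => isOpen_lt (by fun_prop) continuous_const

lemma mem_interior {x : E (n + 1)} (hx : ∀ F, inner ℝ (f.nrm F) x < f.off F) :
    x ∈ interior K.carrier :=
  _root_.mem_interior.2 ⟨{x | ∀ F ∈ univ, inner ℝ (f.nrm F) x < f.off F},
    fun y hy => (f.mem_carrier y).2 fun F => (hy F (mem_univ F)).le,
    f.isOpen_strict univ, fun F _ => hx F⟩

lemma ctr_lt (F : K.FacetIdx) : inner ℝ (f.nrm F) f.ctr < f.off F := by
  have h1 := f.ctr_le F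
  have h2 := f.ht_pos F
  have h3 : 0 < f.ht F / ((n : ℝ) + 2) := by positivity
  linarith

lemma fctr_lt {F F' : K.FacetIdx} (h : F' ≠ F) :
    inner ℝ (f.nrm F') (f.fctr F) < f.off F' := by
  have h1 := f.fctr_le F F' h
  have h2 := f.ht_pos F'
  have h3 : 0 < f.ht F' / ((n : ℝ) + 2) := by positivity
  linarith

lemma interior_nonempty (f : Frame K) : (interior K.carrier).Nonempty := ⟨f.ctr, f.mem_interior f.ctr_lt⟩

/-- An arbitrarily small step along the outward normal leaves the half-space. -/
lemma notMem_interior {x : E (n + 1)} {F : K.FacetIdx} (hx : inner ℝ (f.nrm F) x = f.off F) :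
    x ∉ interior K.carrier := by
  intro h
  have hcont : Continuous fun t : ℝ => x + t • f.nrm F := by fun_prop
  have h1 : ∀ᶠ t in 𝓝 (0 : ℝ), x + t • f.nrm F ∈ interior K.carrier := by
    refine hcont.continuousAt.eventually_mem ?_
    rw [zero_smul, add_zero]
    exact isOpen_interior.mem_nhds h
  obtain ⟨t, ht1, ht0⟩ :=
    ((h1.filter_mono nhdsWithin_le_nhds).and (self_mem_nhdsWithin (s := Ioi (0 : ℝ)))).exists
  have ht0' : 0 < t := ht0
  have h2 := (f.mem_carrier _).1 (interior_subset ht1) F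
  rw [inner_add_right, inner_smul_right, real_inner_self_eq_norm_sq, f.norm_nrm, hx] at h2
  linarith

lemma mem_carrier_of_relint {x : E (n + 1)} {F : K.FacetIdx}
    (hx : inner ℝ (f.nrm F) x ≤ f.off F) (hx' : ∀ F' ≠ F, inner ℝ (f.nrm F') x < f.off F') :
    x ∈ K.carrier := by
  rw [f.mem_carrier]
  intro F'
  by_cases h : F' = F
  · rw [h]; exact hx
  · exact (hx' F' h).le

lemma facet_nonempty_idx (K : Element (n + 1)) : Nonempty K.FacetIdx := by
  cases K
  · exact inferInstanceAs (Nonempty (Fin (n + 1 + 1)))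
  · exact inferInstanceAs (Nonempty (Fin (n + 1) × Bool))

/-- A point of the element at which all the constraints are strict is interior. -/
lemma frontier_subset : frontier K.carrier ⊆ ⋃ F, {x | inner ℝ (f.nrm F) x = f.off F} := by
  intro x hx
  have hxK : x ∈ K.carrier := K.isCompact_carrier.isClosed.frontier_subset hx
  by_contra h
  simp only [mem_iUnion, not_exists, mem_ofPred_eq] at h
  exact hx.2 (f.mem_interior fun F => lt_of_le_of_ne ((f.mem_carrier x).1 hxK F) (h F))

lemma dimH_hyperplane {ν : E (n + 1)} (hν : ‖ν‖ = 1) {x0 : E (n + 1)} :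
    dimH {x | inner ℝ ν x = inner ℝ ν x0} = n := by
  obtain ⟨B, rfl⟩ := exists_basis_head hν
  rw [← range_hypMap, ← image_univ, (isometry_hypMap B x0).dimH_image,
    Real.dimH_univ_eq_finrank]
  simp

/-- The frontier lies in finitely many hyperplanes, and contains an isometric copy of an open set of
ℝⁿ around the centre of a facet. -/
lemma dimH_frontier (f : Frame K) : dimH (frontier K.carrier) = n := by
  refine le_antisymm ?_ ?_
  · refine (dimH_mono f.frontier_subset).trans ?_
    rw [dimH_iUnion]
    refine iSup_le fun F => ?_
    rw [← f.fctr_eq F, dimH_hyperplane (f.norm_nrm F)]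
  · obtain ⟨F⟩ := facet_nonempty_idx K
    obtain ⟨B, hB⟩ := exists_basis_head (f.norm_nrm F)
    set O := hypMap B (f.fctr F) ⁻¹' {x | ∀ F' ∈ ({F}ᶜ : Set _), inner ℝ (f.nrm F') x < f.off F'}
    have hO : IsOpen O := (f.isOpen_strict _).preimage (continuous_hypMap B _)
    have h0 : (0 : E n) ∈ O := fun F' hF' => by
      have : hypMap B (f.fctr F) 0 = f.fctr F := by simp [hypMap]
      rw [this]
      exact f.fctr_lt hF'
    have hsub : hypMap B (f.fctr F) '' O ⊆ frontier K.carrier := by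
      rintro _ ⟨y, hy, rfl⟩
      have h1 : inner ℝ (f.nrm F) (hypMap B (f.fctr F) y) = f.off F := by
        rw [← hB, inner_zero_hypMap, hB, f.fctr_eq]
      exact ⟨subset_closure (f.mem_carrier_of_relint h1.le hy), f.notMem_interior h1⟩
    have h2 := dimH_mono hsub
    rw [(isometry_hypMap B _).dimH_image, Real.dimH_of_nonempty_interior
      ⟨0, hO.interior_eq.symm ▸ h0⟩] at h2
    simpa using h2

end Frame

namespace Mesh

variable {Ω : Set (E (n + 1))} (T : Mesh Ω)

/-- Because of this, fluxes supported in K alone are admissible in X_K. -/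
lemma self_mem_nbhd (K : Fin T.card) : K ∈ T.nbhd K := by
  change dimH _ = _
  rw [inter_self, (T.elt K).frame.dimH_frontier]
  simp

lemma carrier_subset (K : Fin T.card) : (T.elt K).carrier ⊆ closure Ω := by
  rw [← T.cover]
  exact subset_iUnion (fun K => (T.elt K).carrier) K

/-- The mesh covers only the closure of Ω; regular openness of Ω brings interiors back inside. -/
lemma interior_subset_domain (hΩ : IsLipschitzDomain Ω) (K : Fin T.card) :
    interior (T.elt K).carrier ⊆ Ω :=
  (interior_mono (T.carrier_subset K)).trans hΩ.interior_closure_subset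

/-- The frontier of a convex set is null. -/
lemma carrier_ae_subset (hΩ : IsLipschitzDomain Ω) (K : Fin T.card) :
    (T.elt K).carrier ≤ᵐ[volume] Ω := by
  have h := (T.elt K).convex_carrier.addHaar_frontier volume
  filter_upwards [compl_mem_ae_iff.2 h] with x hx hxK
  refine T.interior_subset_domain hΩ K ?_
  by_contra hi
  exact hx ⟨subset_closure hxK, hi⟩

lemma restrict_carrier_le (hΩ : IsLipschitzDomain Ω) (K : Fin T.card) :
    volume.restrict (T.elt K).carrier ≤ volume.restrict Ω :=
  Measure.restrict_mono' (T.carrier_ae_subset hΩ K) le_rfl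

lemma exists_mem_carrier {x : E (n + 1)} (hx : x ∈ closure Ω) : ∃ K, x ∈ (T.elt K).carrier := by
  rw [← T.cover] at hx
  exact mem_iUnion.1 hx

/-- A point in the relative interior of a boundary facet lies in no other element. -/
lemma notMem_of_relint (hΩ : IsLipschitzDomain Ω) {K K' : Fin T.card} (hK : K' ≠ K)
    (f : Frame (T.elt K)) {F : (T.elt K).FacetIdx} (hF : T.IsBoundaryFacet K F)
    {y : E (n + 1)} (hy : inner ℝ (f.nrm F) y = f.off F)
    (hy' : ∀ F' ≠ F, inner ℝ (f.nrm F') y < f.off F') : y ∉ (T.elt K').carrier := by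
  intro hyK'
  have hyK : y ∈ (T.elt K).carrier := f.mem_carrier_of_relint hy.le hy'
  have hyΩ : y ∉ Ω := fun h =>
    (hF ((f.mem_facet F y).2 ⟨hyK, hy⟩)).2 (hΩ.isOpen.interior_eq.symm ▸ h)
  set ν := f.nrm F
  set c := f.off F
  set W : Set (E (n + 1)) := {x | ∀ F' ∈ ({F}ᶜ : Set _), inner ℝ (f.nrm F') x < f.off F'} with hW
  have hWo : IsOpen W := f.isOpen_strict _
  have hyW : y ∈ W := hy'
  have hWK : ∀ x ∈ W, inner ℝ ν x ≤ c → x ∈ (T.elt K).carrier := fun x hx hx' =>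
    f.mem_carrier_of_relint hx' hx
  -- By conformity the common face is where some functional l is maximal on K. Since y is relatively
  -- interior to F, a nearby u in the hyperplane and its reflection 2y - u both lie in K; maximality
  -- at y then forces l u = l y, so u belongs to K' too.
  obtain ⟨l, hl⟩ := T.conforming K K' hK.symm ⟨y, hyK, hyK'⟩
  have hly : ∀ w ∈ (T.elt K).carrier, l w ≤ l y := by
    have : y ∈ {x ∈ (T.elt K).carrier | ∀ w ∈ (T.elt K).carrier, l w ≤ l x} := hl ▸ ⟨hyK, hyK'⟩
    exact this.2
  -- a relative neighbourhood of `y` in the hyperplane lies in `K'`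
  have hrel : ∀ᶠ u in 𝓝 y, inner ℝ ν u = c → u ∈ (T.elt K').carrier := by
    have h2 : ∀ᶠ u in 𝓝 y, (2 : ℝ) • y - u ∈ W := by
      refine ContinuousAt.eventually_mem (f := fun u => (2 : ℝ) • y - u) (by fun_prop) ?_
      refine hWo.mem_nhds ?_
      have : (2 : ℝ) • y - y = y := by rw [two_smul]; abel
      rwa [this]
    filter_upwards [hWo.mem_nhds hyW, h2] with u hu1 hu2 huc
    have h3 := hly _ (hWK u hu1 huc.le)
    have h4 := hly _ (hWK _ hu2 (by
      rw [inner_sub_right, inner_smul_right, hy, huc]; linarith))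
    rw [map_sub, map_smul, smul_eq_mul] at h4
    have h5 : l u = l y := le_antisymm h3 (by linarith)
    have h6 : u ∈ {x ∈ (T.elt K).carrier | ∀ w ∈ (T.elt K).carrier, l w ≤ l x} :=
      ⟨hWK u hu1 huc.le, fun w hw => by rw [h5]; exact hly w hw⟩
    rw [← hl] at h6
    exact h6.2
  -- An interior point of K' off the hyperplane gives a contradiction on either side of it: on the
  -- side of K the interiors overlap, and on the far side y becomes interior to the closure of Ω.
  obtain ⟨z, hz, hzc⟩ : ∃ z ∈ interior (T.elt K').carrier, inner ℝ ν z ≠ c := by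
    obtain ⟨z0, hz0⟩ := (T.elt K').frame.interior_nonempty
    by_cases h : inner ℝ ν z0 = c
    · have hcont : Continuous fun t : ℝ => z0 + t • ν := by fun_prop
      have h1 : ∀ᶠ t in 𝓝 (0 : ℝ), z0 + t • ν ∈ interior (T.elt K').carrier := by
        refine hcont.continuousAt.eventually_mem ?_
        rw [zero_smul, add_zero]
        exact isOpen_interior.mem_nhds hz0
      obtain ⟨t, ht1, ht0⟩ := ((h1.filter_mono nhdsWithin_le_nhds).and
        (self_mem_nhdsWithin (s := Ioi (0 : ℝ)))).exists
      have ht0' : 0 < t := ht0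
      refine ⟨_, ht1, ?_⟩
      rw [inner_add_right, inner_smul_right, real_inner_self_eq_norm_sq, f.norm_nrm, h]
      intro h
      linarith
    · exact ⟨z0, hz0, h⟩
  rcases lt_or_gt_of_ne hzc with hlt | hgt
  · -- the interiors of `K` and `K'` meet
    have hcont : Continuous fun t : ℝ => (1 - t) • y + t • z := by fun_prop
    have h1 : ∀ᶠ t in 𝓝 (0 : ℝ), (1 - t) • y + t • z ∈ W := by
      refine hcont.continuousAt.eventually_mem ?_
      simpa using hWo.mem_nhds hyW
    have h2 : ∀ᶠ t in 𝓝 (0 : ℝ), t < 1 := gt_mem_nhds one_pos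
    obtain ⟨t, ⟨ht1, ht2⟩, ht0⟩ := (((h1.and h2).filter_mono nhdsWithin_le_nhds).and
      (self_mem_nhdsWithin (s := Ioi (0 : ℝ)))).exists
    have ht0' : 0 < t := ht0
    have hin : (1 - t) • y + t • z ∈ interior (T.elt K).carrier := by
      refine f.mem_interior fun F' => ?_
      by_cases hF' : F' = F
      · subst hF'
        rw [inner_add_right, inner_smul_right, inner_smul_right, hy]
        nlinarith
      · exact ht1 F' hF'
    have hin' : (1 - t) • y + t • z ∈ interior (T.elt K').carrier :=
      (T.elt K').convex_carrier.combo_self_interior_mem_interior hyK' hz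
        (by linarith) ht0' (by ring)
    exact disjoint_left.1 (T.disjoint K K' hK.symm) hin hin'
  · -- `K ∪ K'` is a neighbourhood of `y`
    refine hyΩ (hΩ.interior_closure_subset (mem_interior_iff_mem_nhds.2 ?_))
    -- Central projection from z onto the hyperplane: x = (1 - t x) • u x + t x • z with u x in the
    -- hyperplane. It is continuous at y and fixes y.
    set t : E (n + 1) → ℝ := fun x => (inner ℝ ν x - c) / (inner ℝ ν z - c) with ht
    have hden : inner ℝ ν z - c > 0 := by linarith
    have ht0 : t y = 0 := by simp [ht, ν, c, hy]
    have htc : Continuous t := by fun_prop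
    set u : E (n + 1) → E (n + 1) := fun x => (1 - t x)⁻¹ • (x - t x • z) with hu
    have huy : u y = y := by simp [hu, ht0]
    have huc : ContinuousAt u y := by
      have h1 : ContinuousAt (fun x => (1 - t x)⁻¹) y :=
        (continuousAt_const.sub htc.continuousAt).inv₀ (by simp [ht0])
      exact h1.smul (by fun_prop)
    have h1 : ∀ᶠ x in 𝓝 y, inner ℝ ν (u x) = c → u x ∈ (T.elt K').carrier := by
      have : Tendsto u (𝓝 y) (𝓝 y) := by simpa [huy] using huc.tendsto
      exact this.eventually hrel
    have h2 : ∀ᶠ x in 𝓝 y, t x < 1 :=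
      htc.continuousAt.eventually_lt continuousAt_const (by simp [ht0])
    filter_upwards [h1, h2, hWo.mem_nhds hyW] with x hx1 hx2 hxW
    by_cases hxc : inner ℝ ν x ≤ c
    · exact T.carrier_subset K (hWK x hxW hxc)
    · have htx : 0 < t x := div_pos (by linarith) hden
      have h1t : 0 < 1 - t x := by linarith
      have htz : t x * (inner ℝ ν z - c) = inner ℝ ν x - c := by
        simp only [ht]; field_simp
      have hux : u x ∈ (T.elt K').carrier := hx1 (by
        rw [hu, inner_smul_right, inner_sub_right, inner_smul_right, inv_mul_eq_iff_eq_mul₀ h1t.ne']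
        linarith)
      have hxe : x = (1 - t x) • u x + t x • z := by
        rw [hu, smul_inv_smul₀ h1t.ne']
        abel
      rw [hxe]
      exact T.carrier_subset K' ((T.elt K').convex_carrier hux (interior_subset hz) h1t.le
        htx.le (by ring))

/-- An open neighbourhood of the relative interior of a boundary facet in which only one element
is seen. -/
def facetNbhd (K : Fin T.card) (f : Frame (T.elt K)) (F : (T.elt K).FacetIdx) : Set (E (n + 1)) :=
  {x | ∀ F' ∈ ({F}ᶜ : Set _), inner ℝ (f.nrm F') x < f.off F'} ∩
    (⋃ K' ∈ ({K}ᶜ : Set (Fin T.card)), (T.elt K').carrier)ᶜ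

section FacetNbhd

variable {T} {K : Fin T.card} {f : Frame (T.elt K)} {F : (T.elt K).FacetIdx}

lemma isOpen_facetNbhd : IsOpen (T.facetNbhd K f F) := by
  refine (f.isOpen_strict _).inter (isOpen_compl_iff.2 ?_)
  exact (toFinite _).isClosed_biUnion fun K' _ => (T.elt K').isCompact_carrier.isClosed

lemma mem_carrier_of_facetNbhd {x : E (n + 1)} (hx : x ∈ T.facetNbhd K f F)
    (h : inner ℝ (f.nrm F) x ≤ f.off F) : x ∈ (T.elt K).carrier :=
  f.mem_carrier_of_relint h hx.1

lemma mem_carrier_of_facetNbhd_closure {x : E (n + 1)} (hx : x ∈ T.facetNbhd K f F)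
    (h : x ∈ closure Ω) : x ∈ (T.elt K).carrier := by
  obtain ⟨K', hK'⟩ := T.exists_mem_carrier h
  by_cases hKK : K' = K
  · rwa [← hKK]
  · exact (hx.2 (mem_biUnion (x := K') hKK hK')).elim

/-- In this neighbourhood a boundary point of Ω can only belong to K; a strict inequality would make
it interior to K, hence a point of Ω. -/
lemma eq_off_of_facetNbhd (hΩ : IsLipschitzDomain Ω) {x : E (n + 1)}
    (hx : x ∈ T.facetNbhd K f F) (h : x ∈ frontier Ω) : inner ℝ (f.nrm F) x = f.off F := by
  have h1 := mem_carrier_of_facetNbhd_closure hx h.1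
  refine le_antisymm ((f.mem_carrier x).1 h1 F) (not_lt.1 fun hlt => h.2 ?_)
  rw [hΩ.isOpen.interior_eq]
  refine T.interior_subset_domain hΩ K (f.mem_interior fun F' => ?_)
  by_cases hF' : F' = F
  · rwa [hF']
  · exact hx.1 F' hF'

lemma mem_facetNbhd (hΩ : IsLipschitzDomain Ω) (hF : T.IsBoundaryFacet K F) {y : E (n + 1)}
    (hy : inner ℝ (f.nrm F) y = f.off F)
    (hy' : ∀ F' ≠ F, inner ℝ (f.nrm F') y < f.off F') : y ∈ T.facetNbhd K f F := by
  refine ⟨hy', ?_⟩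
  simp only [mem_compl_iff, mem_iUnion, not_exists, mem_singleton_iff]
  exact fun K' hK' => T.notMem_of_relint hΩ hK' f hF hy hy'

lemma isCompact_facet (f : Frame (T.elt K)) (F : (T.elt K).FacetIdx) :
    IsCompact ((T.elt K).facet F) := by
  have : (T.elt K).facet F = (T.elt K).carrier ∩ {x | inner ℝ (f.nrm F) x = f.off F} := by
    ext x; exact f.mem_facet F x
  rw [this]
  exact (T.elt K).isCompact_carrier.inter_right (isClosed_eq (by fun_prop) continuous_const)

/-- The surface measure on a boundary facet is Lebesgue measure in the coordinates of its
hyperplane. -/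
lemma surf_restrict_facet (hF : T.IsBoundaryFacet K F)
    {B : OrthonormalBasis (Fin (n + 1)) ℝ (E (n + 1))} (hB : B 0 = f.nrm F) {x0 : E (n + 1)}
    (hx0 : inner ℝ (f.nrm F) x0 = f.off F) :
    (surf Ω).restrict ((T.elt K).facet F) =
      ((volume : Measure (E n)).map (hypMap B x0)).restrict ((T.elt K).facet F) := by
  have hm := (isCompact_facet f F).measurableSet
  rw [← restrict_hyperplane_eq_map, hB, hx0, surf, Measure.restrict_restrict hm,
    Measure.restrict_restrict hm, inter_eq_left.2 hF, inter_eq_left.2]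
  · rfl
  · exact fun x hx => ((f.mem_facet F x).1 hx).2

/-- The rest of the facet lies in the hyperplanes of the other facets, whose traces on the
hyperplane of F are null. -/
lemma surf_facet_diff (hΩ : IsLipschitzDomain Ω) (hF : T.IsBoundaryFacet K F) :
    ∀ᵐ x ∂((surf Ω).restrict ((T.elt K).facet F)), x ∈ T.facetNbhd K f F := by
  obtain ⟨B, hB⟩ := exists_basis_head (f.norm_nrm F)
  rw [surf_restrict_facet hF hB (f.fctr_eq F)]
  have h1 : ∀ F' ≠ F, ∀ᵐ x ∂((volume : Measure (E n)).map (hypMap B (f.fctr F))),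
      inner ℝ (f.nrm F') x ≠ f.off F' := by
    intro F' hF'
    rw [(measurableEmbedding_hypMap B _).ae_map_iff]
    -- The trace of another facet's hyperplane, in the coordinates of F. It is a proper subspace
    -- because the centre of F satisfies the other constraint strictly.
    set S : AffineSubspace ℝ (E n) :=
      { carrier := {y | inner ℝ (f.nrm F') (hypMap B (f.fctr F) y) = f.off F'}
        smul_vsub_vadd_mem' := by
          intro t p1 p2 p3 h1 h2 h3
          simp only [mem_ofPred_eq, hypMap, inner_add_right, inner_sum, inner_smul_right] at *
          simp only [vsub_eq_sub, vadd_eq_add, PiLp.add_apply, PiLp.smul_apply, PiLp.sub_apply,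
            smul_eq_mul, add_mul, mul_assoc, sub_mul, Finset.sum_add_distrib, ← Finset.mul_sum,
            Finset.sum_sub_distrib]
          linear_combination t * (h1 - h2) + h3 } with hS
    have hST : S ≠ ⊤ := by
      intro h
      have h0 : (0 : E n) ∈ S := by rw [h]; trivial
      have h2 : inner ℝ (f.nrm F') (hypMap B (f.fctr F) 0) = f.off F' := h0
      have h3 : hypMap B (f.fctr F) 0 = f.fctr F := by simp [hypMap]
      rw [h3] at h2
      exact (f.fctr_lt hF').ne h2
    exact compl_mem_ae_iff.2 (Measure.addHaar_affineSubspace volume S hST)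
  have h2 : ∀ᵐ x ∂((volume : Measure (E n)).map (hypMap B (f.fctr F))),
      ∀ F', F' ≠ F → inner ℝ (f.nrm F') x ≠ f.off F' := by
    rw [ae_all_iff]
    intro F'
    by_cases h : F' = F
    · exact ae_of_all _ fun x hx => (hx h).elim
    · filter_upwards [h1 F' h] with x hx _ using hx
  filter_upwards [ae_restrict_of_ae h2, ae_restrict_mem (isCompact_facet f F).measurableSet]
    with x hx hxF
  obtain ⟨hxK, hxc⟩ := (f.mem_facet F x).1 hxF
  exact mem_facetNbhd hΩ hF hxc fun F' hF' =>
    lt_of_le_of_ne ((f.mem_carrier x).1 hxK F') (hx F' hF')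

end FacetNbhd

end Mesh

end

section

/-! ### Pairings in `L²` -/

section L2

variable {α F : Type*} [MeasurableSpace α] {μ : Measure α} [NormedAddCommGroup F]
  [InnerProductSpace ℝ F]

lemma memLp_inner {g v : α → F} (hg : MemLp g 2 μ) (hv : MemLp v 2 μ) :
    MemLp (fun x => inner ℝ (g x) (v x)) 1 μ :=
  hg.of_bilin (fun a b => inner ℝ a b) 1 hv (hg.1.inner hv.1)
    (ae_of_all _ fun x => by
      rw [one_mul]
      exact nnnorm_inner_le_nnnorm (𝕜 := ℝ) _ _)

lemma integrable_inner {g v : α → F} (hg : MemLp g 2 μ) (hv : MemLp v 2 μ) :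
    Integrable (fun x => inner ℝ (g x) (v x)) μ := memLp_one_iff_integrable.1 (memLp_inner hg hv)

/-- Cauchy-Schwarz. Measurability of the u k is enough, since the convergence makes them square
integrable eventually. -/
lemma tendsto_integral_inner {g v : α → F} {u : ℕ → α → F} (hg : MemLp g 2 μ) (hv : MemLp v 2 μ)
    (hu : ∀ k, AEStronglyMeasurable (u k) μ)
    (h : Tendsto (fun k => eLpNorm (u k - v) 2 μ) atTop (𝓝 0)) :
    Tendsto (fun k => ∫ x, inner ℝ (g x) (u k x) ∂μ) atTop (𝓝 (∫ x, inner ℝ (g x) (v x) ∂μ)) := by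
  refine tendsto_integral_of_L1' _ (hg.1.inner hv.1) ?_ ?_
  · have h1 : ∀ᶠ k in atTop, eLpNorm (u k - v) 2 μ < ⊤ := h.eventually_lt_const (by simp)
    filter_upwards [h1] with k hk
    have h2 : MemLp (u k) 2 μ := by
      have h3 : MemLp (u k - v) 2 μ := ⟨(hu k).sub hv.1, hk⟩
      simpa using h3.add hv
    exact integrable_inner hg h2
  · have hb : ∀ k, eLpNorm ((fun x => inner ℝ (g x) (u k x)) - fun x => inner ℝ (g x) (v x)) 1 μ ≤
        eLpNorm g 2 μ * eLpNorm (u k - v) 2 μ := fun k => by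
      have h1 : ((fun x => inner ℝ (g x) (u k x)) - fun x => inner ℝ (g x) (v x)) =
          fun x => inner ℝ (g x) ((u k - v) x) := by
        ext x
        simp [inner_sub_right]
      rw [h1]
      have := eLpNorm_le_eLpNorm_mul_eLpNorm_of_nnnorm (p := 2) (q := 2) (r := 1) hg.1
        ((hu k).sub hv.1) (fun a b => (inner ℝ a b : ℝ)) 1 (ae_of_all _ fun x => by
          rw [one_mul]
          exact nnnorm_inner_le_nnnorm (𝕜 := ℝ) _ _)
      simpa using this
    refine tendsto_of_tendsto_of_tendsto_of_le_of_le tendsto_const_nhds ?_ (fun _ => zero_le) hb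
    have := ENNReal.Tendsto.const_mul h (Or.inr hg.2.ne)
    simpa using this

end L2

/-! ### Green's formula -/

lemma continuous_gradient {d : ℕ} {f : E d → ℝ} (hf : ContDiff ℝ 1 f) :
    Continuous (gradient f) :=
  (InnerProductSpace.toDual ℝ (E d)).symm.continuous.comp (hf.continuous_fderiv (by simp))

/-- Green's formula between `H¹(Ω)` and `Q(Ω)`. -/
lemma MemQ.green_memH1 {d : ℕ} {Ω : Set (E d)} {q : FluxField d} {u : ScalarField d}
    (hq : MemQ Ω q) (hu : MemH1 Ω u) :
    (∫ x in Ω, (inner ℝ (q.val x) (u.grad x) + q.dv x * u.val x)) =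
      ∫ x, q.ntr x * u.tr x ∂(surf Ω) := by
  obtain ⟨s, hs, h1, h2, h3⟩ := hu.trace
  have hs1 : ∀ k, ContDiff ℝ 1 (s k) := fun k => (hs k).of_le (by simp)
  -- For the smooth approximants Green's formula is part of `MemQ`; each of its three terms passes
  -- to the limit as an L² pairing.
  have t1 := tendsto_integral_inner hq.val_memLp hu.grad_memLp
    (fun k => (continuous_gradient (hs1 k)).aestronglyMeasurable) h2
  have t2 := tendsto_integral_inner hq.dv_memLp hu.val_memLp
    (fun k => (hs k).continuous.aestronglyMeasurable) h1
  have t3 := tendsto_integral_inner hq.ntr_memLp hu.tr_memLp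
    (fun k => (hs k).continuous.aestronglyMeasurable) h3
  have hI : ∀ {v : E d → ℝ}, MemLp v 2 (volume.restrict Ω) → ∀ {w : E d → E d},
      MemLp w 2 (volume.restrict Ω) →
      ∫ x in Ω, (inner ℝ (q.val x) (w x) + q.dv x * v x) =
        (∫ x in Ω, inner ℝ (q.val x) (w x)) + ∫ x in Ω, inner ℝ (q.dv x) (v x) := by
    intro v hv w hw
    rw [← integral_add (integrable_inner hq.val_memLp hw) (integrable_inner hq.dv_memLp hv)]
    refine integral_congr_ae (ae_of_all _ fun x => ?_)
    simp [mul_comm]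
  have hfin : ∀ᶠ k in atTop, (∫ x in Ω, inner ℝ (q.val x) (gradient (s k) x)) +
      ∫ x in Ω, inner ℝ (q.dv x) (s k x) = ∫ x, inner ℝ (q.ntr x) (s k x) ∂(surf Ω) := by
    filter_upwards [h1.eventually_lt_const (u := ⊤) (by simp),
      h2.eventually_lt_const (u := ⊤) (by simp)] with k hk1 hk2
    have m1 : MemLp (s k) 2 (volume.restrict Ω) := by
      have h3 : MemLp (s k - u.val) 2 (volume.restrict Ω) :=
        ⟨(hs k).continuous.aestronglyMeasurable.sub hu.val_memLp.1, hk1⟩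
      simpa using h3.add hu.val_memLp
    have m2 : MemLp (gradient (s k)) 2 (volume.restrict Ω) := by
      have h3 : MemLp (gradient (s k) - u.grad) 2 (volume.restrict Ω) :=
        ⟨(continuous_gradient (hs1 k)).aestronglyMeasurable.sub hu.grad_memLp.1, hk2⟩
      simpa using h3.add hu.grad_memLp
    have := hq.green (s k) (hs k)
    rw [hI m1 m2] at this
    rw [this]
    refine integral_congr_ae (ae_of_all _ fun x => ?_)
    simp [mul_comm]
  have := tendsto_nhds_unique ((t1.add t2).congr' hfin) t3
  rw [hI hu.val_memLp hu.grad_memLp, this]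
  refine integral_congr_ae (ae_of_all _ fun x => ?_)
  simp [mul_comm]

/-- Inclusion up to a null set is the right condition, because a closed element may contain boundary
points of Ω. -/
lemma setIntegral_domain_eq {d : ℕ} {Ω A : Set (E d)} (hΩ : MeasurableSet Ω)
    (hA : A ≤ᵐ[volume] Ω) {g : E d → ℝ} (hg : ∀ x ∈ Ω, x ∉ A → g x = 0) :
    ∫ x in Ω, g x = ∫ x in A, g x := by
  rw [setIntegral_eq_of_subset_of_forall_sdiff_eq_zero hΩ (inter_subset_left (t := A))
    fun x hx => hg x hx.1 fun h => hx.2 ⟨hx.1, h⟩]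
  refine setIntegral_congr_set ?_
  filter_upwards [hA] with x hx
  exact propext ⟨fun h => h.2, fun h => ⟨hx h, h⟩⟩

variable {n : ℕ} {Ω : Set (E (n + 1))} {T : Mesh Ω} {K : Fin T.card}

/-- The field equal to a smooth field in a half-space, and to `0` outside. -/
def halfField (V : E (n + 1) → E (n + 1)) (ν : E (n + 1)) (c : ℝ) : FluxField (n + 1) where
  val := indicator {x | inner ℝ ν x ≤ c} V
  dv := indicator {x | inner ℝ ν x ≤ c} (dvg V)
  ntr := indicator {x | inner ℝ ν x = c} fun x => inner ℝ ν (V x)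

lemma measurableSet_halfspace (ν : E (n + 1)) (c : ℝ) : MeasurableSet {x | inner ℝ ν x ≤ c} :=
  (isClosed_le (by fun_prop) continuous_const).measurableSet

lemma measurableSet_hyperplane (ν : E (n + 1)) (c : ℝ) : MeasurableSet {x | inner ℝ ν x = c} :=
  (isClosed_eq (by fun_prop) continuous_const).measurableSet

/-- A field supported, on one side of a hyperplane, in an element, and whose support meets this
hyperplane in the boundary of the domain only, defines an element of `Q(Ω)`. -/
lemma memQ_halfField (hΩ : IsLipschitzDomain Ω) {V : E (n + 1) → E (n + 1)}
    (hV : ContDiff ℝ ∞ V) (hc : HasCompactSupport V) {ν : E (n + 1)} (hν : ‖ν‖ = 1) {c : ℝ}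
    (hVK : ∀ x ∈ tsupport V, inner ℝ ν x ≤ c → x ∈ (T.elt K).carrier)
    (hVb : ∀ x ∈ tsupport V, inner ℝ ν x = c → x ∈ frontier Ω) :
    MemQ Ω (halfField V ν c) := by
  have hV1 : ContDiff ℝ 1 V := hV.of_le (by simp)
  refine ⟨?_, ?_, ?_, ?_⟩
  · exact (hV.continuous.memLp_of_hasCompactSupport hc).indicator (measurableSet_halfspace ν c)
  · exact ((continuous_dvg hV1).memLp_of_hasCompactSupport
      (hasCompactSupport_dvg hc)).indicator (measurableSet_halfspace ν c)
  · rw [halfField, memLp_indicator_iff_restrict (measurableSet_hyperplane ν c)]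
    obtain ⟨B, rfl⟩ := exists_basis_head hν
    have hx0 : inner ℝ (B 0) (c • B 0) = c := by simp [inner_smul_right]
    have hm := restrict_hyperplane_eq_map B (c • B 0)
    rw [hx0] at hm
    -- On the hyperplane the surface measure is dominated by Lebesgue measure, for which the
    -- compactly supported trace is square integrable.
    refine MemLp.mono_measure (μ := (volume : Measure (E n)).map (hypMap B (c • B 0))) ?_ ?_
    · rw [← hm]
      exact Measure.restrict_mono_measure Measure.restrict_le_self _
    · rw [(measurableEmbedding_hypMap B _).memLp_map_measure_iff]
      refine Continuous.memLp_of_hasCompactSupport ?_ ?_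
      · exact (continuous_const.inner hV.continuous).comp (continuous_hypMap B _)
      · refine HasCompactSupport.comp_isClosedEmbedding ?_ (isometry_hypMap B _).isClosedEmbedding
        refine hc.mono' fun x hx => subset_tsupport _ ?_
        intro h
        exact hx (by simp [h])
  · intro f hf
    have hf1 : ContDiff ℝ 1 f := hf.of_le (by simp)
    have hsupp : ∀ x, x ∉ tsupport V → dvg (fun x => f x • V x) x = 0 := fun x hx =>
      dvg_eq_zero_of_notMem fun h => hx (tsupport_smul_subset_right f V h)
    have h1 : ∀ x, inner ℝ ((halfField V ν c).val x) (gradient f x) + (halfField V ν c).dv x * f x =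
        indicator {x | inner ℝ ν x ≤ c} (dvg fun x => f x • V x) x := fun x => by
      by_cases hx : x ∈ {x | inner ℝ ν x ≤ c}
      · simp only [halfField, indicator_of_mem hx, dvg_smul hf1 hV1]
      · simp only [halfField, indicator_of_notMem hx, inner_zero_left, zero_mul, add_zero]
    simp_rw [h1]
    -- Green's formula against f is the divergence theorem for f V in the half-space. The support
    -- conditions on V replace the half-space by Ω, and the hyperplane by its part in the boundary.
    have h2 := integral_halfspace_dvg (hf1.smul hV1) (hc.smul_left (f := f)) hν c
    have h3 : ∫ x in Ω, indicator {x | inner ℝ ν x ≤ c} (dvg fun x => f x • V x) x =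
        ∫ x in {x | inner ℝ ν x ≤ c}, dvg (fun x => f x • V x) x := by
      rw [setIntegral_domain_eq hΩ.isOpen.measurableSet (T.carrier_ae_subset hΩ K),
        ← integral_indicator (measurableSet_halfspace ν c)]
      · refine setIntegral_eq_integral_of_forall_compl_eq_zero fun x hx => ?_
        by_cases hxH : x ∈ {x | inner ℝ ν x ≤ c}
        · rw [indicator_of_mem hxH]
          exact hsupp x fun h => hx (hVK x h hxH)
        · rw [indicator_of_notMem hxH]
      · intro x _ hx
        by_cases hxH : x ∈ {x | inner ℝ ν x ≤ c}
        · rw [indicator_of_mem hxH]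
          exact hsupp x fun h => hx (hVK x h hxH)
        · rw [indicator_of_notMem hxH]
    rw [h3]
    refine h2.trans ?_
    have h4 : ∀ x, (halfField V ν c).ntr x * f x =
        indicator {x | inner ℝ ν x = c} (fun x => inner ℝ ν (f x • V x)) x := fun x => by
      by_cases hx : x ∈ {x | inner ℝ ν x = c}
      · simp only [halfField, indicator_of_mem hx, inner_smul_right, mul_comm]
      · simp only [halfField, indicator_of_notMem hx, zero_mul]
    simp_rw [h4]
    rw [integral_indicator (measurableSet_hyperplane ν c), surf,
      Measure.restrict_restrict (measurableSet_hyperplane ν c)]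
    refine setIntegral_eq_of_subset_of_forall_sdiff_eq_zero (measurableSet_hyperplane ν c)
      inter_subset_left fun x hx => ?_
    have hxV : x ∉ tsupport V := fun h => hx.2 ⟨hx.1, hVb x h hx.1⟩
    simp [image_eq_zero_of_notMem_tsupport hxV]

/-! ### Smooth representatives on an element -/

/-- The weak divergence of a field that is smooth in an element. -/
lemma MemQ.dv_ae_eq (hΩ : IsLipschitzDomain Ω) {q : FluxField (n + 1)} (hq : MemQ Ω q)
    {V : E (n + 1) → E (n + 1)} (hV : ContDiff ℝ ∞ V)
    (hqV : ∀ᵐ x ∂(volume.restrict (T.elt K).carrier), q.val x = V x) :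
    ∀ᵐ x ∂(volume.restrict (T.elt K).carrier), q.dv x = dvg V x := by
  have hV1 : ContDiff ℝ 1 V := hV.of_le (by simp)
  have hKm := (T.elt K).isCompact_carrier.measurableSet
  have hfin : IsFiniteMeasure (volume.restrict (T.elt K).carrier) :=
    ⟨by simpa using (T.elt K).isCompact_carrier.measure_lt_top⟩
  have hle := T.restrict_carrier_le hΩ K
  have hint : Integrable (fun x => q.dv x - dvg V x) (volume.restrict (T.elt K).carrier) :=
    ((hq.dv_memLp.mono_measure hle).integrable (by simp)).sub
      ((continuous_dvg hV1).continuousOn.integrableOn_compact (T.elt K).isCompact_carrier)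
  have hint2 : Integrable q.dv (volume.restrict (T.elt K).carrier) :=
    (hq.dv_memLp.mono_measure hle).integrable (by simp)
  -- The fundamental lemma of the calculus of variations on the interior; the frontier of K is null
  -- by convexity.
  have key := isOpen_interior.ae_eq_zero_of_integral_contDiff_smul_eq_zero
    (U := interior (T.elt K).carrier) (μ := volume.restrict (T.elt K).carrier)
    (hint.locallyIntegrable.locallyIntegrableOn _) ?_
  · have hfr := (T.elt K).convex_carrier.addHaar_frontier volume
    filter_upwards [key, ae_restrict_of_ae (compl_mem_ae_iff.2 hfr), ae_restrict_mem hKm]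
      with x hx hxf hxK
    by_contra hne
    refine hxf ⟨subset_closure hxK, fun hi => hne (sub_eq_zero.1 (hx hi))⟩
  · intro g hg hgc hgs
    have hg1 : ContDiff ℝ 1 g := hg.of_le (by simp)
    have h0 : ∀ x, x ∉ interior (T.elt K).carrier → g x = 0 ∧ gradient g x = 0 := fun x hx => by
      have hx' : x ∉ tsupport g := fun h => hx (hgs h)
      refine ⟨image_eq_zero_of_notMem_tsupport hx', ?_⟩
      rw [gradient, image_eq_zero_of_notMem_tsupport fun h => hx' (tsupport_fderiv_subset ℝ h)]
      simp
    have hgr := hq.green g hg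
    have hr : ∫ x, q.ntr x * g x ∂(surf Ω) = 0 := by
      rw [surf]
      refine setIntegral_eq_zero_of_forall_eq_zero fun x hx => ?_
      rw [(h0 x fun h => hx.2 (by
        rw [hΩ.isOpen.interior_eq]; exact T.interior_subset_domain hΩ K h)).1, mul_zero]
    rw [hr, setIntegral_domain_eq hΩ.isOpen.measurableSet (T.carrier_ae_subset hΩ K)] at hgr
    swap
    · intro x _ hx
      obtain ⟨ha, hb⟩ := h0 x fun h => hx (interior_subset h)
      rw [ha, hb, inner_zero_right, mul_zero, add_zero]
    obtain ⟨F⟩ := Frame.facet_nonempty_idx (T.elt K)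
    set f := (T.elt K).frame
    -- The weak formula for q is compared with the classical one for g V. Both boundary terms vanish
    -- because g is supported in the interior of K, and any facet's half-space will do.
    have hdv := integral_halfspace_dvg (hg1.smul hV1) (hgc.smul_right (f' := V)) (f.norm_nrm F)
      (f.off F)
    have hz : ∀ x, x ∉ interior (T.elt K).carrier → dvg (fun x => g x • V x) x = 0 := fun x hx => by
      rw [dvg_smul hg1 hV1, (h0 x hx).1, (h0 x hx).2, inner_zero_right, mul_zero, add_zero]
    have hzero : ∫ x in (T.elt K).carrier, dvg (fun x => g x • V x) x = 0 := by
      rw [setIntegral_eq_integral_of_forall_compl_eq_zero fun x hx =>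
        hz x fun h => hx (interior_subset h)]
      rw [← setIntegral_eq_integral_of_forall_compl_eq_zero
        (s := {x | inner ℝ (f.nrm F) x ≤ f.off F}) fun x hx => hz x fun h =>
          hx ((f.mem_carrier x).1 (interior_subset h) F)]
      refine hdv.trans (setIntegral_eq_zero_of_forall_eq_zero fun x hx => ?_)
      simp [(h0 x (f.notMem_interior hx)).1]
    have hcg : Integrable (fun x => g x * q.dv x) (volume.restrict (T.elt K).carrier) := by
      obtain ⟨C, hC⟩ := hg.continuous.bounded_above_of_compact_support hgc
      exact hint2.bdd_mul hg.continuous.aestronglyMeasurable (ae_of_all _ hC)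
    have hcg2 : Integrable (fun x => inner ℝ (V x) (gradient g x))
        (volume.restrict (T.elt K).carrier) :=
      (Continuous.inner hV.continuous (continuous_gradient hg1)).continuousOn.integrableOn_compact
        (T.elt K).isCompact_carrier
    have hcg3 : Integrable (fun x => g x * dvg V x) (volume.restrict (T.elt K).carrier) :=
      (hg.continuous.mul (continuous_dvg hV1)).continuousOn.integrableOn_compact
        (T.elt K).isCompact_carrier
    have e1 : ∫ x in (T.elt K).carrier, (inner ℝ (q.val x) (gradient g x) + q.dv x * g x) =
        (∫ x in (T.elt K).carrier, inner ℝ (V x) (gradient g x)) +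
          ∫ x in (T.elt K).carrier, g x * q.dv x := by
      rw [← integral_add hcg2 hcg]
      refine integral_congr_ae ?_
      filter_upwards [hqV] with x hx
      rw [hx, mul_comm]
    have e2 : ∫ x in (T.elt K).carrier, dvg (fun x => g x • V x) x =
        (∫ x in (T.elt K).carrier, inner ℝ (V x) (gradient g x)) +
          ∫ x in (T.elt K).carrier, g x * dvg V x := by
      rw [← integral_add hcg2 hcg3]
      refine integral_congr_ae (ae_of_all _ fun x => ?_)
      simp only [dvg_smul hg1 hV1, mul_comm]
    simp only [smul_eq_mul, mul_sub]
    rw [integral_sub hcg hcg3]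
    linarith

end

/-! ### Weak gradients, traces and normal traces of functions that are smooth in an element -/

section

variable {n : ℕ} {Ω : Set (E (n + 1))} {T : Mesh Ω} {K : Fin T.card}

lemma IsLipschitzDomain.isCompact_closure {d : ℕ} {Ω : Set (E d)} (hΩ : IsLipschitzDomain Ω) :
    IsCompact (closure Ω) :=
  hΩ.isBounded.isCompact_closure

lemma IsLipschitzDomain.memLp_of_continuous {d : ℕ} {Ω : Set (E d)} (hΩ : IsLipschitzDomain Ω)
    {V : Type*} [NormedAddCommGroup V] [SecondCountableTopology V] {f : E d → V}
    (hf : Continuous f) : MemLp f 2 (volume.restrict Ω) := by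
  obtain ⟨C, hC⟩ := hΩ.isCompact_closure.exists_bound_of_continuousOn hf.continuousOn
  have hfin : IsFiniteMeasure (volume.restrict Ω) :=
    ⟨by simpa using hΩ.isBounded.measure_lt_top⟩
  refine MemLp.of_bound hf.aestronglyMeasurable C ?_
  exact ae_restrict_of_forall_mem hΩ.isOpen.measurableSet fun x hx => hC x (subset_closure hx)

lemma surf_integral_eq_facet {F : (T.elt K).FacetIdx} (hF : T.IsBoundaryFacet K F)
    {g : E (n + 1) → ℝ} (hg : ∀ x ∈ frontier Ω, x ∉ (T.elt K).facet F → g x = 0) :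
    ∫ x, g x ∂(surf Ω) = ∫ x in (T.elt K).facet F, g x ∂(surf Ω) := by
  have hm := (Mesh.isCompact_facet (T.elt K).frame F).measurableSet
  rw [surf, Measure.restrict_restrict hm, inter_eq_left.2 hF]
  exact setIntegral_eq_of_subset_of_forall_sdiff_eq_zero isClosed_frontier.measurableSet hF
    fun x hx => hg x hx.1 hx.2

/-- The boundary of Ω is covered by finitely many compact pieces of hyperplanes. -/
lemma Mesh.isFiniteMeasure_surf (T : Mesh Ω) (hΩ : IsLipschitzDomain Ω) :
    IsFiniteMeasure (surf Ω) := by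
  refine ⟨?_⟩
  rw [surf, Measure.restrict_apply_univ]
  have hsub : frontier Ω ⊆ ⋃ K : Fin T.card, ⋃ F : (T.elt K).FacetIdx,
      (T.elt K).carrier ∩
        {x | inner ℝ ((T.elt K).frame.nrm F) x = (T.elt K).frame.off F} := by
    intro x hx
    obtain ⟨K, hK⟩ := T.exists_mem_carrier hx.1
    refine mem_iUnion.2 ⟨K, ?_⟩
    have hfr : x ∈ frontier (T.elt K).carrier := ⟨subset_closure hK, fun h => hx.2 (by
      rw [hΩ.isOpen.interior_eq]; exact T.interior_subset_domain hΩ K h)⟩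
    obtain ⟨F, hF⟩ := mem_iUnion.1 ((T.elt K).frame.frontier_subset hfr)
    exact mem_iUnion.2 ⟨F, hK, hF⟩
  refine (measure_mono hsub).trans_lt ((measure_iUnion_fintype_le _ _).trans_lt
    (ENNReal.sum_lt_top.2 fun K _ => (measure_iUnion_fintype_le _ _).trans_lt
      (ENNReal.sum_lt_top.2 fun F _ => ?_)))
  set f := (T.elt K).frame
  obtain ⟨B, hB⟩ := exists_basis_head (f.norm_nrm F)
  rw [← Measure.restrict_apply (T.elt K).isCompact_carrier.measurableSet, ← f.fctr_eq F, ← hB]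
  have := restrict_hyperplane_eq_map B (f.fctr F)
  rw [Nat.add_sub_cancel, this, (measurableEmbedding_hypMap B _).map_apply]
  exact ((isometry_hypMap B _).isClosedEmbedding.isCompact_preimage
    (T.elt K).isCompact_carrier).measure_lt_top

lemma Mesh.memLp_surf (T : Mesh Ω) (hΩ : IsLipschitzDomain Ω) {v : E (n + 1) → ℝ}
    (hv : Continuous v) : MemLp v 2 (surf Ω) := by
  have := T.isFiniteMeasure_surf hΩ
  obtain ⟨C, hC⟩ := hΩ.isCompact_closure.exists_bound_of_continuousOn hv.continuousOn
  refine MemLp.of_bound hv.aestronglyMeasurable C ?_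
  exact ae_restrict_of_forall_mem isClosed_frontier.measurableSet
    fun x hx => hC x (frontier_subset_closure hx)

/-- Green's formula for a flux supported in an element in which `u` coincides with a smooth
function. -/
lemma MemQ.integral_inner_grad_sub (hΩ : IsLipschitzDomain Ω) {q : FluxField (n + 1)}
    (hq : MemQ Ω q) {u : ScalarField (n + 1)} (hu : MemH1 Ω u) {v : E (n + 1) → ℝ}
    (hv : ContDiff ℝ ∞ v) (huv : ∀ᵐ x ∂(volume.restrict (T.elt K).carrier), u.val x = v x)
    (hq1 : ∀ x ∉ (T.elt K).carrier, q.val x = 0) (hq2 : ∀ x ∉ (T.elt K).carrier, q.dv x = 0)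
    (hvs : MemLp v 2 (surf Ω)) :
    ∫ x in (T.elt K).carrier, inner ℝ (q.val x) (u.grad x - gradient v x) =
      ∫ x, q.ntr x * (u.tr x - v x) ∂(surf Ω) := by
  have hv1 : ContDiff ℝ 1 v := hv.of_le (by simp)
  have hKm := (T.elt K).isCompact_carrier.measurableSet
  have h1 := hq.green_memH1 hu
  have h2 := hq.green v hv
  have i3 := integrable_inner hq.ntr_memLp hu.tr_memLp
  have i4 := integrable_inner hq.ntr_memLp hvs
  have e3 : ∫ x, q.ntr x * (u.tr x - v x) ∂(surf Ω) =
      (∫ x, q.ntr x * u.tr x ∂(surf Ω)) - ∫ x, q.ntr x * v x ∂(surf Ω) := by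
    rw [← integral_sub (by simpa [mul_comm] using i3) (by simpa [mul_comm] using i4)]
    simp only [mul_sub]
  have i1 : Integrable (fun x => inner ℝ (q.val x) (u.grad x) + q.dv x * u.val x)
      (volume.restrict Ω) :=
    (integrable_inner hq.val_memLp hu.grad_memLp).add
      (by simpa [mul_comm] using integrable_inner hq.dv_memLp hu.val_memLp)
  have i2 : Integrable (fun x => inner ℝ (q.val x) (gradient v x) + q.dv x * v x)
      (volume.restrict Ω) :=
    (integrable_inner hq.val_memLp (hΩ.memLp_of_continuous (continuous_gradient hv1))).add
      (by simpa [mul_comm] using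
        integrable_inner hq.dv_memLp (hΩ.memLp_of_continuous hv.continuous))
  rw [e3, ← h1, ← h2, ← integral_sub i1 i2,
    setIntegral_domain_eq hΩ.isOpen.measurableSet (T.carrier_ae_subset hΩ K)]
  · refine integral_congr_ae ?_
    filter_upwards [huv] with x hx
    rw [hx, inner_sub_right]
    ring
  · intro x _ hx
    rw [hq1 x hx, hq2 x hx]
    simp

lemma halfField_eq_zero {V : E (n + 1) → E (n + 1)} {ν : E (n + 1)} {c : ℝ} {s : Set (E (n + 1))}
    (hVK : ∀ x ∈ tsupport V, inner ℝ ν x ≤ c → x ∈ s) {x : E (n + 1)} (hx : x ∉ s) :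
    (halfField V ν c).val x = 0 ∧ (halfField V ν c).dv x = 0 := by
  by_cases h : x ∈ {x | inner ℝ ν x ≤ c}
  · have hV : x ∉ tsupport V := fun hV => hx (hVK x hV h)
    simp only [halfField, indicator_of_mem h]
    exact ⟨image_eq_zero_of_notMem_tsupport hV, dvg_eq_zero_of_notMem hV⟩
  · simp only [halfField, indicator_of_notMem h, and_self]

section Representatives

variable {u : ScalarField (n + 1)} {v : E (n + 1) → ℝ}

/-- The weak gradient of a function that is smooth in an element. -/
lemma MemH1.grad_ae_eq (hΩ : IsLipschitzDomain Ω) (hu : MemH1 Ω u) (hv : ContDiff ℝ ∞ v)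
    (huv : ∀ᵐ x ∂(volume.restrict (T.elt K).carrier), u.val x = v x) :
    ∀ᵐ x ∂(volume.restrict (T.elt K).carrier), u.grad x = gradient v x := by
  have hv1 : ContDiff ℝ 1 v := hv.of_le (by simp)
  have hKm := (T.elt K).isCompact_carrier.measurableSet
  have hfin : IsFiniteMeasure (volume.restrict (T.elt K).carrier) :=
    ⟨by simpa using (T.elt K).isCompact_carrier.measure_lt_top⟩
  have hint : Integrable (fun x => u.grad x - gradient v x)
      (volume.restrict (T.elt K).carrier) :=
    ((hu.grad_memLp.mono_measure (T.restrict_carrier_le hΩ K)).integrable (by simp)).sub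
      ((continuous_gradient hv1).continuousOn.integrableOn_compact (T.elt K).isCompact_carrier)
  have key := isOpen_interior.ae_eq_zero_of_integral_contDiff_smul_eq_zero
    (U := interior (T.elt K).carrier) (μ := volume.restrict (T.elt K).carrier)
    (hint.locallyIntegrable.locallyIntegrableOn _) ?_
  · have hfr := (T.elt K).convex_carrier.addHaar_frontier volume
    filter_upwards [key, ae_restrict_of_ae (compl_mem_ae_iff.2 hfr), ae_restrict_mem hKm]
      with x hx hxf hxK
    by_contra hne
    refine hxf ⟨subset_closure hxK, fun hi => hne (sub_eq_zero.1 (hx hi))⟩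
  · intro g hg hgc hgs
    have hgint : Integrable (fun x => g x • (u.grad x - gradient v x))
        (volume.restrict (T.elt K).carrier) := by
      obtain ⟨C, hC⟩ := hg.continuous.bounded_above_of_compact_support hgc
      exact hint.bdd_smul C hg.continuous.aestronglyMeasurable (ae_of_all _ hC)
    -- The difference of gradients is paired with each constant direction w through the flux g w,
    -- whose normal trace vanishes because g is supported in the interior of K.
    refine ext_inner_left ℝ fun w => ?_
    rw [inner_zero_right, ← integral_inner hgint]
    obtain ⟨F⟩ := Frame.facet_nonempty_idx (T.elt K)
    set f := (T.elt K).frame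
    have hsub : tsupport (fun x => g x • w) ⊆ interior (T.elt K).carrier :=
      (tsupport_smul_subset_left g _).trans hgs
    have hVK : ∀ x ∈ tsupport (fun x => g x • w), inner ℝ (f.nrm F) x ≤ f.off F →
        x ∈ (T.elt K).carrier := fun x hx _ => interior_subset (hsub hx)
    have hoff : ∀ x, inner ℝ (f.nrm F) x = f.off F → x ∉ tsupport (fun x => g x • w) :=
      fun x h hx => f.notMem_interior h (hsub hx)
    have hq : MemQ Ω (halfField (fun x => g x • w) (f.nrm F) (f.off F)) :=
      memQ_halfField (T := T) (K := K) hΩ (hg.smul contDiff_const) hgc.smul_right (f.norm_nrm F)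
        hVK fun x hx h => (hoff x h hx).elim
    have h := hq.integral_inner_grad_sub hΩ hu hv huv
      (fun x hx => (halfField_eq_zero hVK hx).1) (fun x hx => (halfField_eq_zero hVK hx).2)
      (T.memLp_surf hΩ hv.continuous)
    have h0 : ∀ x, (halfField (fun x => g x • w) (f.nrm F) (f.off F)).ntr x = 0 := fun x => by
      by_cases hx : inner ℝ (f.nrm F) x = f.off F
      · have := image_eq_zero_of_notMem_tsupport (hoff x hx)
        simp only [halfField]
        rw [indicator_of_mem (by exact hx)]
        simp only [this, inner_zero_right]
      · simp only [halfField]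
        rw [indicator_of_notMem (by exact hx)]
    simp only [h0, zero_mul, integral_zero] at h
    rw [← h]
    refine setIntegral_congr_fun hKm fun x hx => ?_
    simp only [halfField]
    rw [indicator_of_mem (by exact (f.mem_carrier x).1 hx F), inner_smul_left, inner_smul_right]
    rfl

variable {F : (T.elt K).FacetIdx}

section FacetTest

variable (f : Frame (T.elt K)) {V : E (n + 1) → E (n + 1)}

lemma mem_facet_of_tsupport {g : E (n + 1) → ℝ}
    (hgs : tsupport g ⊆ T.facetNbhd K f F) {x : E (n + 1)} (hx : x ∈ tsupport g)
    (hc : inner ℝ (f.nrm F) x = f.off F) : x ∈ (T.elt K).facet F :=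
  (f.mem_facet F x).2 ⟨Mesh.mem_carrier_of_facetNbhd (hgs hx) hc.le, hc⟩

/-- Within the neighbourhood, the inner side of the hyperplane lies in K and the hyperplane itself
lies in F, hence in the boundary of Ω. Cutting there creates no normal jump inside Ω. -/
lemma memQ_halfField_facet (hΩ : IsLipschitzDomain Ω) (hF : T.IsBoundaryFacet K F)
    (hV : ContDiff ℝ ∞ V) (hVc : HasCompactSupport V) (hVs : tsupport V ⊆ T.facetNbhd K f F) :
    MemQ Ω (halfField V (f.nrm F) (f.off F)) :=
  memQ_halfField (T := T) (K := K) hΩ hV hVc (f.norm_nrm F)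
    (fun _x hx h => Mesh.mem_carrier_of_facetNbhd (hVs hx) h)
    fun _ hx h => hF ((f.mem_facet F _).2 ⟨Mesh.mem_carrier_of_facetNbhd (hVs hx) h.le, h⟩)

end FacetTest

/-- A function on a boundary facet that is orthogonal to the test functions supported near the
interior of the facet. -/
lemma ae_facet_eq_zero (hΩ : IsLipschitzDomain Ω) (f : Frame (T.elt K))
    (hF : T.IsBoundaryFacet K F) {w : E (n + 1) → ℝ} (hw : MemLp w 2 (surf Ω))
    (h : ∀ g : E (n + 1) → ℝ, ContDiff ℝ ∞ g → HasCompactSupport g →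
      tsupport g ⊆ T.facetNbhd K f F → ∫ x in (T.elt K).facet F, g x * w x ∂(surf Ω) = 0) :
    ∀ᵐ x ∂((surf Ω).restrict ((T.elt K).facet F)), w x = 0 := by
  have := T.isFiniteMeasure_surf hΩ
  have hint : Integrable w ((surf Ω).restrict ((T.elt K).facet F)) :=
    (hw.restrict _).integrable (by simp)
  have key := (Mesh.isOpen_facetNbhd (f := f) (F := F)).ae_eq_zero_of_integral_contDiff_smul_eq_zero
    (hint.locallyIntegrable.locallyIntegrableOn _) h
  filter_upwards [key, Mesh.surf_facet_diff (f := f) hΩ hF] with x h1 h2 using h1 h2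

/-- The trace of a function that is smooth in an element. -/
lemma MemH1.tr_ae_eq (hΩ : IsLipschitzDomain Ω) (hu : MemH1 Ω u) (hv : ContDiff ℝ ∞ v)
    (huv : ∀ᵐ x ∂(volume.restrict (T.elt K).carrier), u.val x = v x)
    (hF : T.IsBoundaryFacet K F) :
    ∀ᵐ x ∂((surf Ω).restrict ((T.elt K).facet F)), u.tr x = v x := by
  set f := (T.elt K).frame
  have hvs := T.memLp_surf hΩ hv.continuous
  have := ae_facet_eq_zero hΩ f hF (hu.tr_memLp.sub hvs) ?_
  · filter_upwards [this] with x hx using sub_eq_zero.1 hx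
  · intro g hg hgc hgs
    have hsub : tsupport (fun x => g x • f.nrm F) ⊆ T.facetNbhd K f F :=
      (tsupport_smul_subset_left g _).trans hgs
    -- The flux g ν has normal trace g on F. The gradients already agree in K, so Green's formula
    -- leaves only the difference of the traces.
    have hq := memQ_halfField_facet f hΩ hF (V := fun x => g x • f.nrm F)
      (hg.smul contDiff_const) hgc.smul_right hsub
    have hVK : ∀ x ∈ tsupport (fun x => g x • f.nrm F), inner ℝ (f.nrm F) x ≤ f.off F →
        x ∈ (T.elt K).carrier := fun x hx h => Mesh.mem_carrier_of_facetNbhd (hsub hx) h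
    have h := hq.integral_inner_grad_sub hΩ hu hv huv
      (fun x hx => (halfField_eq_zero hVK hx).1) (fun x hx => (halfField_eq_zero hVK hx).2) hvs
    have hz : ∫ x in (T.elt K).carrier, inner ℝ
        ((halfField (fun x => g x • f.nrm F) (f.nrm F) (f.off F)).val x)
        (u.grad x - gradient v x) = 0 := by
      refine integral_eq_zero_of_ae ?_
      filter_upwards [hu.grad_ae_eq hΩ hv huv] with x hx
      simp [hx]
    rw [hz, surf_integral_eq_facet hF] at h
    · rw [h]
      refine setIntegral_congr_fun (Mesh.isCompact_facet f F).measurableSet fun x hx => ?_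
      simp only [halfField]
      rw [indicator_of_mem (by exact ((f.mem_facet F x).1 hx).2), inner_smul_right,
        real_inner_self_eq_norm_sq, f.norm_nrm]
      simp
    · intro x _ hx
      by_cases hc : inner ℝ (f.nrm F) x = f.off F
      · have hgx : g x = 0 := image_eq_zero_of_notMem_tsupport fun hxg =>
          hx (mem_facet_of_tsupport f hgs hxg hc)
        simp only [halfField]
        rw [indicator_of_mem (by exact hc), hgx, zero_smul, inner_zero_right, zero_mul]
      · simp only [halfField]
        rw [indicator_of_notMem (by exact hc), zero_mul]

/-- The normal trace of a field that is smooth in an element. -/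
lemma MemQ.ntr_ae_eq (hΩ : IsLipschitzDomain Ω) {q : FluxField (n + 1)} (hq : MemQ Ω q)
    {V : E (n + 1) → E (n + 1)} (hV : ContDiff ℝ ∞ V)
    (hqV : ∀ᵐ x ∂(volume.restrict (T.elt K).carrier), q.val x = V x)
    (hF : T.IsBoundaryFacet K F) :
    ∀ᵐ x ∂((surf Ω).restrict ((T.elt K).facet F)),
      q.ntr x = inner ℝ ((T.elt K).frame.nrm F) (V x) := by
  set f := (T.elt K).frame with hf
  have hV1 : ContDiff ℝ 1 V := hV.of_le (by simp)
  have hfm := (Mesh.isCompact_facet f F).measurableSet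
  have hKm := (T.elt K).isCompact_carrier.measurableSet
  have := T.isFiniteMeasure_surf hΩ
  have hvs := T.memLp_surf hΩ (v := fun x => inner ℝ (f.nrm F) (V x))
    (continuous_const.inner hV.continuous)
  have := ae_facet_eq_zero hΩ f hF (hq.ntr_memLp.sub hvs) ?_
  · filter_upwards [this] with x hx using sub_eq_zero.1 hx
  · intro g hg hgc hgs
    have hg1 : ContDiff ℝ 1 g := hg.of_le (by simp)
    have hsub : tsupport (fun x => g x • V x) ⊆ T.facetNbhd K f F :=
      (tsupport_smul_subset_left g _).trans hgs
    have hVK : ∀ x ∈ tsupport (fun x => g x • V x), inner ℝ (f.nrm F) x ≤ f.off F →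
        x ∈ (T.elt K).carrier := fun x hx h => Mesh.mem_carrier_of_facetNbhd (hsub hx) h
    -- Two Green formulas share the same volume integral: q against g, and the cut field g V against
    -- the constant 1. Their boundary terms must agree.
    have h1 := (memQ_halfField_facet f hΩ hF (V := fun x => g x • V x)
      (hg.smul hV) hgc.smul_right hsub).green (fun _ => 1) contDiff_const
    have h2 := hq.green g hg
    rw [surf_integral_eq_facet hF] at h1 h2
    rotate_left
    · intro x hx hxF
      have hgx : g x = 0 := image_eq_zero_of_notMem_tsupport fun hxg =>
        hxF (mem_facet_of_tsupport f hgs hxg (Mesh.eq_off_of_facetNbhd hΩ (hgs hxg) hx))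
      rw [hgx, mul_zero]
    · intro x hx hxF
      by_cases hc : inner ℝ (f.nrm F) x = f.off F
      · have hgx : g x = 0 := image_eq_zero_of_notMem_tsupport fun hxg =>
          hxF (mem_facet_of_tsupport f hgs hxg hc)
        simp only [halfField]
        rw [indicator_of_mem (by exact hc), hgx, zero_smul, inner_zero_right, zero_mul]
      · simp only [halfField]
        rw [indicator_of_notMem (by exact hc), zero_mul]
    rw [setIntegral_domain_eq hΩ.isOpen.measurableSet (T.carrier_ae_subset hΩ K)] at h1 h2
    rotate_left
    · intro x hxΩ hx
      have hxg : x ∉ tsupport g := fun hxg => hx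
        (Mesh.mem_carrier_of_facetNbhd_closure (hgs hxg) (subset_closure hxΩ))
      have : gradient g x = 0 := by
        rw [gradient, image_eq_zero_of_notMem_tsupport fun h => hxg (tsupport_fderiv_subset ℝ h)]
        simp
      rw [this, image_eq_zero_of_notMem_tsupport hxg, inner_zero_right, mul_zero, add_zero]
    · intro x hxΩ hx
      obtain ⟨a, b⟩ := halfField_eq_zero hVK hx
      rw [a, b, inner_zero_left, zero_mul, add_zero]
    have h3 : ∫ x in (T.elt K).carrier, (inner ℝ (q.val x) (gradient g x) + q.dv x * g x) =
        ∫ x in (T.elt K).carrier,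
          (inner ℝ ((halfField (fun x => g x • V x) (f.nrm F) (f.off F)).val x)
            (gradient (fun _ => (1 : ℝ)) x) +
            (halfField (fun x => g x • V x) (f.nrm F) (f.off F)).dv x * 1) := by
      refine integral_congr_ae ?_
      filter_upwards [hqV, hq.dv_ae_eq hΩ hV hqV, ae_restrict_mem hKm] with x hx1 hx2 hxK
      have hgr : gradient (fun _ : E (n + 1) => (1 : ℝ)) x = 0 := by simp [gradient]
      rw [hgr, inner_zero_right, zero_add, mul_one, hx1, hx2]
      simp only [halfField]
      rw [indicator_of_mem (by exact (f.mem_carrier x).1 hxK F), dvg_smul hg1 hV1]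
    rw [h3, h1] at h2
    have h4 : ∀ x ∈ (T.elt K).facet F,
        (halfField (fun x => g x • V x) (f.nrm F) (f.off F)).ntr x * 1 =
          g x * inner ℝ (f.nrm F) (V x) := fun x hx => by
      simp only [halfField]
      rw [indicator_of_mem (by exact ((f.mem_facet F x).1 hx).2), inner_smul_right, mul_one]
    rw [setIntegral_congr_fun hfm h4] at h2
    obtain ⟨C, hC⟩ := hg.continuous.bounded_above_of_compact_support hgc
    have i1 : Integrable (fun x => g x * q.ntr x) ((surf Ω).restrict ((T.elt K).facet F)) :=
      ((hq.ntr_memLp.restrict _).integrable (by simp)).bdd_mul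
        hg.continuous.aestronglyMeasurable (ae_of_all _ hC)
    have i2 : Integrable (fun x => g x * inner ℝ (f.nrm F) (V x))
        ((surf Ω).restrict ((T.elt K).facet F)) :=
      ((hvs.restrict _).integrable (by simp)).bdd_mul
        hg.continuous.aestronglyMeasurable (ae_of_all _ hC)
    simp only [Pi.sub_apply, mul_sub]
    rw [integral_sub i1 i2, h2, sub_eq_zero]
    exact integral_congr_ae (ae_of_all _ fun x => mul_comm _ _)

end Representatives

end

section

/-! ### Polynomial representatives -/

/-- Directional derivatives of polynomial functions are polynomial. -/
lemma IsPF.fderiv {n m : ℕ} {f : E n → ℝ} (hf : IsPF m f) (v : E n) :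
    IsPF m (fun x => fderiv ℝ f x v) := by
  -- A finite-dimensional space of functions is closed under pointwise limits, and it contains the
  -- difference quotients.
  have hcl : IsClosed (PF n m : Set (E n → ℝ)) := (PF n m).closed_of_finiteDimensional
  refine mem_PF.1 (hcl.mem_of_tendsto (b := 𝓝[≠] (0 : ℝ))
    (f := fun t x => t⁻¹ * (f (x + t • v) - f x)) ?_ (Eventually.of_forall fun t => ?_))
  · refine tendsto_pi_nhds.2 fun x => ?_
    have hd := ((hf.contDiff.differentiable (by simp)) x).hasFDerivAt.hasLineDerivAt v
    simpa using hd.tendsto_slope_zero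
  · refine mem_PF.2 (const_mul _ (sub (hf.comp fun i => ?_) hf))
    simpa using (coord i).add (const (t * v i))

/-- A field with polynomial components. -/
def IsPFVec {n : ℕ} (m : ℕ) (V : E n → E n) : Prop := ∀ i, IsPF m fun x => V x i

namespace IsPFVec

variable {n m m' : ℕ} {V W : E n → E n}

lemma contDiff (hV : IsPFVec m V) : ContDiff ℝ ∞ V :=
  contDiff_euclidean.2 fun i => (hV i).contDiff

lemma mono (hV : IsPFVec m V) (h : m ≤ m') : IsPFVec m' V := fun i => (hV i).mono h

lemma add (hV : IsPFVec m V) (hW : IsPFVec m W) : IsPFVec m (fun x => V x + W x) :=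
  fun i => (hV i).add (hW i)

lemma smul {f : E n → ℝ} (hf : IsPF m' f) (hV : IsPFVec m V) :
    IsPFVec (m' + m) (fun x => f x • V x) := fun i => hf.mul (hV i)

lemma const_smul (c : ℝ) (hV : IsPFVec m V) : IsPFVec m (fun x => c • V x) :=
  fun i => (hV i).const_mul c

lemma sum {ι : Type*} {s : Finset ι} {F : ι → E n → E n} (h : ∀ j ∈ s, IsPFVec m (F j)) :
    IsPFVec m (fun x => ∑ j ∈ s, F j x) := fun i => by
  simp only [WithLp.ofLp_sum, Finset.sum_apply]
  exact IsPF.sum fun j hj => h j hj i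

lemma inner_const (w : E n) (hV : IsPFVec m V) : IsPF m (fun x => inner ℝ w (V x)) := by
  simp only [PiLp.inner_apply]
  exact IsPF.sum fun i _ => by simpa [mul_comm] using (hV i).const_mul (w i)

lemma gradient {v : E n → ℝ} (hv : IsPF m v) : IsPFVec m (gradient v) := fun i => by
  have : (fun x => _root_.gradient v x i) = fun x => _root_.fderiv ℝ v x
      (EuclideanSpace.single i 1) := by
    ext x
    rw [← InnerProductSpace.toDual_symm_apply, EuclideanSpace.inner_single_right]
    simp [_root_.gradient]
  rw [this]
  exact hv.fderiv _

end IsPFVec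

variable {n : ℕ} {K : Element (n + 1)}

lemma Element.IsPoly.exists_isPF {m : ℕ} {f : E (n + 1) → ℝ} (h : K.IsPoly m f) :
    ∃ g, IsPF m g ∧ ∀ᵐ x ∂(volume.restrict K.carrier), f x = g x := by
  obtain ⟨P, hP, hf⟩ := h
  exact ⟨_, ⟨P, hP, rfl⟩, hf⟩

/-- On a cuboid the degree is at most k + 1 in each of the n + 1 edge coordinates, which bounds the
total degree; this also covers the degree k + 1 on a simplex. -/
lemma Element.MemRTN.exists_isPFVec {k : ℕ} {q : E (n + 1) → E (n + 1)} (h : K.MemRTN k q) :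
    ∃ V, IsPFVec ((n + 1) * (k + 1)) V ∧ ∀ᵐ x ∂(volume.restrict K.carrier), q x = V x := by
  cases K with
  | simplex v hv =>
    obtain ⟨A, B, hA, hB, h⟩ := h
    have hk : k + 1 ≤ (n + 1) * (k + 1) := Nat.le_mul_of_pos_left _ n.succ_pos
    refine ⟨fun x => WithLp.toLp 2 fun i => MvPolynomial.eval (fun j => x j) (A i) +
      MvPolynomial.eval (fun j => x j) B * x i, fun i => ?_, ?_⟩
    · refine IsPF.mono (IsPF.add (IsPF.mono ⟨A i, hA i, rfl⟩ (Nat.le_succ k)) ?_) hk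
      exact IsPF.mul ⟨B, hB, rfl⟩ (IsPF.coord i)
    · filter_upwards [h] with x hx
      ext i
      exact hx i
  | cuboid a b ℓ hℓ =>
    obtain ⟨A, hA, h⟩ := h
    refine ⟨fun x => ∑ i, MvPolynomial.eval (fun j => inner ℝ (b j) (x - a)) (A i) • b i,
      ?_, ?_⟩
    · refine IsPFVec.sum fun i _ j => ?_
      have h1 : IsPF ((n + 1) * (k + 1)) fun x : E (n + 1) =>
          MvPolynomial.eval (fun j => inner ℝ (b j) (x - a)) (A i) := by
        refine IsPF.eval_comp (fun j => ?_) fun s hs => ?_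
        · simp only [inner_sub_right]
          simpa only [← sub_eq_neg_add] using IsPF.affine (b j) (-inner ℝ (b j) a)
        · calc ∑ j, s j ≤ ∑ j : Fin (n + 1), (k + 1) := by
                refine Finset.sum_le_sum fun j _ =>
                  (MvPolynomial.monomial_le_degreeOf j hs).trans ((hA i j).trans ?_)
                split_ifs <;> omega
            _ = _ := by simp
      simpa [mul_comm] using h1.const_mul (b i j)
    · filter_upwards [h] with x hx
      rw [← b.sum_repr (q x)]
      refine Finset.sum_congr rfl fun i _ => ?_
      rw [b.repr_apply_apply, hx i]

/-! ### Piecewise polynomial coefficients -/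

section Piecewise

variable {Ω : Set (E (n + 1))} (T : Mesh Ω) {m : ℕ} {f : E (n + 1) → ℝ}

lemma Mesh.ae_of_ae_carrier {p : E (n + 1) → Prop}
    (h : ∀ K, ∀ᵐ x ∂(volume.restrict (T.elt K).carrier), p x) :
    ∀ᵐ x ∂(volume.restrict Ω), p x := by
  have h1 := (ae_restrict_iUnion_iff (μ := volume) (fun K => (T.elt K).carrier) p).2 h
  rw [T.cover] at h1
  exact ae_restrict_of_ae_restrict_of_subset subset_closure h1

/-- There are finitely many compact elements, with a continuous representative on each. -/
lemma Mesh.exists_bound_of_isPoly (h : ∀ K, (T.elt K).IsPoly m f) :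
    AEStronglyMeasurable f (volume.restrict Ω) ∧
      ∃ C : ℝ, 0 ≤ C ∧ ∀ᵐ x ∂(volume.restrict Ω), |f x| ≤ C := by
  choose g hg hfg using fun K => (h K).exists_isPF
  constructor
  · have h1 : AEStronglyMeasurable f (volume.restrict (⋃ K, (T.elt K).carrier)) :=
      aestronglyMeasurable_iUnion_iff.2 fun K =>
        ((hg K).continuous.aestronglyMeasurable).congr ((hfg K).mono fun x hx => hx.symm)
    rw [T.cover] at h1
    exact h1.mono_set subset_closure
  · choose C hC using fun K => (T.elt K).isCompact_carrier.exists_bound_of_continuousOn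
      (hg K).continuous.continuousOn
    refine ⟨∑ K, |C K|, by positivity, T.ae_of_ae_carrier fun K => ?_⟩
    filter_upwards [hfg K, ae_restrict_mem (T.elt K).isCompact_carrier.measurableSet] with x h1 h2
    rw [h1]
    refine (hC K x h2).trans ((le_abs_self _).trans ?_)
    exact Finset.single_le_sum (f := fun K => |C K|) (fun K _ => abs_nonneg _)
      (Finset.mem_univ K)

lemma Mesh.memLp_isPoly_smul {V : Type*} [NormedAddCommGroup V] [NormedSpace ℝ V]
    (h : ∀ K, (T.elt K).IsPoly m f) {g : E (n + 1) → V} (hg : MemLp g 2 (volume.restrict Ω)) :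
    MemLp (fun x => f x • g x) 2 (volume.restrict Ω) := by
  obtain ⟨hm, C, hC, hb⟩ := T.exists_bound_of_isPoly h
  refine hg.of_le_mul (c := C) (hm.smul hg.1) ?_
  filter_upwards [hb] with x hx
  rw [norm_smul, Real.norm_eq_abs]
  gcongr

end Piecewise

/-! ### Bounds of the diagonal entries -/

/-- Real-valued essential extrema and finite suprema are meaningful only for bounded families; the
uniform bounds lo and hi supply this. -/
lemma ess_bounds {d : ℕ} {μ : Measure (E d)} [NeZero μ] {ι : Type*} [Finite ι] [Nonempty ι]
    {D : ι → E d → ℝ} {lo hi : ℝ} (h : ∀ i, ∀ᵐ x ∂μ, D i x ∈ Icc lo hi) :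
    lo ≤ (⨅ i, essInf (D i) μ) ∧ ∀ᵐ x ∂μ, ∀ i,
      (⨅ i, essInf (D i) μ) ≤ D i x ∧ D i x ≤ ⨆ i, essSup (D i) μ := by
  have hb1 : ∀ i, IsBoundedUnder (· ≤ ·) (ae μ) (D i) := fun i =>
    ⟨hi, eventually_map.2 ((h i).mono fun x hx => hx.2)⟩
  have hb2 : ∀ i, IsBoundedUnder (· ≥ ·) (ae μ) (D i) := fun i =>
    ⟨lo, eventually_map.2 ((h i).mono fun x hx => hx.1)⟩
  constructor
  · exact le_ciInf fun i => le_liminf_of_le (hb1 i).isCoboundedUnder_ge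
      ((h i).mono fun x hx => hx.1)
  · refine ae_all_iff.2 fun i => ?_
    filter_upwards [ae_le_essSup (hb1 i), ae_essInf_le (hb2 i)] with x h1 h2
    exact ⟨(ciInf_le (Finite.bddBelow_range _) i).trans h2,
      h1.trans (le_ciSup (f := fun i => essSup (D i) μ) (Finite.bddAbove_range _) i)⟩

lemma neZero_restrict_carrier (K : Element (n + 1)) : NeZero (volume.restrict K.carrier) :=
  ⟨fun h => (isOpen_interior.measure_pos volume K.frame.interior_nonempty).ne'
    (measure_mono_null interior_subset (Measure.restrict_eq_zero.1 h))⟩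

section Delta

variable {G Nh : ℕ} {Ω : Set (E (n + 1))} (T : Mesh Ω) {X : CrossSections (n + 1) G}

lemma delta_bounds_O (hΩ : IsLipschitzDomain Ω) (hX : X.Admissible Nh Ω) [Nonempty (Idx G Nh)]
    (K : Fin T.card) : 0 < X.deltaMinO Nh (T.elt K) ∧
      ∀ᵐ x ∂(volume.restrict (T.elt K).carrier), ∀ a : Idx G Nh,
        X.deltaMinO Nh (T.elt K) ≤ X.To Nh x a a ∧ X.To Nh x a a ≤ X.deltaMaxO Nh (T.elt K) := by
  obtain ⟨lo, hi, hlo, -, h⟩ := hX.removal_odd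
  have := neZero_restrict_carrier (T.elt K)
  have hb := ess_bounds (μ := volume.restrict (T.elt K).carrier)
    (D := fun (a : Idx G Nh) x => X.To Nh x a a) (lo := lo) (hi := hi) fun a => by
      filter_upwards [ae_mono (T.restrict_carrier_le hΩ K) (h a.1 a.2)] with x hx
      simpa [CrossSections.To, CrossSections.mat] using hx
  exact ⟨hlo.trans_le hb.1, hb.2⟩

lemma delta_bounds_E (hΩ : IsLipschitzDomain Ω) (hX : X.Admissible Nh Ω) [Nonempty (Idx G Nh)]
    (K : Fin T.card) : 0 < X.deltaMinE Nh (T.elt K) ∧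
      ∀ᵐ x ∂(volume.restrict (T.elt K).carrier), ∀ a : Idx G Nh,
        X.deltaMinE Nh (T.elt K) ≤ X.Te Nh x a a ∧ X.Te Nh x a a ≤ X.deltaMaxE Nh (T.elt K) := by
  obtain ⟨lo, hi, hlo, -, h⟩ := hX.removal_even
  have := neZero_restrict_carrier (T.elt K)
  have hb := ess_bounds (μ := volume.restrict (T.elt K).carrier)
    (D := fun (a : Idx G Nh) x => X.Te Nh x a a) (lo := lo) (hi := hi) fun a => by
      filter_upwards [ae_mono (T.restrict_carrier_le hΩ K) (h a.1 a.2)] with x hx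
      simpa [CrossSections.Te, CrossSections.mat] using hx
  exact ⟨hlo.trans_le hb.1, hb.2⟩

end Delta

end

section

variable {n G Nh : ℕ} {Ω : Set (E (n + 1))} {T : Mesh Ω} {X : CrossSections (n + 1) G}

/-! ### The residuals -/

/-- The residual of the conservation equations. -/
def resR (X : CrossSections (n + 1) G) (S : Idx G Nh → E (n + 1) → ℝ)
    (p : Idx G Nh → FluxField (n + 1)) (φ : Idx G Nh → ScalarField (n + 1)) (a : Idx G Nh)
    (x : E (n + 1)) : ℝ :=
  S a x - divHT p a x - ∑ b, X.Te Nh x a b * (φ b).val x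

/-- The residual of the flux equations. -/
def resF (X : CrossSections (n + 1) G) (p : Idx G Nh → FluxField (n + 1))
    (φ : Idx G Nh → ScalarField (n + 1)) (a : Idx G Nh) (x : E (n + 1)) : E (n + 1) :=
  (∑ b, X.To Nh x a b • (p b).val x) + ∑ b, matH G Nh a b • (φ b).grad x

section Integrable

variable {mo me : ℕ}

lemma integrable_mul {α : Type*} [MeasurableSpace α] {μ : Measure α} {f g : α → ℝ}
    (hf : MemLp f 2 μ) (hg : MemLp g 2 μ) : Integrable (fun x => f x * g x) μ := by
  simpa [mul_comm] using integrable_inner hf hg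

lemma memLp_divHT {q : Idx G Nh → FluxField (n + 1)} (hq : ∀ a, MemQ Ω (q a)) (a : Idx G Nh) :
    MemLp (divHT q a) 2 (volume.restrict Ω) :=
  memLp_finsetSum _ fun b _ => (hq b).dv_memLp.const_mul _

lemma memLp_To (hTo : ∀ K a b, (T.elt K).IsPoly mo (fun x => X.To Nh x a b))
    {p : Idx G Nh → FluxField (n + 1)} (hp : ∀ a, MemQ Ω (p a)) (a : Idx G Nh) :
    MemLp (fun x => ∑ b, X.To Nh x a b • (p b).val x) 2 (volume.restrict Ω) :=
  memLp_finsetSum _ fun b _ => T.memLp_isPoly_smul (fun K => hTo K a b) (hp b).val_memLp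

lemma memLp_Te (hTe : ∀ K a b, (T.elt K).IsPoly me (fun x => X.Te Nh x a b))
    {φ : Idx G Nh → E (n + 1) → ℝ} (hφ : ∀ a, MemLp (φ a) 2 (volume.restrict Ω)) (a : Idx G Nh) :
    MemLp (fun x => ∑ b, X.Te Nh x a b * φ b x) 2 (volume.restrict Ω) :=
  memLp_finsetSum _ fun b _ => T.memLp_isPoly_smul (fun K => hTe K a b) (hφ b)

lemma memLp_resR (hTe : ∀ K a b, (T.elt K).IsPoly me (fun x => X.Te Nh x a b))
    {S : Idx G Nh → E (n + 1) → ℝ} (hS : ∀ a, MemLp (S a) 2 (volume.restrict Ω))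
    {p : Idx G Nh → FluxField (n + 1)} (hp : ∀ a, MemQ Ω (p a))
    {φ : Idx G Nh → ScalarField (n + 1)} (hφ : ∀ a, MemH1 Ω (φ a)) (a : Idx G Nh) :
    MemLp (resR X S p φ a) 2 (volume.restrict Ω) :=
  ((hS a).sub (memLp_divHT hp a)).sub (memLp_Te hTe (fun b => (hφ b).val_memLp) a)

lemma memLp_resF (hTo : ∀ K a b, (T.elt K).IsPoly mo (fun x => X.To Nh x a b))
    {p : Idx G Nh → FluxField (n + 1)} (hp : ∀ a, MemQ Ω (p a))
    {φ : Idx G Nh → ScalarField (n + 1)} (hφ : ∀ a, MemH1 Ω (φ a)) (a : Idx G Nh) :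
    MemLp (resF X p φ a) 2 (volume.restrict Ω) :=
  (memLp_To hTo hp a).add (memLp_finsetSum _ fun b _ => (hφ b).grad_memLp.const_smul (matH G Nh a b))

end Integrable

/-! ### The error representation -/

instance {d : ℕ} : Neg (FluxField d) := ⟨fun q => ⟨-q.val, -q.dv, -q.ntr⟩⟩

/-- Allows the weak problem to be tested with (-q, ψ), which changes c into d. -/
lemma MemQ.neg {d : ℕ} {Ω : Set (E d)} {q : FluxField d} (hq : MemQ Ω q) : MemQ Ω (-q) := by
  refine ⟨hq.val_memLp.neg, hq.dv_memLp.neg, hq.ntr_memLp.neg, fun f hf => ?_⟩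
  have h := hq.green f hf
  have h1 : ∀ x, inner ℝ ((-q).val x) (gradient f x) + (-q).dv x * f x =
      -(inner ℝ (q.val x) (gradient f x) + q.dv x * f x) := fun x => by
    change inner ℝ (-(q.val x)) _ + -(q.dv x) * _ = _
    rw [inner_neg_left]
    ring
  have h2 : ∀ x, (-q).ntr x * f x = -(q.ntr x * f x) := fun x => neg_mul _ _
  simp only [h1, h2, integral_neg, h]

/-- The scalar-divergence coupling of an `H¹` family, by Green's formula. -/
lemma ipL2_divHT_eq {q : Idx G Nh → FluxField (n + 1)} (hq : ∀ a, MemQ Ω (q a))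
    {φ : Idx G Nh → ScalarField (n + 1)} (hφ : ∀ a, MemH1 Ω (φ a)) :
    ipL2 Ω (fun a => (φ a).val) (divHT q) =
      (∫ x, ∑ a, (∑ b, matH G Nh a b * (φ b).tr x) * (q a).ntr x ∂(surf Ω)) -
        ∫ x in Ω, ∑ a, inner ℝ (∑ b, matH G Nh a b • (φ b).grad x) ((q a).val x) := by
  have i1 : Integrable (fun x => ∑ a, (φ a).val x * divHT q a x) (volume.restrict Ω) :=
    integrable_finsetSum _ fun a _ => integrable_mul (hφ a).val_memLp (memLp_divHT hq a)
  have i2 : Integrable (fun x => ∑ a, inner ℝ (∑ b, matH G Nh a b • (φ b).grad x) ((q a).val x))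
      (volume.restrict Ω) :=
    integrable_finsetSum _ fun a _ => integrable_inner
      (memLp_finsetSum _ fun b _ => (hφ b).grad_memLp.const_smul (matH G Nh a b))
      (hq a).val_memLp
  rw [eq_sub_iff_add_eq, ipL2, ← integral_add i1 i2]
  have j1 : ∀ a b, Integrable (fun x => matH G Nh a b *
      (inner ℝ ((q a).val x) ((φ b).grad x) + (q a).dv x * (φ b).val x)) (volume.restrict Ω) :=
    fun a b => ((integrable_inner (hq a).val_memLp (hφ b).grad_memLp).add
      (integrable_mul (hq a).dv_memLp (hφ b).val_memLp)).const_mul _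
  have j2 : ∀ a b, Integrable (fun x => matH G Nh a b * ((q a).ntr x * (φ b).tr x)) (surf Ω) :=
    fun a b => (integrable_mul (hq a).ntr_memLp (hφ b).tr_memLp).const_mul _
  calc _ = ∫ x in Ω, ∑ a, ∑ b, matH G Nh a b *
          (inner ℝ ((q a).val x) ((φ b).grad x) + (q a).dv x * (φ b).val x) := by
        refine integral_congr_ae (ae_of_all _ fun x => ?_)
        simp only [divHT, Matrix.transpose_apply, Finset.mul_sum, sum_inner, inner_smul_left,
          mul_add, Finset.sum_add_distrib]
        rw [Finset.sum_comm, add_comm]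
        congr 1
        · simp [real_inner_comm]
        · exact Finset.sum_congr rfl fun a _ => Finset.sum_congr rfl fun b _ => by ring
    _ = ∑ a, ∑ b, matH G Nh a b * ∫ x in Ω,
          (inner ℝ ((q a).val x) ((φ b).grad x) + (q a).dv x * (φ b).val x) := by
        rw [integral_finsetSum _ fun a _ => integrable_finsetSum _ fun b _ => j1 a b]
        refine Finset.sum_congr rfl fun a _ => ?_
        rw [integral_finsetSum _ fun b _ => j1 a b]
        exact Finset.sum_congr rfl fun b _ => integral_const_mul _ _
    _ = ∑ a, ∑ b, matH G Nh a b * ∫ x, (q a).ntr x * (φ b).tr x ∂(surf Ω) := by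
        refine Finset.sum_congr rfl fun a _ => Finset.sum_congr rfl fun b _ => ?_
        rw [(hq a).green_memH1 (hφ b)]
    _ = ∫ x, ∑ a, ∑ b, matH G Nh a b * ((q a).ntr x * (φ b).tr x) ∂(surf Ω) := by
        rw [integral_finsetSum _ fun a _ => integrable_finsetSum _ fun b _ => j2 a b]
        refine Finset.sum_congr rfl fun a _ => ?_
        rw [integral_finsetSum _ fun b _ => j2 a b]
        exact Finset.sum_congr rfl fun b _ => (integral_const_mul _ _).symm
    _ = _ := by
        refine integral_congr_ae (ae_of_all _ fun x => ?_)
        simp only [Finset.sum_mul]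
        exact Finset.sum_congr rfl fun a _ => Finset.sum_congr rfl fun b _ => by ring

/-- The error in terms of the residuals. -/
lemma formD_error {mo me : ℕ} (hTo : ∀ K a b, (T.elt K).IsPoly mo (fun x => X.To Nh x a b))
    (hTe : ∀ K a b, (T.elt K).IsPoly me (fun x => X.Te Nh x a b))
    {S : Idx G Nh → E (n + 1) → ℝ} (hS : ∀ a, MemLp (S a) 2 (volume.restrict Ω))
    {z zh w : State (n + 1) G Nh} {φ : Idx G Nh → ScalarField (n + 1)}
    (hz : IsSolution X Ω S z) (hzh : ∀ a, MemQ Ω (zh.flux a)) (hφ : ∀ a, MemH1 Ω (φ a))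
    (hw : MemX Ω w) :
    formD X Ω (z - reconstruct zh φ) w =
      (∫ x in Ω, ∑ a, resR X S zh.flux φ a x * w.scal a x)
      - (∫ x in Ω, ∑ a, inner ℝ (resF X zh.flux φ a x) ((w.flux a).val x))
      + ∫ x, ∑ a, bdResidual zh.flux φ x a * (w.flux a).ntr x ∂(surf Ω) := by
  obtain ⟨hw1, hw2⟩ := hw
  obtain ⟨⟨hz1, hz2⟩, hsol⟩ := hz
  have hφ2 := fun a => (hφ a).val_memLp
  -- integrability
  have iTo : ∀ p : Idx G Nh → FluxField (n + 1), (∀ a, MemQ Ω (p a)) → Integrable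
      (fun x => ∑ a, inner ℝ (∑ b, X.To Nh x a b • (p b).val x) ((w.flux a).val x))
      (volume.restrict Ω) := fun p hp =>
    integrable_finsetSum _ fun a _ => integrable_inner (memLp_To hTo hp a) (hw1 a).val_memLp
  have iTe : ∀ u : Idx G Nh → E (n + 1) → ℝ, (∀ a, MemLp (u a) 2 (volume.restrict Ω)) →
      Integrable (fun x => ∑ a, (∑ b, X.Te Nh x a b * u b x) * w.scal a x)
      (volume.restrict Ω) := fun u hu =>
    integrable_finsetSum _ fun a _ => integrable_mul (memLp_Te hTe hu a) (hw2 a)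
  have iBd : ∀ p : Idx G Nh → FluxField (n + 1), (∀ a, MemQ Ω (p a)) → Integrable
      (fun x => ∑ a, (∑ b, matGammaT G Nh a b * (p b).ntr x) * (w.flux a).ntr x)
      (surf Ω) := fun p hp =>
    integrable_finsetSum _ fun a _ => integrable_mul
      (memLp_finsetSum _ fun b _ => (hp b).ntr_memLp.const_mul _) (hw1 a).ntr_memLp
  have iDv : ∀ p : Idx G Nh → FluxField (n + 1), (∀ a, MemQ Ω (p a)) → Integrable
      (fun x => ∑ a, w.scal a x * divHT p a x) (volume.restrict Ω) := fun p hp =>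
    integrable_finsetSum _ fun a _ => integrable_mul (hw2 a) (memLp_divHT hp a)
  have iSc : ∀ u : Idx G Nh → E (n + 1) → ℝ, (∀ a, MemLp (u a) 2 (volume.restrict Ω)) →
      Integrable (fun x => ∑ a, u a x * divHT w.flux a x) (volume.restrict Ω) := fun u hu =>
    integrable_finsetSum _ fun a _ => integrable_mul (hu a) (memLp_divHT hw1 a)
  -- linearity in the first argument
  have e1 : formTo X Ω (z - reconstruct zh φ).flux w.flux =
      formTo X Ω z.flux w.flux - formTo X Ω zh.flux w.flux := by
    rw [formTo, formTo, formTo, ← integral_sub (iTo _ hz1) (iTo _ hzh)]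
    refine integral_congr_ae (ae_of_all _ fun x => ?_)
    simp only [← Finset.sum_sub_distrib, ← inner_sub_left, ← smul_sub]
    rfl
  have e2 : formTe X Ω (z - reconstruct zh φ).scal w.scal =
      formTe X Ω z.scal w.scal - formTe X Ω (fun a => (φ a).val) w.scal := by
    rw [formTe, formTe, formTe, ipL2, ipL2, ipL2, ← integral_sub (iTe _ hz2) (iTe _ hφ2)]
    refine integral_congr_ae (ae_of_all _ fun x => ?_)
    simp only [← Finset.sum_sub_distrib, ← sub_mul, ← mul_sub]
    rfl
  have e3 : formBd Ω (z - reconstruct zh φ).flux w.flux =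
      formBd Ω z.flux w.flux - formBd Ω zh.flux w.flux := by
    rw [formBd, formBd, formBd, ← integral_sub (iBd _ hz1) (iBd _ hzh)]
    refine integral_congr_ae (ae_of_all _ fun x => ?_)
    simp only [← Finset.sum_sub_distrib, ← sub_mul, ← mul_sub]
    rfl
  have e4 : ipL2 Ω w.scal (divHT (z - reconstruct zh φ).flux) =
      ipL2 Ω w.scal (divHT z.flux) - ipL2 Ω w.scal (divHT zh.flux) := by
    rw [ipL2, ipL2, ipL2, ← integral_sub (iDv _ hz1) (iDv _ hzh)]
    refine integral_congr_ae (ae_of_all _ fun x => ?_)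
    simp only [divHT, ← Finset.sum_sub_distrib, ← mul_sub]
    rfl
  have e5 : ipL2 Ω (z - reconstruct zh φ).scal (divHT w.flux) =
      ipL2 Ω z.scal (divHT w.flux) - ipL2 Ω (fun a => (φ a).val) (divHT w.flux) := by
    rw [ipL2, ipL2, ipL2, ← integral_sub (iSc _ hz2) (iSc _ hφ2)]
    refine integral_congr_ae (ae_of_all _ fun x => ?_)
    simp only [← Finset.sum_sub_distrib, ← sub_mul]
    rfl
  -- the equation solved by `z`
  have h := hsol ⟨fun a => -w.flux a, w.scal⟩ ⟨fun a => (hw1 a).neg, hw2⟩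
  have n1 : formTo X Ω z.flux (fun a => -w.flux a) = -formTo X Ω z.flux w.flux := by
    rw [formTo, formTo, ← integral_neg]
    refine integral_congr_ae (ae_of_all _ fun x => ?_)
    simp only [← Finset.sum_neg_distrib, ← inner_neg_right]
    rfl
  have n2 : formBd Ω z.flux (fun a => -w.flux a) = -formBd Ω z.flux w.flux := by
    rw [formBd, formBd, ← integral_neg]
    refine integral_congr_ae (ae_of_all _ fun x => ?_)
    simp only [← Finset.sum_neg_distrib, ← mul_neg]
    rfl
  have n3 : ipL2 Ω z.scal (divHT fun a => -w.flux a) = -ipL2 Ω z.scal (divHT w.flux) := by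
    rw [ipL2, ipL2, ← integral_neg]
    refine integral_congr_ae (ae_of_all _ fun x => ?_)
    simp only [divHT, ← Finset.sum_neg_distrib, ← mul_neg]
    rfl
  simp only [formC, n1, n2, n3] at h
  -- the residuals
  have iS : Integrable (fun x => ∑ a, S a x * w.scal a x) (volume.restrict Ω) :=
    integrable_finsetSum _ fun a _ => integrable_mul (hS a) (hw2 a)
  have iSD : Integrable (fun x => (∑ a, S a x * w.scal a x) -
      ∑ a, w.scal a x * divHT zh.flux a x) (volume.restrict Ω) := iS.sub (iDv _ hzh)
  have r1 : ∫ x in Ω, ∑ a, resR X S zh.flux φ a x * w.scal a x =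
      ipL2 Ω S w.scal - ipL2 Ω w.scal (divHT zh.flux) -
        formTe X Ω (fun a => (φ a).val) w.scal := by
    rw [formTe, ipL2, ipL2, ipL2, ← integral_sub iS (iDv _ hzh),
      ← integral_sub iSD (iTe _ hφ2)]
    refine integral_congr_ae (ae_of_all _ fun x => ?_)
    simp only [← Finset.sum_sub_distrib, resR]
    exact Finset.sum_congr rfl fun a _ => by ring
  have iH : Integrable (fun x => ∑ a, inner ℝ (∑ b, matH G Nh a b • (φ b).grad x)
      ((w.flux a).val x)) (volume.restrict Ω) :=
    integrable_finsetSum _ fun a _ => integrable_inner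
      (memLp_finsetSum _ fun b _ => (hφ b).grad_memLp.const_smul (matH G Nh a b))
      (hw1 a).val_memLp
  have r2 : ∫ x in Ω, ∑ a, inner ℝ (resF X zh.flux φ a x) ((w.flux a).val x) =
      formTo X Ω zh.flux w.flux +
        ∫ x in Ω, ∑ a, inner ℝ (∑ b, matH G Nh a b • (φ b).grad x) ((w.flux a).val x) := by
    rw [formTo, ← integral_add (iTo _ hzh) iH]
    refine integral_congr_ae (ae_of_all _ fun x => ?_)
    simp only [resF, inner_add_left, Finset.sum_add_distrib]
  have iT : Integrable (fun x => ∑ a, (∑ b, matH G Nh a b * (φ b).tr x) * (w.flux a).ntr x)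
      (surf Ω) :=
    integrable_finsetSum _ fun a _ => integrable_mul
      (memLp_finsetSum _ fun b _ => (hφ b).tr_memLp.const_mul _) (hw1 a).ntr_memLp
  have r3 : ∫ x, ∑ a, bdResidual zh.flux φ x a * (w.flux a).ntr x ∂(surf Ω) =
      (∫ x, ∑ a, (∑ b, matH G Nh a b * (φ b).tr x) * (w.flux a).ntr x ∂(surf Ω)) -
        formBd Ω zh.flux w.flux := by
    rw [formBd, ← integral_sub iT (iBd _ hzh)]
    refine integral_congr_ae (ae_of_all _ fun x => ?_)
    simp only [bdResidual, sub_mul, Finset.sum_sub_distrib]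
  -- Green's formula replaces the coupling of φ with div q by a gradient term, which completes the
  -- flux residual, and by a trace term, which completes the boundary residual.
  rw [formD, e1, e2, e3, e4, e5, ipL2_divHT_eq hw1 hφ, r1, r2, r3]
  linarith

/-! ### Duality with the local norm -/

/-- Rescaling of a state. -/
def scaleState {d : ℕ} (t : ℝ) (w : State d G Nh) : State d G Nh :=
  ⟨fun a => ⟨t • (w.flux a).val, t • (w.flux a).dv, t • (w.flux a).ntr⟩, fun a => t • w.scal a⟩

lemma MemXK.scaleState {K : Fin T.card} {w : State (n + 1) G Nh} (hw : MemXK T K w) (t : ℝ) :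
    MemXK T K (scaleState t w) := by
  obtain ⟨⟨h1, h2⟩, h3, h4⟩ := hw
  refine ⟨⟨fun a => ⟨(h1 a).val_memLp.const_smul t, (h1 a).dv_memLp.const_smul t,
    (h1 a).ntr_memLp.const_smul t, fun f hf => ?_⟩, fun a => (h2 a).const_smul t⟩, fun a => ?_,
    fun a => ?_⟩
  · have h := (h1 a).green f hf
    have e : ∀ x, inner ℝ (t • (w.flux a).val x) (gradient f x) + t * (w.flux a).dv x * f x =
        t * (inner ℝ ((w.flux a).val x) (gradient f x) + (w.flux a).dv x * f x) := fun x => by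
      rw [real_inner_smul_left]
      ring
    simp only [SPN.scaleState, Pi.smul_apply, smul_eq_mul, e]
    simp only [mul_assoc, integral_const_mul, h]
  · filter_upwards [h3 a] with x hx hxK
    simp [SPN.scaleState, hx hxK]
  · filter_upwards [h4 a] with x hx hxK
    simp [SPN.scaleState, hx hxK]

lemma normS_scaleState {t : ℝ} (ht : 0 ≤ t) (w : State (n + 1) G Nh) :
    normS X T (scaleState t w) = t * normS X T w := by
  have h1 : ∀ x (a : Idx G Nh), X.To Nh x a a * ‖t • (w.flux a).val x‖ ^ 2 =
      t ^ 2 * (X.To Nh x a a * ‖(w.flux a).val x‖ ^ 2) := fun x a => by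
    rw [norm_smul, mul_pow, Real.norm_eq_abs, sq_abs]; ring
  have h2 : ∀ x (a : Idx G Nh), X.Te Nh x a a * (t * w.scal a x) ^ 2 =
      t ^ 2 * (X.Te Nh x a a * w.scal a x ^ 2) := fun x a => by ring
  have h3 : ∀ x (a : Idx G Nh), (t * (w.flux a).dv x) ^ 2 = t ^ 2 * (w.flux a).dv x ^ 2 :=
    fun x a => by ring
  have h4 : ∀ x (a : Idx G Nh), (∑ b, matGammaT G Nh a b * (t * (w.flux b).ntr x)) *
      (t * (w.flux a).ntr x) =
      t ^ 2 * ((∑ b, matGammaT G Nh a b * (w.flux b).ntr x) * (w.flux a).ntr x) := fun x a => by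
    simp only [mul_left_comm _ t, ← Finset.mul_sum]; ring
  unfold normS
  rw [← Real.sqrt_sq ht, ← Real.sqrt_mul (sq_nonneg t), Real.sqrt_sq ht]
  congr 1
  simp only [SPN.scaleState, Pi.smul_apply, smul_eq_mul, h1, h2, h3, h4, ← Finset.mul_sum,
    integral_const_mul, mul_add]
  congr 1
  · congr 1
    rw [Finset.mul_sum]
    exact Finset.sum_congr rfl fun K _ => by ring
  · rw [Finset.mul_sum]
    refine Finset.sum_congr rfl fun K _ => ?_
    rw [Finset.mul_sum]
    refine Finset.sum_congr rfl fun F _ => ?_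
    split_ifs
    · ring
    · simp

lemma formD_scaleState (t : ℝ) (e w : State (n + 1) G Nh) :
    formD X Ω e (scaleState t w) = t * formD X Ω e w := by
  have h4 : ∀ x (a : Idx G Nh), divHT (scaleState t w).flux a x = t * divHT w.flux a x :=
    fun x a => by
      simp only [divHT, SPN.scaleState, Pi.smul_apply, smul_eq_mul, mul_left_comm _ t,
        ← Finset.mul_sum]
  simp only [formD, formTo, formTe, formBd, ipL2, h4]
  simp only [SPN.scaleState, Pi.smul_apply, smul_eq_mul, inner_smul_right, mul_left_comm _ t,
    mul_assoc t, ← Finset.mul_sum, integral_const_mul]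
  ring

/-- By homogeneity w / A competes in the supremum. Any positive upper bound A of the norm will do,
so the norm of a test state never has to be computed exactly. -/
lemma formD_le_of_localNorm {K : Fin T.card} {e w : State (n + 1) G Nh} (hw : MemXK T K w)
    {A : ℝ} (hA : 0 < A) (hwA : normS X T w ≤ A) {N : ℝ} (hN : 0 ≤ N)
    (h : localNorm X T K e ≤ ENNReal.ofReal N) : formD X Ω e w ≤ A * N := by
  have h1 : ENNReal.ofReal (formD X Ω e (scaleState A⁻¹ w)) ≤ localNorm X T K e := by
    refine le_iSup₂_of_le (scaleState A⁻¹ w) ⟨hw.scaleState _, ?_⟩ le_rfl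
    rw [normS_scaleState (by positivity), inv_mul_le_iff₀ hA, mul_one]
    exact hwA
  have h2 := (ENNReal.ofReal_le_ofReal_iff hN).1 (h1.trans h)
  rwa [formD_scaleState, inv_mul_le_iff₀ hA] at h2

end

section

/-! ### The estimator of the conservation equations -/

section Zero

variable {d : ℕ} {Ω : Set (E d)}

instance : Zero (FluxField d) := ⟨⟨0, 0, 0⟩⟩

lemma memQ_zero : MemQ Ω (0 : FluxField d) := by
  refine ⟨MemLp.zero, MemLp.zero, MemLp.zero, fun f _ => ?_⟩
  change ∫ x in Ω, (inner ℝ (0 : E d) (gradient f x) + (0 : ℝ) * f x) =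
    ∫ x, (0 : ℝ) * f x ∂(surf Ω)
  simp

end Zero

variable {n G Nh : ℕ} {Ω : Set (E (n + 1))} {T : Mesh Ω} {X : CrossSections (n + 1) G}

/-- The removal terms are bounded below, so dividing by them preserves square integrability. -/
lemma memLp_resR_div {me : ℕ} (hX : X.Admissible Nh Ω)
    (hTe : ∀ K a b, (T.elt K).IsPoly me (fun x => X.Te Nh x a b)) (K : Fin T.card)
    {R : E (n + 1) → ℝ} (hR : MemLp R 2 (volume.restrict Ω)) (a : Idx G Nh) :
    MemLp (indicator (T.elt K).carrier fun x => R x / X.Te Nh x a a) 2 (volume.restrict Ω) := by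
  obtain ⟨lo, hi, hlo, -, h⟩ := hX.removal_even
  refine MemLp.indicator (T.elt K).isCompact_carrier.measurableSet ?_
  refine hR.of_le_mul (c := lo⁻¹) ?_ ?_
  · have h1 := (T.exists_bound_of_isPoly fun K => hTe K a a).1
    exact (hR.1.aemeasurable.div h1.aemeasurable).aestronglyMeasurable
  · filter_upwards [h a.1 a.2] with x hx
    have h2 : lo ≤ X.Te Nh x a a := by
      simpa [CrossSections.Te, CrossSections.mat] using hx.1
    rw [norm_div, Real.norm_of_nonneg (hlo.le.trans h2), div_eq_inv_mul]
    gcongr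

/-- Scalar tests are only required to be square integrable, so δ_e⁻¹ R can be cut off sharply at K
without a bubble. It pairs with R to η² and has norm exactly η, whence the constant 1. -/
lemma etaR_le {me mo : ℕ} (hΩ : IsLipschitzDomain Ω) (hX : X.Admissible Nh Ω)
    [Nonempty (Idx G Nh)]
    (hTo : ∀ K a b, (T.elt K).IsPoly mo (fun x => X.To Nh x a b))
    (hTe : ∀ K a b, (T.elt K).IsPoly me (fun x => X.Te Nh x a b))
    {S : Idx G Nh → E (n + 1) → ℝ} (hS : ∀ a, MemLp (S a) 2 (volume.restrict Ω))
    {z zh : State (n + 1) G Nh} {φ : Idx G Nh → ScalarField (n + 1)}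
    (hz : IsSolution X Ω S z) (hzh : ∀ a, MemQ Ω (zh.flux a)) (hφ : ∀ a, MemH1 Ω (φ a))
    {K : Fin T.card} {N : ℝ} (hN : 0 ≤ N)
    (h : localNorm X T K (z - reconstruct zh φ) ≤ ENNReal.ofReal N) :
    etaR X S (T.elt K) zh.flux φ ≤ N := by
  have hKm := (T.elt K).isCompact_carrier.measurableSet
  obtain ⟨hmin, hdiag⟩ := delta_bounds_E T hΩ hX K
  set R := resR X S zh.flux φ with hRdef
  have hR := memLp_resR (X := X) hTe hS hzh hφ
  set η := etaR X S (T.elt K) zh.flux φ with hη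
  have hη0 : 0 ≤ η := Real.sqrt_nonneg _
  have hη2 : η ^ 2 = ∫ x in (T.elt K).carrier, ∑ a, R a x ^ 2 / X.Te Nh x a a := by
    refine Real.sq_sqrt (integral_nonneg_of_ae ?_)
    filter_upwards [hdiag] with x hx
    exact Finset.sum_nonneg fun a _ => div_nonneg (sq_nonneg _) (hmin.le.trans (hx a).1)
  rcases hη0.eq_or_lt with h0 | hpos
  · rw [← h0]; exact hN
  set w : State (n + 1) G Nh :=
    ⟨0, fun a => indicator (T.elt K).carrier fun x => R a x / X.Te Nh x a a⟩ with hw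
  have hwX : MemX Ω w := ⟨fun a => memQ_zero, fun a => memLp_resR_div hX hTe K (hR a) a⟩
  have hwK : MemXK T K w := by
    refine ⟨hwX, fun a => ae_of_all _ fun x hx => by simp [hw, indicator_of_notMem hx],
      fun a => ae_of_all _ fun x _ => rfl⟩
  have hnorm : normS X T w = η := by
    have e1 : ∫ x in Ω, ∑ a, X.Te Nh x a a * w.scal a x ^ 2 = η ^ 2 := by
      rw [hη2, setIntegral_domain_eq hΩ.isOpen.measurableSet (T.carrier_ae_subset hΩ K)]
      · refine integral_congr_ae ?_
        filter_upwards [hdiag, ae_restrict_mem hKm] with x hx hxK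
        refine Finset.sum_congr rfl fun a _ => ?_
        have : X.Te Nh x a a ≠ 0 := (hmin.trans_le (hx a).1).ne'
        simp only [hw, indicator_of_mem hxK]
        field_simp
      · intro x _ hx
        simp [hw, indicator_of_notMem hx]
    have z1 : ∀ a x, (w.flux a).val x = 0 := fun _ _ => rfl
    have z2 : ∀ a x, (w.flux a).dv x = 0 := fun _ _ => rfl
    have z3 : ∀ a x, (w.flux a).ntr x = 0 := fun _ _ => rfl
    rw [normS, e1]
    simp only [z1, z2, z3]
    simp [Real.sqrt_sq hη0]
  have key := formD_le_of_localNorm hwK hpos hnorm.le hN h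
  rw [formD_error hTo hTe hS hz hzh hφ hwX] at key
  have k2 : ∫ x in Ω, ∑ a, inner ℝ (resF X zh.flux φ a x) ((w.flux a).val x) = 0 := by
    have z1 : ∀ a x, (w.flux a).val x = 0 := fun _ _ => rfl
    simp [z1]
  have k3 : ∫ x, ∑ a, bdResidual zh.flux φ x a * (w.flux a).ntr x ∂(surf Ω) = 0 := by
    have z3 : ∀ a x, (w.flux a).ntr x = 0 := fun _ _ => rfl
    simp [z3]
  have k1 : ∫ x in Ω, ∑ a, resR X S zh.flux φ a x * w.scal a x = η ^ 2 := by
    rw [hη2, setIntegral_domain_eq hΩ.isOpen.measurableSet (T.carrier_ae_subset hΩ K)]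
    · refine setIntegral_congr_fun hKm fun x hxK => ?_
      refine Finset.sum_congr rfl fun a _ => ?_
      simp only [hw, indicator_of_mem hxK, ← hRdef]
      ring
    · intro x _ hx
      simp [hw, indicator_of_notMem hx]
  rw [k1, k2, k3, sub_zero, add_zero, sq] at key
  exact le_of_mul_le_mul_left key hpos

/-! ### The norm of a flux supported in one element -/

/-- Distinct elements overlap only in their frontiers, which are null. -/
lemma Mesh.setIntegral_carrier_eq_zero (T : Mesh Ω) {K K' : Fin T.card} (hK : K' ≠ K)
    {g : E (n + 1) → ℝ} (hg : ∀ x ∉ (T.elt K).carrier, g x = 0) :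
    ∫ x in (T.elt K').carrier, g x = 0 := by
  refine integral_eq_zero_of_ae ?_
  have h1 := (T.elt K).convex_carrier.addHaar_frontier volume
  have h2 := (T.elt K').convex_carrier.addHaar_frontier volume
  filter_upwards [ae_restrict_mem (T.elt K').isCompact_carrier.measurableSet,
    ae_restrict_of_ae (compl_mem_ae_iff.2 h1), ae_restrict_of_ae (compl_mem_ae_iff.2 h2)]
    with x hx hf hf'
  refine hg x fun hxK => ?_
  have hi : x ∈ interior (T.elt K).carrier := by
    by_contra hi; exact hf ⟨subset_closure hxK, hi⟩
  have hi' : x ∈ interior (T.elt K').carrier := by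
    by_contra hi; exact hf' ⟨subset_closure hx, hi⟩
  exact disjoint_left.1 (T.disjoint K K' hK.symm) hi hi'

-- The element terms of the norm collapse to K. The facet sum is kept whole, since the normal trace
-- is a separate datum on which nothing is assumed here.
open Classical in
lemma normS_sq_le (hΩ : IsLipschitzDomain Ω) {K : Fin T.card} {w : State (n + 1) G Nh}
    (hs : ∀ a, w.scal a = 0) (h1 : ∀ a, ∀ x ∉ (T.elt K).carrier, (w.flux a).val x = 0)
    (h2 : ∀ a, ∀ x ∉ (T.elt K).carrier, (w.flux a).dv x = 0) {A : ℝ} (hA : 0 ≤ A)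
    (h : (∫ x in (T.elt K).carrier, ∑ a, X.To Nh x a a * ‖(w.flux a).val x‖ ^ 2)
      + (X.deltaMaxO Nh (T.elt K) * (T.elt K).diam ^ 2 *
        ∫ x in (T.elt K).carrier, ∑ a, (w.flux a).dv x ^ 2)
      + (∑ K, ∑ F : (T.elt K).FacetIdx,
        if T.IsBoundaryFacet K F then
          X.deltaMaxO Nh (T.elt K) * (T.elt K).altitude F *
            ∫ x in (T.elt K).facet F,
              (∑ a, (∑ b, matGammaT G Nh a b * (w.flux b).ntr x) * (w.flux a).ntr x) ∂(surf Ω)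
        else 0) ≤ A ^ 2) : normS X T w ≤ A := by
  refine Real.sqrt_le_iff.2 ⟨hA, le_trans (le_of_eq ?_) h⟩
  rw [setIntegral_domain_eq hΩ.isOpen.measurableSet (T.carrier_ae_subset hΩ K) (g := fun x =>
    ∑ a, X.To Nh x a a * ‖(w.flux a).val x‖ ^ 2)]
  · simp only [hs, Pi.zero_apply, ne_eq, OfNat.ofNat_ne_zero, not_false_eq_true, zero_pow,
      mul_zero, Finset.sum_const_zero, integral_zero, add_zero]
    congr 2
    rw [Finset.sum_eq_single K]
    · intro K' _ hK
      rw [T.setIntegral_carrier_eq_zero hK, mul_zero]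
      intro x hx
      simp [h2 _ x hx]
    · simp
  · intro x _ hx
    simp [h1 _ x hx]

/-! ### Cut-off functions -/

/-- Smooth cut-off functions at every scale. -/
lemma exists_cutoff (n : ℕ) : ∃ L : ℝ, 0 < L ∧ ∀ (x0 : E n) (s : ℝ), 0 < s →
    ∃ χ : E n → ℝ, ContDiff ℝ ∞ χ ∧ (∀ x, 0 ≤ χ x ∧ χ x ≤ 1) ∧
      (∀ x ∈ Metric.ball x0 (1 / 2 * s), χ x = 1) ∧ tsupport χ ⊆ Metric.closedBall x0 s ∧
      (∀ x ∉ Metric.ball x0 s, χ x = 0) ∧ ∀ x, ‖gradient χ x‖ ≤ L / s := by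
  let ψ : ContDiffBump (0 : E n) := ⟨1 / 2, 1, by norm_num, by norm_num⟩
  have hψ : ContDiff ℝ ∞ ψ := ψ.contDiff
  have hψ1 : ContDiff ℝ 1 ψ := ψ.contDiff
  obtain ⟨L, hL⟩ := (hψ1.continuous_fderiv (by simp)).bounded_above_of_compact_support
    (ψ.hasCompactSupport.fderiv ℝ)
  refine ⟨|L| + 1, by positivity, fun x0 s hs => ?_⟩
  have hd : ∀ x, ‖s⁻¹ • (x - x0)‖ = s⁻¹ * dist x x0 := fun x => by
    rw [norm_smul, Real.norm_of_nonneg (by positivity), dist_eq_norm]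
  have hout : ∀ x ∉ Metric.ball x0 s, ψ (s⁻¹ • (x - x0)) = 0 := fun x hx => by
    refine ψ.zero_of_le_dist ?_
    rw [dist_zero_right, hd, le_inv_mul_iff₀ hs, mul_one]
    exact not_lt.1 hx
  refine ⟨fun x => ψ (s⁻¹ • (x - x0)), hψ.comp (by fun_prop),
    fun x => ⟨ψ.nonneg, ψ.le_one⟩, fun x hx => ?_, ?_, hout, fun x => ?_⟩
  · refine ψ.one_of_mem_closedBall ?_
    rw [mem_closedBall_zero_iff, hd, inv_mul_le_iff₀ hs]
    rw [Metric.mem_ball] at hx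
    change _ ≤ s * (1 / 2)
    linarith
  · refine closure_minimal (fun x hx => ?_) Metric.isClosed_closedBall
    by_contra h
    exact hx (hout x fun hb => h (Metric.ball_subset_closedBall hb))
  · have h1 : HasFDerivAt (fun x => s⁻¹ • (x - x0)) (s⁻¹ • ContinuousLinearMap.id ℝ (E n)) x :=
      ((hasFDerivAt_id x).sub_const x0).const_smul s⁻¹
    have h2 := ((hψ1.differentiable (by simp) (s⁻¹ • (x - x0))).hasFDerivAt).comp x h1
    rw [gradient, LinearIsometryEquiv.norm_map]
    have h3 : fderiv ℝ (fun x => ψ (s⁻¹ • (x - x0))) x = s⁻¹ • fderiv ℝ ψ (s⁻¹ • (x - x0)) := by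
      refine h2.fderiv.trans ?_
      ext v
      simp
    rw [h3, norm_smul, Real.norm_of_nonneg (by positivity), div_eq_inv_mul]
    gcongr
    exact (hL _).trans ((le_abs_self _).trans (by linarith))

end

section

/-! ### Bubble functions in an element -/

variable {n : ℕ}

lemma integrableOn_of_continuous {d : ℕ} {f : E d → ℝ} (hf : Continuous f) {s : Set (E d)}
    (hs : Bornology.IsBounded s) : IntegrableOn f s :=
  (hf.continuousOn.integrableOn_compact hs.isCompact_closure).mono_set subset_closure

/-- The divergence of a truncated field. -/
lemma dvg_smul_sq_le {χ : E n → ℝ} (hχ : ContDiff ℝ ∞ χ) {V : E n → E n} (hV : ContDiff ℝ ∞ V)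
    {b : ℝ} {x : E n} (h0 : 0 ≤ χ x) (h1 : χ x ≤ 1) (hb : ‖gradient χ x‖ ≤ b) :
    dvg (fun x => χ x • V x) x ^ 2 ≤ 2 * (b ^ 2 * ‖V x‖ ^ 2 + dvg V x ^ 2) := by
  rw [dvg_smul (hχ.of_le (by simp)) (hV.of_le (by simp))]
  have i1 : inner ℝ (V x) (gradient χ x) ^ 2 ≤ b ^ 2 * ‖V x‖ ^ 2 := by
    rw [← mul_pow, ← sq_abs]
    refine pow_le_pow_left₀ (abs_nonneg _) ((abs_real_inner_le_norm _ _).trans ?_) 2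
    rw [mul_comm]
    gcongr
  have i2 : (dvg V x * χ x) ^ 2 ≤ dvg V x ^ 2 := by
    rw [mul_pow]
    refine mul_le_of_le_one_right (sq_nonneg _) (pow_le_one₀ h0 h1)
  linarith [sq_nonneg (inner ℝ (V x) (gradient χ x) - dvg V x * χ x),
    add_sq' (inner ℝ (V x) (gradient χ x)) (dvg V x * χ x),
    sub_sq' (inner ℝ (V x) (gradient χ x)) (dvg V x * χ x)]

lemma norm_sq_eq_sum (v : E n) : ‖v‖ ^ 2 = ∑ i, v i ^ 2 := by
  rw [EuclideanSpace.real_norm_sq_eq]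

lemma integral_norm_sq_eq_sum {V : E n → E n} (hV : Continuous V) {s : Set (E n)}
    (hs : Bornology.IsBounded s) :
    ∫ x in s, ‖V x‖ ^ 2 = ∑ i, ∫ x in s, V x i ^ 2 := by
  have hi : ∀ i, IntegrableOn (fun x => V x i ^ 2) s := fun i =>
    integrableOn_of_continuous (by fun_prop) hs
  rw [← integral_finsetSum _ fun i _ => hi i]
  simp only [norm_sq_eq_sum]

/-- Inverse estimate for the divergence. -/
lemma exists_dvg_bound (n m : ℕ) : ∃ C : ℝ, 0 < C ∧ ∀ V : E n → E n, IsPFVec m V →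
    ∀ (x0 : E n) (s : ℝ), 0 < s → s ^ 2 * ∫ x in Metric.ball x0 s, dvg V x ^ 2 ≤
      C * ∫ x in Metric.ball x0 s, ‖V x‖ ^ 2 := by
  obtain ⟨C, hC, h⟩ := exists_inverse_bound n m
  -- Cauchy-Schwarz over the n diagonal derivatives gives n C; n + 1 is positive in dimension zero
  -- as well.
  refine ⟨(n + 1) * C, by positivity, fun V hV x0 s hs => ?_⟩
  have hVc := hV.contDiff
  have hball := Metric.isBounded_ball (x := x0) (r := s)
  have hd : ∀ i, Continuous fun x => fderiv ℝ (fun x => V x i) x (EuclideanSpace.single i 1) :=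
    fun i => ((hV i).fderiv _).continuous
  have h1 : ∀ x, dvg V x ^ 2 ≤
      n * ∑ i, (fderiv ℝ (fun x => V x i) x (EuclideanSpace.single i 1)) ^ 2 := fun x => by
    have e : dvg V x = ∑ i, fderiv ℝ (fun x => V x i) x (EuclideanSpace.single i 1) := by
      rw [dvg_eq_sum (EuclideanSpace.basisFun (Fin n) ℝ)]
      refine Finset.sum_congr rfl fun i _ => ?_
      have hVd := (hVc.differentiable (by simp) x).hasFDerivAt
      have hp := ((EuclideanSpace.proj (𝕜 := ℝ) i).hasFDerivAt.comp x hVd).fderiv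
      have hp' : fderiv ℝ (fun x => V x i) x = (EuclideanSpace.proj (𝕜 := ℝ) i).comp
          (fderiv ℝ V x) := hp
      rw [hp']
      simp [EuclideanSpace.inner_single_left]
    rw [e]
    simpa using sq_sum_le_card_mul_sum_sq (s := Finset.univ)
      (f := fun i => fderiv ℝ (fun x => V x i) x (EuclideanSpace.single i 1))
  have h2 : ∫ x in Metric.ball x0 s, dvg V x ^ 2 ≤ n * ∑ i, ∫ x in Metric.ball x0 s,
      (fderiv ℝ (fun x => V x i) x (EuclideanSpace.single i 1)) ^ 2 := by
    have hi : ∀ i, IntegrableOn (fun x =>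
        (fderiv ℝ (fun x => V x i) x (EuclideanSpace.single i 1)) ^ 2) (Metric.ball x0 s) :=
      fun i => integrableOn_of_continuous ((hd i).pow 2) hball
    rw [← integral_finsetSum _ fun i _ => hi i, ← integral_const_mul]
    refine integral_mono (integrableOn_of_continuous
      ((continuous_dvg (hVc.of_le (by simp))).pow 2) hball)
      (integrableOn_of_continuous (by fun_prop) hball) h1
  have h3 : ∀ i, s ^ 2 * ∫ x in Metric.ball x0 s,
      (fderiv ℝ (fun x => V x i) x (EuclideanSpace.single i 1)) ^ 2 ≤
      C * ∫ x in Metric.ball x0 s, V x i ^ 2 := fun i => by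
    refine (h _ (hV i) x0 s hs _ (by simp)).trans ?_
    gcongr
    · exact ae_of_all _ fun x => sq_nonneg _
    · exact integrableOn_of_continuous ((hV i).continuous.pow 2) hball
    · linarith
  have h4 := integral_norm_sq_eq_sum hVc.continuous hball
  have hn : (0 : ℝ) ≤ n := n.cast_nonneg
  have hI : 0 ≤ ∫ x in Metric.ball x0 s, ‖V x‖ ^ 2 := integral_nonneg fun x => sq_nonneg _
  calc s ^ 2 * ∫ x in Metric.ball x0 s, dvg V x ^ 2
      ≤ s ^ 2 * (n * ∑ i, ∫ x in Metric.ball x0 s,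
        (fderiv ℝ (fun x => V x i) x (EuclideanSpace.single i 1)) ^ 2) := by gcongr
    _ = n * ∑ i, s ^ 2 * ∫ x in Metric.ball x0 s,
        (fderiv ℝ (fun x => V x i) x (EuclideanSpace.single i 1)) ^ 2 := by
      rw [Finset.mul_sum, Finset.mul_sum, Finset.mul_sum]
      exact Finset.sum_congr rfl fun i _ => by ring
    _ ≤ n * ∑ i, C * ∫ x in Metric.ball x0 s, V x i ^ 2 := by
      exact mul_le_mul_of_nonneg_left (Finset.sum_le_sum fun i _ => h3 i) hn
    _ = n * (C * ∫ x in Metric.ball x0 s, ‖V x‖ ^ 2) := by rw [← Finset.mul_sum, ← h4]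
    _ ≤ _ := by nlinarith [mul_nonneg hC.le hI]

/-- A bubble function in an element, for which the norms of polynomial fields with and without
the bubble function are equivalent and an inverse estimate holds. -/
lemma exists_bubble (n m : ℕ) {κ : ℝ} (hκ : 0 < κ) : ∃ C : ℝ, 0 < C ∧
    ∀ K : Element (n + 1), κ ≤ K.shapeReg → ∃ χ : E (n + 1) → ℝ, ContDiff ℝ ∞ χ ∧
      HasCompactSupport χ ∧ tsupport χ ⊆ interior K.carrier ∧ (∀ x, 0 ≤ χ x ∧ χ x ≤ 1) ∧
      ∀ V : E (n + 1) → E (n + 1), IsPFVec m V →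
        ∫ x in K.carrier, ‖V x‖ ^ 2 ≤ C * ∫ x in K.carrier, χ x * ‖V x‖ ^ 2 ∧
        K.diam ^ 2 * ∫ x in K.carrier, dvg (fun x => χ x • V x) x ^ 2 ≤
          C * ∫ x in K.carrier, ‖V x‖ ^ 2 := by
  -- By `Frame.ctr_le` and `Frame.le_ht`, the centre is at distance at least 2 ρ h_K from every face
  -- hyperplane, so the ball of radius ρ h_K lies in the interior.
  set ρ : ℝ := κ / 2 ^ n / (2 * (n + 2)) with hρ
  have hρ0 : 0 < ρ := by positivity
  obtain ⟨L, hL, hcut⟩ := exists_cutoff (n + 1)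
  -- With s = ρ h_K, the factor 2/ρ gives a ball of radius 2 h_K about the centre, which contains K.
  obtain ⟨C1, hC1, hball⟩ := exists_ball_bound (n + 1) m (2 / ρ)
  obtain ⟨C2, hC2, hdvg⟩ := exists_dvg_bound (n + 1) m
  refine ⟨C1 + 2 * (L ^ 2 + C2) / ρ ^ 2, by positivity, fun K hK => ?_⟩
  set f := K.frame
  obtain ⟨F0⟩ := Frame.facet_nonempty_idx K
  have hd : 0 < K.diam := f.diam_pos F0
  set s := ρ * K.diam with hs
  have hs0 : 0 < s := by positivity
  obtain ⟨χ, hχ, h01, hone, hts, hout, hgr⟩ := hcut f.ctr s hs0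
  have hsub : Metric.closedBall f.ctr s ⊆ interior K.carrier := fun x hx => by
    refine f.mem_interior fun F => ?_
    have h1 := f.ctr_le F
    have h2 := f.le_ht hK F
    have h3 : inner ℝ (f.nrm F) x - inner ℝ (f.nrm F) f.ctr ≤ s := by
      rw [← inner_sub_right]
      refine (real_inner_le_norm _ _).trans ?_
      rw [f.norm_nrm, one_mul]
      simpa [dist_eq_norm] using hx
    have h4 : s < f.ht F / (n + 2) := by
      have h6 : 2 * s = κ / 2 ^ n * K.diam / (n + 2) := by
        rw [hs, hρ]; field_simp
      have h5 : 2 * s ≤ f.ht F / (n + 2) := by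
        rw [h6]; gcongr
      linarith
    linarith
  have hχc : HasCompactSupport χ := (isCompact_closedBall f.ctr s).of_isClosed_subset
    (isClosed_tsupport χ) hts
  refine ⟨χ, hχ, hχc, hts.trans hsub, h01, fun V hV => ?_⟩
  have hVc := hV.contDiff
  have hKb := K.isCompact_carrier.isBounded
  have hKm := K.isCompact_carrier.measurableSet
  have hbK : Metric.ball f.ctr s ⊆ K.carrier :=
    Metric.ball_subset_closedBall.trans (hsub.trans interior_subset)
  have hI : 0 ≤ ∫ x in K.carrier, ‖V x‖ ^ 2 := integral_nonneg fun x => sq_nonneg _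
  have hJ : 0 ≤ ∫ x in K.carrier, χ x * ‖V x‖ ^ 2 :=
    integral_nonneg fun x => mul_nonneg (h01 x).1 (sq_nonneg _)
  have hcV : Continuous fun x => ‖V x‖ ^ 2 := hVc.continuous.norm.pow 2
  have hcχ : Continuous fun x => χ x * ‖V x‖ ^ 2 := hχ.continuous.mul hcV
  have hcd : Continuous fun x => dvg (fun x => χ x • V x) x ^ 2 :=
    (continuous_dvg ((hχ.smul hVc).of_le (by simp))).pow 2
  constructor
  · have hsum := fun B hB => integral_norm_sq_eq_sum hVc.continuous (s := B) hB
    have hctrK : f.ctr ∈ K.carrier := hbK (Metric.mem_ball_self hs0)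
    have h1 : ∫ x in K.carrier, ‖V x‖ ^ 2 ≤
        ∫ x in Metric.ball f.ctr (2 / ρ * s), ‖V x‖ ^ 2 := by
      refine setIntegral_mono_set (integrableOn_of_continuous hcV Metric.isBounded_ball)
        (ae_of_all _ fun x => sq_nonneg _) (ae_of_all _ fun x hx => ?_)
      have : 2 / ρ * s = 2 * K.diam := by rw [hs]; field_simp
      rw [this]
      change dist x f.ctr < 2 * K.diam
      have := Metric.dist_le_diam_of_mem hKb hx hctrK
      change _ ≤ K.diam at this
      linarith
    have h2 : ∫ x in Metric.ball f.ctr (2 / ρ * s), ‖V x‖ ^ 2 ≤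
        C1 * ∫ x in Metric.ball f.ctr (1 / 2 * s), ‖V x‖ ^ 2 := by
      rw [hsum _ Metric.isBounded_ball, hsum _ Metric.isBounded_ball, Finset.mul_sum]
      exact Finset.sum_le_sum fun i _ => hball _ (hV i) _ _ hs0
    have h3 : ∫ x in Metric.ball f.ctr (1 / 2 * s), ‖V x‖ ^ 2 ≤
        ∫ x in K.carrier, χ x * ‖V x‖ ^ 2 := by
      have : ∫ x in Metric.ball f.ctr (1 / 2 * s), ‖V x‖ ^ 2 =
          ∫ x in Metric.ball f.ctr (1 / 2 * s), χ x * ‖V x‖ ^ 2 :=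
        setIntegral_congr_fun Metric.isOpen_ball.measurableSet fun x hx => by simp [hone x hx]
      rw [this]
      refine setIntegral_mono_set (integrableOn_of_continuous hcχ hKb)
        (ae_of_all _ fun x => mul_nonneg (h01 x).1 (sq_nonneg _))
        (ae_of_all _ ?_)
      exact (Metric.ball_subset_ball (by linarith)).trans hbK
    refine (h1.trans h2).trans ((mul_le_mul_of_nonneg_left h3 hC1.le).trans ?_)
    gcongr
    exact le_add_of_nonneg_right (by positivity)
  · have h1 : ∫ x in K.carrier, dvg (fun x => χ x • V x) x ^ 2 =
        ∫ x in Metric.ball f.ctr s, dvg (fun x => χ x • V x) x ^ 2 := by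
      refine setIntegral_eq_of_subset_of_forall_sdiff_eq_zero hKm hbK fun x hx => ?_
      have hz : χ x = 0 := hout x hx.2
      -- A zero of the nonnegative χ is a minimum, so the gradient vanishes there also.
      have hgz : gradient χ x = 0 := by
        have hmin : IsLocalMin χ x := Eventually.of_forall fun y => by rw [hz]; exact (h01 y).1
        rw [gradient, hmin.fderiv_eq_zero, map_zero]
      rw [dvg_smul (hχ.of_le (by simp)) (hVc.of_le (by simp)), hz, hgz]
      simp
    have hcd2 : Continuous fun x => 2 * ((L / s) ^ 2 * ‖V x‖ ^ 2 + dvg V x ^ 2) :=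
      continuous_const.mul ((continuous_const.mul hcV).add
        ((continuous_dvg (hVc.of_le (by simp))).pow 2))
    have h2 : ∫ x in Metric.ball f.ctr s, dvg (fun x => χ x • V x) x ^ 2 ≤
        2 * ((L / s) ^ 2 * (∫ x in Metric.ball f.ctr s, ‖V x‖ ^ 2) +
          ∫ x in Metric.ball f.ctr s, dvg V x ^ 2) := by
      rw [← integral_const_mul, ← integral_add, ← integral_const_mul]
      · refine integral_mono (integrableOn_of_continuous hcd Metric.isBounded_ball)
          (integrableOn_of_continuous hcd2 Metric.isBounded_ball) fun x =>
          dvg_smul_sq_le hχ hVc (h01 x).1 (h01 x).2 (hgr x)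
      · exact integrableOn_of_continuous (continuous_const.mul hcV) Metric.isBounded_ball
      · exact integrableOn_of_continuous
          ((continuous_dvg (hVc.of_le (by simp))).pow 2) Metric.isBounded_ball
    have h3 := hdvg V hV f.ctr s hs0
    have h4 : ∫ x in Metric.ball f.ctr s, ‖V x‖ ^ 2 ≤ ∫ x in K.carrier, ‖V x‖ ^ 2 :=
      setIntegral_mono_set (integrableOn_of_continuous hcV hKb)
        (ae_of_all _ fun x => sq_nonneg _) (ae_of_all _ hbK)
    have h5 : s ^ 2 * ∫ x in K.carrier, dvg (fun x => χ x • V x) x ^ 2 ≤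
        2 * (L ^ 2 + C2) * ∫ x in K.carrier, ‖V x‖ ^ 2 := by
      rw [h1]
      calc _ ≤ s ^ 2 * (2 * ((L / s) ^ 2 * (∫ x in Metric.ball f.ctr s, ‖V x‖ ^ 2) +
          ∫ x in Metric.ball f.ctr s, dvg V x ^ 2)) := by gcongr
        _ = 2 * (L ^ 2 * (∫ x in Metric.ball f.ctr s, ‖V x‖ ^ 2) +
          s ^ 2 * ∫ x in Metric.ball f.ctr s, dvg V x ^ 2) := by
            field_simp
        _ ≤ 2 * (L ^ 2 * (∫ x in Metric.ball f.ctr s, ‖V x‖ ^ 2) +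
          C2 * ∫ x in Metric.ball f.ctr s, ‖V x‖ ^ 2) := by gcongr
        _ = 2 * (L ^ 2 + C2) * ∫ x in Metric.ball f.ctr s, ‖V x‖ ^ 2 := by ring
        _ ≤ _ := by gcongr
    have h6 : K.diam ^ 2 * ∫ x in K.carrier, dvg (fun x => χ x • V x) x ^ 2 ≤
        2 * (L ^ 2 + C2) / ρ ^ 2 * ∫ x in K.carrier, ‖V x‖ ^ 2 := by
      rw [div_mul_eq_mul_div, le_div_iff₀ (by positivity)]
      refine le_trans (le_of_eq ?_) h5
      rw [hs]; ring
    refine h6.trans ?_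
    gcongr
    linarith

end

section

/-! ### The estimator of the flux equations -/

variable {n G Nh : ℕ} {Ω : Set (E (n + 1))} {T : Mesh Ω} {X : CrossSections (n + 1) G}

lemma deltaMinO_le_deltaMaxO (hΩ : IsLipschitzDomain Ω) (hX : X.Admissible Nh Ω)
    [Nonempty (Idx G Nh)] (K : Fin T.card) :
    X.deltaMinO Nh (T.elt K) ≤ X.deltaMaxO Nh (T.elt K) := by
  have := neZero_restrict_carrier (T.elt K)
  obtain ⟨x, hx⟩ := (delta_bounds_O T hΩ hX K).2.exists
  exact (hx (Classical.arbitrary _)).1.trans (hx (Classical.arbitrary _)).2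

lemma deltaMinE_le_deltaMaxE (hΩ : IsLipschitzDomain Ω) (hX : X.Admissible Nh Ω)
    [Nonempty (Idx G Nh)] (K : Fin T.card) :
    X.deltaMinE Nh (T.elt K) ≤ X.deltaMaxE Nh (T.elt K) := by
  have := neZero_restrict_carrier (T.elt K)
  obtain ⟨x, hx⟩ := (delta_bounds_E T hΩ hX K).2.exists
  exact (hx (Classical.arbitrary _)).1.trans (hx (Classical.arbitrary _)).2

/-- The weak gradient agrees on K with that of the polynomial representative. The degree is the sum
of the individual bounds, which dominates each term. -/
lemma exists_resF_isPFVec {k mo mφ : ℕ} (hΩ : IsLipschitzDomain Ω) {K : Fin T.card}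
    (hTo : ∀ a b : Idx G Nh, (T.elt K).IsPoly mo (fun x => X.To Nh x a b))
    {p : Idx G Nh → FluxField (n + 1)} (hp : ∀ a, (T.elt K).MemRTN k (p a).val)
    {φ : Idx G Nh → ScalarField (n + 1)} (hφ : ∀ a, MemH1 Ω (φ a))
    (hφp : ∀ a, (T.elt K).IsPoly mφ (φ a).val) :
    ∃ V : Idx G Nh → E (n + 1) → E (n + 1),
      (∀ a, IsPFVec (mo + (n + 1) * (k + 1) + mφ) (V a)) ∧
      ∀ᵐ x ∂(volume.restrict (T.elt K).carrier), ∀ a, resF X p φ a x = V a x := by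
  choose g hg hgT using fun a b => (hTo a b).exists_isPF
  choose P hP hpP using fun a => (hp a).exists_isPFVec
  choose v hv hφv using fun a => (hφp a).exists_isPF
  refine ⟨fun a x => (∑ b, g a b x • P b x) + ∑ b, matH G Nh a b • gradient (v b) x,
    fun a => ?_, ?_⟩
  · refine IsPFVec.add ?_ ?_
    · exact IsPFVec.mono (IsPFVec.sum fun b _ => IsPFVec.smul (hg a b) (hP b)) (by omega)
    · exact IsPFVec.mono (IsPFVec.sum fun b _ => (IsPFVec.gradient (hv b)).const_smul _)
        (by omega)
  · have h1 := fun b => (hφ b).grad_ae_eq hΩ (hv b).contDiff (hφv b)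
    have h2 := ae_all_iff.2 fun a => ae_all_iff.2 fun b => hgT a b
    filter_upwards [ae_all_iff.2 h1, h2, ae_all_iff.2 hpP] with x k1 k2 k3 a
    simp only [resF, k1, k2, k3]

/-- Division by √M. The estimate is asked only for M > 0, where the test state has a positive bound
on its norm. -/
lemma le_of_sq_le_sqrt_mul {M B C N : ℝ} (hM : 0 ≤ M) (hC : 0 < C) (hN : 0 ≤ N)
    (h : 0 < M → M ≤ C * (Real.sqrt (B * M) * N)) : Real.sqrt M ≤ C * Real.sqrt B * N := by
  rcases hM.eq_or_lt with h0 | h0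
  · rw [← h0, Real.sqrt_zero]; positivity
  · have h1 := h h0
    rw [Real.sqrt_mul' _ hM] at h1
    have h2 : 0 < Real.sqrt M := Real.sqrt_pos.2 h0
    refine le_of_mul_le_mul_right ?_ h2
    rw [Real.mul_self_sqrt hM]
    refine h1.trans (le_of_eq ?_)
    ring

/-- The test flux is minus the residual times the interior bubble. The unweighted L² bound is kept
as a conclusion of its own, because the flux residual reappears when the boundary condition is
tested. -/
lemma exists_etaF_bound (n k mo mφ : ℕ) {κ : ℝ} (hκ : 0 < κ) : ∃ C : ℝ, 0 < C ∧
    ∀ {G Nh : ℕ} [Nonempty (Idx G Nh)] {Ω : Set (E (n + 1))} (_ : IsLipschitzDomain Ω)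
      {T : Mesh Ω} {X : CrossSections (n + 1) G} (_ : X.Admissible Nh Ω) {me : ℕ}
      (_ : ∀ K a b, (T.elt K).IsPoly mo (fun x => X.To Nh x a b))
      (_ : ∀ K a b, (T.elt K).IsPoly me (fun x => X.Te Nh x a b))
      {S : Idx G Nh → E (n + 1) → ℝ} (_ : ∀ a, MemLp (S a) 2 (volume.restrict Ω))
      {z zh : State (n + 1) G Nh} {φ : Idx G Nh → ScalarField (n + 1)}
      (_ : IsSolution X Ω S z) (_ : ∀ a, MemQ Ω (zh.flux a)) (_ : ∀ a, MemH1 Ω (φ a))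
      {K : Fin T.card} (_ : ∀ a, (T.elt K).MemRTN k (zh.flux a).val)
      (_ : ∀ a, (T.elt K).IsPoly mφ (φ a).val) (_ : κ ≤ (T.elt K).shapeReg)
      {N : ℝ} (_ : 0 ≤ N)
      (_ : localNorm X T K (z - reconstruct zh φ) ≤ ENNReal.ofReal N),
      Real.sqrt (∫ x in (T.elt K).carrier, ∑ a, ‖resF X zh.flux φ a x‖ ^ 2) ≤
        C * Real.sqrt (X.deltaMaxO Nh (T.elt K)) * N ∧
      etaF X (T.elt K) zh.flux φ ≤
        C * Real.sqrt (X.deltaMaxO Nh (T.elt K) / X.deltaMinO Nh (T.elt K)) * N := by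
  obtain ⟨C, hC, hbub⟩ := exists_bubble n (mo + (n + 1) * (k + 1) + mφ) hκ
  refine ⟨C * Real.sqrt (1 + C), by positivity, ?_⟩
  intro G Nh _ Ω hΩ T X hX me hTo hTe S hS z zh φ hz hzh hφ K hp hφp hK N hN hloc
  have hKm := (T.elt K).isCompact_carrier.measurableSet
  have hKb := (T.elt K).isCompact_carrier.isBounded
  obtain ⟨hmin, hdiag⟩ := delta_bounds_O T hΩ hX K
  have hmm := deltaMinO_le_deltaMaxO (T := T) hΩ hX K
  set δ := X.deltaMaxO Nh (T.elt K) with hδ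
  set δ' := X.deltaMinO Nh (T.elt K) with hδ'
  have hδ0 : 0 < δ := hmin.trans_le hmm
  obtain ⟨V, hV, hresV⟩ := exists_resF_isPFVec hΩ (hTo K) hp hφ hφp
  -- The sign compensates the minus in front of the flux residual in `formD_error`.
  set U : Idx G Nh → E (n + 1) → E (n + 1) := fun a x => (-1 : ℝ) • V a x with hU
  have hUp : ∀ a, IsPFVec (mo + (n + 1) * (k + 1) + mφ) (U a) := fun a => (hV a).const_smul _
  have hUc : ∀ a, ContDiff ℝ ∞ (U a) := fun a => (hUp a).contDiff
  have hresU : ∀ᵐ x ∂(volume.restrict (T.elt K).carrier), ∀ a,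
      resF X zh.flux φ a x = -U a x := by
    filter_upwards [hresV] with x hx a
    rw [hx a, hU]
    simp
  obtain ⟨χ, hχ, hχc, hχs, h01, hest⟩ := hbub (T.elt K) hK
  -- Any facet serves: χ is supported in the interior of K, so cutting at the hyperplane of F
  -- changes nothing and the normal trace is zero.
  obtain ⟨F⟩ := Frame.facet_nonempty_idx (T.elt K)
  set f := (T.elt K).frame
  have hsub : ∀ a, tsupport (fun x => χ x • U a x) ⊆ interior (T.elt K).carrier := fun a =>
    (tsupport_smul_subset_left χ _).trans hχs
  have hVK : ∀ a, ∀ x ∈ tsupport (fun x => χ x • U a x), inner ℝ (f.nrm F) x ≤ f.off F →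
      x ∈ (T.elt K).carrier := fun a x hx _ => interior_subset (hsub a hx)
  set w : State (n + 1) G Nh :=
    ⟨fun a => halfField (fun x => χ x • U a x) (f.nrm F) (f.off F), 0⟩ with hw
  have hwQ : ∀ a, MemQ Ω (w.flux a) := fun a =>
    memQ_halfField (T := T) (K := K) hΩ (hχ.smul (hUc a)) hχc.smul_right (f.norm_nrm F)
      (hVK a) fun x hx h => (f.notMem_interior h (hsub a hx)).elim
  have hwX : MemX Ω w := ⟨hwQ, fun a => MemLp.zero⟩
  have w1 : ∀ a, ∀ x ∉ (T.elt K).carrier, (w.flux a).val x = 0 := fun a x hx =>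
    (halfField_eq_zero (hVK a) hx).1
  have w2 : ∀ a, ∀ x ∉ (T.elt K).carrier, (w.flux a).dv x = 0 := fun a x hx =>
    (halfField_eq_zero (hVK a) hx).2
  have w3 : ∀ a x, (w.flux a).ntr x = 0 := fun a x => by
    by_cases hx : inner ℝ (f.nrm F) x = f.off F
    · have hz : χ x = 0 :=
        image_eq_zero_of_notMem_tsupport fun h => f.notMem_interior hx (hχs h)
      simp only [hw, halfField]
      rw [indicator_of_mem (by exact hx), hz, zero_smul, inner_zero_right]
    · simp only [hw, halfField]
      rw [indicator_of_notMem (by exact hx)]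
  have w4 : ∀ a, ∀ x ∈ (T.elt K).carrier, (w.flux a).val x = χ x • U a x := fun a x hx => by
    simp only [hw, halfField]
    rw [indicator_of_mem (by exact (f.mem_carrier x).1 hx F)]
  have w5 : ∀ a, ∀ x ∈ (T.elt K).carrier,
      (w.flux a).dv x = dvg (fun x => χ x • U a x) x := fun a x hx => by
    simp only [hw, halfField]
    rw [indicator_of_mem (by exact (f.mem_carrier x).1 hx F)]
  have hwK : MemXK T K w := by
    refine ⟨hwX, fun a => ae_of_all _ fun x _ => rfl, fun a => ae_of_all _ fun x hx => ?_⟩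
    exact w1 a x fun h => hx (mem_biUnion (T.self_mem_nbhd K) h)
  have iU : ∀ a, IntegrableOn (fun x => ‖U a x‖ ^ 2) (T.elt K).carrier := fun a =>
    integrableOn_of_continuous ((hUc a).continuous.norm.pow 2) hKb
  have iχ : ∀ a, IntegrableOn (fun x => χ x * ‖U a x‖ ^ 2) (T.elt K).carrier := fun a =>
    integrableOn_of_continuous (hχ.continuous.mul ((hUc a).continuous.norm.pow 2)) hKb
  have iD : ∀ a, IntegrableOn (fun x => dvg (fun x => χ x • U a x) x ^ 2) (T.elt K).carrier :=
    fun a => integrableOn_of_continuous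
      ((continuous_dvg ((hχ.smul (hUc a)).of_le (by simp))).pow 2) hKb
  set M : ℝ := ∫ x in (T.elt K).carrier, ∑ a, ‖U a x‖ ^ 2 with hM
  have hM0 : 0 ≤ M := integral_nonneg fun x => Finset.sum_nonneg fun a _ => sq_nonneg _
  have hMs : M = ∑ a, ∫ x in (T.elt K).carrier, ‖U a x‖ ^ 2 :=
    integral_finsetSum _ fun a _ => iU a
  have iM : IntegrableOn (fun x => ∑ a, ‖U a x‖ ^ 2) (T.elt K).carrier :=
    integrable_finsetSum _ fun a _ => iU a
  have hMle : Real.sqrt M ≤ C * Real.sqrt (δ * (1 + C)) * N := by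
    -- M is at most C ∫ χ |U|², this integral is the value of d at the test state, and the squared
    -- norm of that state is at most δ (1 + C) M: δ M from the L² part and δ C M from the
    -- divergence.
    refine le_of_sq_le_sqrt_mul hM0 hC hN fun hMpos => ?_
    have hnorm : normS X T w ≤ Real.sqrt (δ * (1 + C) * M) := by
      refine normS_sq_le hΩ (K := K) (fun a => rfl) w1 w2 (Real.sqrt_nonneg _) ?_
      rw [Real.sq_sqrt (by positivity)]
      have t1 : ∫ x in (T.elt K).carrier, ∑ a, X.To Nh x a a * ‖(w.flux a).val x‖ ^ 2 ≤ δ * M := by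
        rw [hM, ← integral_const_mul]
        refine integral_mono_of_nonneg ?_ (iM.const_mul δ) ?_
        · filter_upwards [hdiag] with x hx
          exact Finset.sum_nonneg fun a _ => mul_nonneg (hmin.le.trans (hx a).1) (sq_nonneg _)
        · filter_upwards [hdiag, ae_restrict_mem hKm] with x hx hxK
          simp only [Finset.mul_sum]
          refine Finset.sum_le_sum fun a _ => ?_
          rw [w4 a x hxK, norm_smul, Real.norm_of_nonneg (h01 x).1]
          refine mul_le_mul (hx a).2 ?_ (sq_nonneg _) hδ0.le
          exact pow_le_pow_left₀ (mul_nonneg (h01 x).1 (norm_nonneg _))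
            (mul_le_of_le_one_left (norm_nonneg _) (h01 x).2) 2
      have t2 : δ * (T.elt K).diam ^ 2 * ∫ x in (T.elt K).carrier, ∑ a, (w.flux a).dv x ^ 2 ≤
          δ * (C * M) := by
        have e : ∫ x in (T.elt K).carrier, ∑ a, (w.flux a).dv x ^ 2 =
            ∑ a, ∫ x in (T.elt K).carrier, dvg (fun x => χ x • U a x) x ^ 2 := by
          rw [← integral_finsetSum _ fun a _ => iD a]
          refine setIntegral_congr_fun hKm fun x hx => ?_
          exact Finset.sum_congr rfl fun a _ => by rw [w5 a x hx]
        rw [e, mul_assoc]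
        refine mul_le_mul_of_nonneg_left ?_ hδ0.le
        rw [hMs, Finset.mul_sum, Finset.mul_sum]
        exact Finset.sum_le_sum fun a _ => (hest _ (hUp a)).2
      simp only [w3, mul_zero, Finset.sum_const_zero, integral_zero, ite_self]
      linarith
    have key := formD_le_of_localNorm hwK (Real.sqrt_pos.2 (by positivity)) hnorm hN hloc
    rw [formD_error hTo hTe hS hz hzh hφ hwX] at key
    have k1 : ∀ a x, w.scal a x = 0 := fun _ _ => rfl
    simp only [k1, w3, mul_zero, Finset.sum_const_zero, integral_zero, zero_sub, add_zero] at key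
    have k2 : ∫ x in Ω, ∑ a, inner ℝ (resF X zh.flux φ a x) ((w.flux a).val x) =
        -∑ a, ∫ x in (T.elt K).carrier, χ x * ‖U a x‖ ^ 2 := by
      rw [setIntegral_domain_eq hΩ.isOpen.measurableSet (T.carrier_ae_subset hΩ K),
        ← integral_finsetSum _ fun a _ => iχ a, ← integral_neg]
      · refine integral_congr_ae ?_
        filter_upwards [hresU, ae_restrict_mem hKm] with x hx hxK
        rw [← Finset.sum_neg_distrib]
        refine Finset.sum_congr rfl fun a _ => ?_
        rw [hx a, w4 a x hxK, inner_neg_left, inner_smul_right, real_inner_self_eq_norm_sq]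
      · intro x _ hx
        simp [w1 _ x hx]
    rw [k2, neg_neg] at key
    refine le_trans ?_ (mul_le_mul_of_nonneg_left key hC.le)
    rw [hMs, Finset.mul_sum]
    exact Finset.sum_le_sum fun a _ => (hest _ (hUp a)).1
  -- The weight 1/δ_o is bounded by 1/δ_min, while the test norm was bounded with δ_max; this is the
  -- source of the ratio.
  have hη : etaF X (T.elt K) zh.flux φ ≤ Real.sqrt (M / δ') := by
    refine Real.sqrt_le_sqrt ?_
    rw [hM, ← integral_div]
    refine integral_mono_of_nonneg ?_ (iM.div_const δ') ?_
    · filter_upwards [hdiag] with x hx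
      exact Finset.sum_nonneg fun a _ => div_nonneg (sq_nonneg _) (hmin.le.trans (hx a).1)
    · filter_upwards [hdiag, hresU] with x hx hxU
      simp only [Finset.sum_div]
      refine Finset.sum_le_sum fun a _ => ?_
      have e : (∑ b, X.To Nh x a b • (zh.flux b).val x) + ∑ b, matH G Nh a b • (φ b).grad x =
          -U a x := hxU a
      rw [e, norm_neg]
      exact div_le_div_of_nonneg_left (sq_nonneg _) hmin (hx a).1
  refine ⟨?_, hη.trans ?_⟩
  · have e : ∫ x in (T.elt K).carrier, ∑ a, ‖resF X zh.flux φ a x‖ ^ 2 = M := by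
      refine integral_congr_ae ?_
      filter_upwards [hresU] with x hx
      simp only [hx, norm_neg]
    rw [e]
    refine hMle.trans (le_of_eq ?_)
    rw [Real.sqrt_mul hδ0.le]
    ring
  rw [Real.sqrt_div hM0, Real.sqrt_div hδ0.le, div_le_iff₀ (Real.sqrt_pos.2 hmin)]
  refine hMle.trans (le_of_eq ?_)
  have h0 : Real.sqrt δ' ≠ 0 := (Real.sqrt_pos.2 hmin).ne'
  rw [Real.sqrt_mul hδ0.le]
  field_simp

end

section

/-! ### Bubble functions on a boundary facet -/

variable {n : ℕ}

lemma IsPF.comp_hypMap {m : ℕ} {W : E (n + 1) → ℝ} (hW : IsPF m W)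
    (B : OrthonormalBasis (Fin (n + 1)) ℝ (E (n + 1))) (x0 : E (n + 1)) :
    IsPF m (fun y : E n => W (hypMap B x0 y)) := hW.comp fun j => by
  simp only [hypMap, PiLp.add_apply, WithLp.ofLp_sum, Finset.sum_apply, PiLp.smul_apply,
    smul_eq_mul]
  refine (IsPF.const _).add (IsPF.sum fun i _ => ?_)
  simpa [mul_comm] using (IsPF.coord i).const_mul (B i.succ j)

lemma IsPF.comp_hypProj {m : ℕ} {W : E n → ℝ} (hW : IsPF m W)
    (B : OrthonormalBasis (Fin (n + 1)) ℝ (E (n + 1))) (x0 : E (n + 1)) :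
    IsPF m (fun x : E (n + 1) => W (hypProj B x0 x)) := hW.comp fun i => by
  simp only [hypProj, inner_sub_right]
  simpa only [← sub_eq_neg_add] using IsPF.affine (B i.succ) (-inner ℝ (B i.succ) x0)

/-- Polynomials on a hyperplane, extended to a ball as constants in the normal direction. -/
lemma exists_cylinder_bound (n m : ℕ) : ∃ C : ℝ, 0 < C ∧ ∀ W : E n → ℝ, IsPF m W →
    ∀ (B : OrthonormalBasis (Fin (n + 1)) ℝ (E (n + 1))) (x0 : E (n + 1)) (s : ℝ), 0 < s →
      ∫ x in Metric.ball x0 s, W (hypProj B x0 x) ^ 2 ≤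
        C * s * ∫ y in Metric.ball (0 : E n) (1 / 2 * s), W y ^ 2 := by
  -- In the frame, projection onto the hyperplane drops the first coordinate. Composition with it is
  -- linear on polynomials, so `exists_poly_bound` applies; the factor s comes from the difference
  -- of dimensions.
  let tail : E (n + 1) → E n := fun y => WithLp.toLp 2 fun i => y i.succ
  have htail : Continuous tail := by
    refine (PiLp.continuous_toLp 2 _).comp (continuous_pi fun i => ?_)
    fun_prop
  let g : PF n m →ₗ[ℝ] (E (n + 1) → ℝ) :=
    { toFun := fun f y => (f : E n → ℝ) (tail y)
      map_add' := fun _ _ => rfl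
      map_smul' := fun _ _ => rfl }
  obtain ⟨C, hC, h⟩ := exists_poly_bound m g
    (fun f => (isPF_coe f).continuous.comp htail) 1
  refine ⟨C, hC, fun W hW B x0 s hs => ?_⟩
  have hWs : IsPF m (fun y => W (s • y)) := hW.comp fun i => by
    simpa using (IsPF.coord i).const_mul s
  have h1 := integral_ball_scale (fun x => W (hypProj B x0 x) ^ 2) x0 hs 1
  rw [one_mul] at h1
  have h2 := integral_ball_scale (fun y => W y ^ 2) 0 hs (1 / 2)
  have h3 : ∫ y in Metric.ball (0 : E (n + 1)) 1, W (hypProj B x0 (x0 + s • y)) ^ 2 =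
      ∫ y in Metric.ball (0 : E (n + 1)) 1, W (s • tail y) ^ 2 := by
    have := B.repr.symm.measurePreserving.setIntegral_preimage_emb
      B.repr.symm.toHomeomorph.measurableEmbedding
      (fun y => W (hypProj B x0 (x0 + s • y)) ^ 2) (Metric.ball 0 1)
    rw [← this, LinearIsometryEquiv.preimage_ball, map_zero]
    refine setIntegral_congr_fun Metric.isOpen_ball.measurableSet fun y _ => ?_
    congr 2
    ext i
    simp only [hypProj, add_sub_cancel_left, inner_smul_right, tail, PiLp.smul_apply, smul_eq_mul]
    congr 1
    rw [← B.repr_apply_apply]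
    simp
  rw [h1, h2, h3]
  simp only [zero_add]
  have h4 := h ⟨_, mem_PF.2 hWs⟩
  calc s ^ (n + 1) * ∫ y in Metric.ball (0 : E (n + 1)) 1, W (s • tail y) ^ 2
      ≤ s ^ (n + 1) * (C * ∫ y in Metric.ball (0 : E n) (1 / 2), W (s • y) ^ 2) :=
        mul_le_mul_of_nonneg_left h4 (by positivity)
    _ = _ := by rw [pow_succ]; ring

/-- A bubble function on a facet, with an extension operator for polynomials on the facet. -/
lemma exists_facet_bubble (n m : ℕ) {κ : ℝ} (hκ : 0 < κ) : ∃ C : ℝ, 0 < C ∧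
    ∀ K : Element (n + 1), κ ≤ K.shapeReg → ∀ (F : K.FacetIdx)
      (B : OrthonormalBasis (Fin (n + 1)) ℝ (E (n + 1))), B 0 = K.frame.nrm F →
      ∀ σ : Measure (E (n + 1)), σ =
        ((volume : Measure (E n)).map (hypMap B (K.frame.fctr F))).restrict (K.facet F) →
      ∃ χ : E (n + 1) → ℝ, ContDiff ℝ ∞ χ ∧ HasCompactSupport χ ∧
        (∀ x ∈ tsupport χ, ∀ F' ≠ F, inner ℝ (K.frame.nrm F') x < K.frame.off F') ∧
        (∀ x, 0 ≤ χ x ∧ χ x ≤ 1) ∧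
      ∀ W : E (n + 1) → ℝ, IsPF m W →
        ∫ x, W x ^ 2 ∂σ ≤ C * ∫ x, χ x * W x ^ 2 ∂σ ∧
        ∃ Y : E (n + 1) → ℝ, ContDiff ℝ ∞ Y ∧
          (∀ x, inner ℝ (K.frame.nrm F) x = K.frame.off F → Y x = W x) ∧
          ∫ x in K.carrier, (χ x * Y x) ^ 2 ≤ C * K.diam * ∫ x, W x ^ 2 ∂σ ∧
          K.diam ^ 2 * ∫ x in K.carrier,
            dvg (fun x => χ x • (Y x • K.frame.nrm F)) x ^ 2 ≤
            C * K.diam * ∫ x, W x ^ 2 ∂σ := by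
  -- The same radius as for the interior bubble, now around the centre of the facet: the ball
  -- satisfies all the other constraints strictly, and may cross the hyperplane of F.
  set ρ : ℝ := κ / 2 ^ n / (2 * (n + 2)) with hρ
  have hρ0 : 0 < ρ := by positivity
  obtain ⟨L, hL, hcut⟩ := exists_cutoff (n + 1)
  obtain ⟨C1, hC1, hball⟩ := exists_ball_bound n m (2 / ρ)
  obtain ⟨C3, hC3, hcyl⟩ := exists_cylinder_bound n m
  refine ⟨C1 + C3 * ρ + L ^ 2 * C3 / ρ, by positivity, fun K hK F B hB σ hσ => ?_⟩
  set f := K.frame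
  have hd : 0 < K.diam := f.diam_pos F
  set s := ρ * K.diam with hs
  have hs0 : 0 < s := by positivity
  set x0 := f.fctr F with hx0
  obtain ⟨χ, hχ, h01, hone, hts, hout, hgr⟩ := hcut x0 s hs0
  have hsub : ∀ x ∈ Metric.closedBall x0 s, ∀ F' ≠ F, inner ℝ (f.nrm F') x < f.off F' := by
    intro x hx F' hF'
    have h1 := f.fctr_le F F' hF'
    have h2 := f.le_ht hK F'
    have h3 : inner ℝ (f.nrm F') x - inner ℝ (f.nrm F') x0 ≤ s := by
      rw [← inner_sub_right]
      refine (real_inner_le_norm _ _).trans ?_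
      rw [f.norm_nrm, one_mul]
      simpa [dist_eq_norm] using hx
    have h4 : s < f.ht F' / (n + 2) := by
      have h6 : 2 * s = κ / 2 ^ n * K.diam / (n + 2) := by
        rw [hs, hρ]; field_simp
      have h5 : 2 * s ≤ f.ht F' / (n + 2) := by
        rw [h6]; gcongr
      linarith
    linarith
  have hχc : HasCompactSupport χ := (isCompact_closedBall x0 s).of_isClosed_subset
    (isClosed_tsupport χ) hts
  refine ⟨χ, hχ, hχc, fun x hx => hsub x (hts hx), h01, fun W hW => ?_⟩
  set Φ := hypMap B x0 with hΦ
  have hΦi : Isometry Φ := isometry_hypMap B x0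
  have hΦ0 : Φ 0 = x0 := by simp [hΦ, hypMap]
  have hΦP : ∀ y, inner ℝ (f.nrm F) (Φ y) = f.off F := fun y => by
    rw [← hB, hΦ, inner_zero_hypMap, hB, hx0, f.fctr_eq]
  have hKb := K.isCompact_carrier.isBounded
  have hKm := K.isCompact_carrier.measurableSet
  set A := Φ ⁻¹' K.facet F with hA
  have hfm : MeasurableSet (K.facet F) := by
    have : K.facet F = K.carrier ∩ {x | inner ℝ (f.nrm F) x = f.off F} := by
      ext x; exact f.mem_facet F x
    rw [this]
    exact hKm.inter (measurableSet_hyperplane _ _)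
  -- In hyperplane coordinates the facet lies between the ball of radius s and the ball of radius 2
  -- h_K, which makes polynomial norms on it comparable to norms on balls.
  have hmemA : ∀ y ∈ Metric.ball (0 : E n) s, y ∈ A := fun y hy => by
    refine (f.mem_facet F _).2 ⟨f.mem_carrier_of_relint (hΦP y).le (hsub _ ?_), hΦP y⟩
    rw [Metric.mem_closedBall, ← hΦ0, hΦi.dist_eq]
    exact (Metric.mem_ball.1 hy).le
  have hAb : A ⊆ Metric.ball 0 (2 / ρ * s) := fun y hy => by
    have h1 : x0 ∈ K.carrier := by
      have := ((f.mem_facet F _).1 (hmemA 0 (Metric.mem_ball_self hs0))).1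
      rwa [hΦ0] at this
    have h2 := Metric.dist_le_diam_of_mem hKb ((f.mem_facet F _).1 hy).1 h1
    rw [← hΦ0, hΦi.dist_eq] at h2
    have : 2 / ρ * s = 2 * K.diam := by rw [hs]; field_simp
    rw [Metric.mem_ball, this]
    change _ ≤ K.diam at h2
    linarith
  have hAbd : Bornology.IsBounded A := Metric.isBounded_ball.subset hAb
  have hint : ∀ g : E (n + 1) → ℝ, ∫ x, g x ∂σ = ∫ y in A, g (Φ y) := fun g => by
    rw [hσ, (measurableEmbedding_hypMap B x0).setIntegral_map]
  set Wt : E n → ℝ := fun y => W (Φ y) with hWt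
  have hWtp : IsPF m Wt := hW.comp_hypMap B x0
  set J := ∫ x, W x ^ 2 ∂σ with hJ
  have hJA : J = ∫ y in A, Wt y ^ 2 := hint fun x => W x ^ 2
  have hcW : Continuous fun y => Wt y ^ 2 := hWtp.continuous.pow 2
  have hcχ : Continuous fun y => χ (Φ y) * Wt y ^ 2 :=
    (hχ.continuous.comp hΦi.continuous).mul hcW
  have hhalf : Metric.ball (0 : E n) (1 / 2 * s) ⊆ A :=
    (Metric.ball_subset_ball (by linarith)).trans hmemA
  have hhalfJ : ∫ y in Metric.ball (0 : E n) (1 / 2 * s), Wt y ^ 2 ≤ J := by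
    rw [hJA]
    exact setIntegral_mono_set (integrableOn_of_continuous hcW hAbd)
      (ae_of_all _ fun x => sq_nonneg _) (ae_of_all _ hhalf)
  have hJ0 : 0 ≤ J := integral_nonneg fun x => sq_nonneg _
  constructor
  · rw [hJA, hint fun x => χ x * W x ^ 2]
    have h0 : 0 ≤ ∫ y in A, χ (Φ y) * Wt y ^ 2 :=
      integral_nonneg fun y => mul_nonneg (h01 _).1 (sq_nonneg _)
    have h1 : ∫ y in A, Wt y ^ 2 ≤ ∫ y in Metric.ball 0 (2 / ρ * s), Wt y ^ 2 :=
      setIntegral_mono_set (integrableOn_of_continuous hcW Metric.isBounded_ball)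
        (ae_of_all _ fun x => sq_nonneg _) (ae_of_all _ hAb)
    have h2 := hball Wt hWtp 0 s hs0
    have h3 : ∫ y in Metric.ball (0 : E n) (1 / 2 * s), Wt y ^ 2 ≤
        ∫ y in A, χ (Φ y) * Wt y ^ 2 := by
      have : ∫ y in Metric.ball (0 : E n) (1 / 2 * s), Wt y ^ 2 =
          ∫ y in Metric.ball (0 : E n) (1 / 2 * s), χ (Φ y) * Wt y ^ 2 := by
        refine setIntegral_congr_fun Metric.isOpen_ball.measurableSet fun y hy => ?_
        have : Φ y ∈ Metric.ball x0 (1 / 2 * s) := by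
          rw [Metric.mem_ball, ← hΦ0, hΦi.dist_eq]; exact hy
        simp [hone _ this]
      rw [this]
      exact setIntegral_mono_set (integrableOn_of_continuous hcχ hAbd)
        (ae_of_all _ fun y => mul_nonneg (h01 _).1 (sq_nonneg _)) (ae_of_all _ hhalf)
    refine (h1.trans h2).trans ((mul_le_mul_of_nonneg_left h3 hC1.le).trans ?_)
    refine mul_le_mul_of_nonneg_right ?_ h0
    have : 0 ≤ C3 * ρ := by positivity
    have : 0 ≤ L ^ 2 * C3 / ρ := by positivity
    linarith
  -- The extension is constant along the normal. Hence the divergence of χ Y ν is just Y times the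
  -- normal derivative of χ, and only the bound L / s on the gradient of χ is needed.
  · set Y : E (n + 1) → ℝ := fun x => Wt (hypProj B x0 x) with hY
    have hYp : IsPF m Y := hWtp.comp_hypProj B x0
    have hYc : ContDiff ℝ ∞ Y := hYp.contDiff
    have hYb : ∫ x in Metric.ball x0 s, Y x ^ 2 ≤ C3 * s * J :=
      (hcyl Wt hWtp B x0 s hs0).trans (mul_le_mul_of_nonneg_left hhalfJ (by positivity))
    have hYi : IntegrableOn (fun x => Y x ^ 2) (Metric.ball x0 s) :=
      integrableOn_of_continuous (hYc.continuous.pow 2) Metric.isBounded_ball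
    have hcar : ∀ (g : E (n + 1) → ℝ) (b : ℝ), Continuous g → (∀ x, 0 ≤ g x) →
        (∀ x ∉ Metric.ball x0 s, g x = 0) → (∀ x, g x ≤ b * Y x ^ 2) →
        ∫ x in K.carrier, g x ≤ b * ∫ x in Metric.ball x0 s, Y x ^ 2 := by
      intro g b hg h0 hz hb
      have e : ∫ x in K.carrier, g x = ∫ x in K.carrier ∩ Metric.ball x0 s, g x :=
        setIntegral_eq_of_subset_of_forall_sdiff_eq_zero hKm inter_subset_left fun x hx =>
          hz x fun h => hx.2 ⟨hx.1, h⟩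
      have i1 : IntegrableOn g (Metric.ball x0 s) :=
        integrableOn_of_continuous hg Metric.isBounded_ball
      rw [e, ← integral_const_mul]
      exact (setIntegral_mono_set i1 (ae_of_all _ h0) (ae_of_all _ inter_subset_right)).trans
        (integral_mono i1 (hYi.const_mul b) hb)
    refine ⟨Y, hYc, fun x hx => ?_, ?_, ?_⟩
    · have hx' : inner ℝ (B 0) x = inner ℝ (B 0) x0 := by rw [hB, hx, hx0, f.fctr_eq]
      rw [hY, hWt]
      simp only [hΦ, hypMap_hypProj B x0 hx']
    · refine (hcar (fun x => (χ x * Y x) ^ 2) 1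
        ((hχ.continuous.mul hYc.continuous).pow 2) (fun x => sq_nonneg _)
        (fun x hx => by simp [hout x hx]) fun x => ?_).trans ?_
      · rw [mul_pow]
        exact mul_le_mul_of_nonneg_right (pow_le_one₀ (h01 x).1 (h01 x).2) (sq_nonneg _)
      · rw [one_mul]
        refine hYb.trans ?_
        rw [hs, ← mul_assoc]
        have h1 : C3 * ρ ≤ C1 + C3 * ρ + L ^ 2 * C3 / ρ := by
          have : 0 ≤ L ^ 2 * C3 / ρ := by positivity
          linarith
        gcongr
    · have hYν : ∀ x, inner ℝ (f.nrm F) (gradient Y x) = 0 := fun x => by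
        rw [real_inner_comm, gradient, InnerProductSpace.toDual_symm_apply]
        have h1 := ((hYc.differentiable (by simp)) x).hasFDerivAt.hasLineDerivAt (f.nrm F)
        have h2 : ∀ t : ℝ, Y (x + t • f.nrm F) = Y x := fun t => by
          have h3 : hypProj B x0 (x + t • f.nrm F) = hypProj B x0 x := by
            ext i
            simp only [hypProj, ← hB]
            rw [add_sub_right_comm, inner_add_right, inner_smul_right,
              B.orthonormal.2 (Fin.succ_ne_zero i), mul_zero, add_zero]
          rw [hY]
          simp only [h3]
        have h4 := h1.lineDeriv
        rw [← h4, lineDeriv]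
        simp only [h2, deriv_const']
      have hdv : ∀ x, dvg (fun x => χ x • (Y x • f.nrm F)) x =
          Y x * inner ℝ (f.nrm F) (gradient χ x) := fun x => by
        have c1 : ContDiff ℝ 1 Y := hYc.of_le (by simp)
        have z : dvg (fun _ : E (n + 1) => f.nrm F) x = 0 := by simp [dvg]
        have c2 : ContDiff ℝ 1 fun x => Y x • f.nrm F := c1.smul contDiff_const
        rw [dvg_smul (hχ.of_le (by simp)) c2, dvg_smul c1 contDiff_const,
          hYν, z, real_inner_smul_left]
        ring
      simp only [hdv]
      have hb := hcar (fun x => (Y x * inner ℝ (f.nrm F) (gradient χ x)) ^ 2) ((L / s) ^ 2)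
        ((hYc.continuous.mul (continuous_const.inner
          (continuous_gradient (hχ.of_le (by simp))))).pow 2) (fun x => sq_nonneg _)
        (fun x hx => by
          have hmin : IsLocalMin χ x := Eventually.of_forall fun y => by
            rw [hout x hx]; exact (h01 y).1
          rw [gradient, hmin.fderiv_eq_zero, map_zero, inner_zero_right]
          simp) fun x => by
          rw [mul_pow, mul_comm]
          refine mul_le_mul_of_nonneg_right ?_ (sq_nonneg _)
          rw [← sq_abs]
          refine pow_le_pow_left₀ (abs_nonneg _) ((abs_real_inner_le_norm _ _).trans ?_) 2
          rw [f.norm_nrm, one_mul]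
          exact hgr x
      calc K.diam ^ 2 * ∫ x in K.carrier, (Y x * inner ℝ (f.nrm F) (gradient χ x)) ^ 2
          ≤ K.diam ^ 2 * ((L / s) ^ 2 * (C3 * s * J)) := by
            gcongr
            exact hb.trans (mul_le_mul_of_nonneg_left hYb (sq_nonneg _))
        _ = L ^ 2 * C3 / ρ * K.diam * J := by
            rw [hs]; field_simp
        _ ≤ _ := by
            have h1 : L ^ 2 * C3 / ρ ≤ C1 + C3 * ρ + L ^ 2 * C3 / ρ := by
              have : 0 ≤ C3 * ρ := by positivity
              linarith
            gcongr

end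

section

/-! ### The estimator of the boundary condition -/

variable {n G Nh : ℕ} {Ω : Set (E (n + 1))} {T : Mesh Ω} {X : CrossSections (n + 1) G}

/-- On F, the trace and the normal trace are those of the polynomial representatives in K. -/
lemma exists_bdResidual_isPF {k mφ : ℕ} (hΩ : IsLipschitzDomain Ω) {K : Fin T.card}
    {F : (T.elt K).FacetIdx} (hF : T.IsBoundaryFacet K F)
    {p : Idx G Nh → FluxField (n + 1)} (hpQ : ∀ a, MemQ Ω (p a))
    (hp : ∀ a, (T.elt K).MemRTN k (p a).val)
    {φ : Idx G Nh → ScalarField (n + 1)} (hφ : ∀ a, MemH1 Ω (φ a))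
    (hφp : ∀ a, (T.elt K).IsPoly mφ (φ a).val) :
    ∃ g : Idx G Nh → E (n + 1) → ℝ, (∀ a, IsPF (mφ + (n + 1) * (k + 1)) (g a)) ∧
      ∀ᵐ x ∂((surf Ω).restrict ((T.elt K).facet F)), ∀ a, bdResidual p φ x a = g a x := by
  choose P hP hpP using fun a => (hp a).exists_isPFVec
  choose v hv hφv using fun a => (hφp a).exists_isPF
  refine ⟨fun a x => (∑ b, matH G Nh a b * v b x) -
    ∑ b, matGammaT G Nh a b * inner ℝ ((T.elt K).frame.nrm F) (P b x), fun a => ?_, ?_⟩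
  · refine IsPF.sub ?_ ?_
    · exact IsPF.sum fun b _ => ((hv b).mono (by omega)).const_mul _
    · exact IsPF.sum fun b _ => (((hP b).inner_const _).mono (by omega)).const_mul _
  · have h1 := fun b => (hφ b).tr_ae_eq hΩ (hv b).contDiff (hφv b) hF
    have h2 := fun b => (hpQ b).ntr_ae_eq hΩ (hP b).contDiff (hpP b) hF
    filter_upwards [ae_all_iff.2 h1, ae_all_iff.2 h2] with x k1 k2 a
    simp only [bdResidual, k1, k2]

/-- The Cauchy-Schwarz inequality for families of vector fields. -/
lemma abs_integral_sum_inner_le {α ι : Type*} [MeasurableSpace α] {μ : Measure α} [Fintype ι]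
    {d : ℕ} {r q : ι → α → E d} (hr : ∀ a, MemLp (r a) 2 μ) (hq : ∀ a, MemLp (q a) 2 μ) :
    |∫ x, ∑ a, inner ℝ (r a x) (q a x) ∂μ| ≤
      Real.sqrt (∫ x, ∑ a, ‖r a x‖ ^ 2 ∂μ) * Real.sqrt (∫ x, ∑ a, ‖q a x‖ ^ 2 ∂μ) := by
  have hr0 : 0 ≤ ∫ x, ∑ a, ‖r a x‖ ^ 2 ∂μ :=
    integral_nonneg fun x => Finset.sum_nonneg fun a _ => sq_nonneg _
  have i1 : Integrable (fun x => ∑ a, ‖r a x‖ ^ 2) μ :=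
    integrable_finsetSum _ fun a _ => by
      simpa only [real_inner_self_eq_norm_sq] using integrable_inner (hr a) (hr a)
  have i2 : Integrable (fun x => ∑ a, ‖q a x‖ ^ 2) μ :=
    integrable_finsetSum _ fun a _ => by
      simpa only [real_inner_self_eq_norm_sq] using integrable_inner (hq a) (hq a)
  have i3 : Integrable (fun x => ∑ a, inner ℝ (r a x) (q a x)) μ :=
    integrable_finsetSum _ fun a _ => integrable_inner (hr a) (hq a)
  rw [← Real.sqrt_mul hr0]
  refine Real.abs_le_sqrt ?_
  -- The quadratic t ↦ ∫ Σ |t r + q|² is nonnegative, so its discriminant is not positive.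
  have h := discrim_le_zero (a := ∫ x, ∑ a, ‖r a x‖ ^ 2 ∂μ)
    (b := 2 * ∫ x, ∑ a, inner ℝ (r a x) (q a x) ∂μ) (c := ∫ x, ∑ a, ‖q a x‖ ^ 2 ∂μ) fun t => by
      have e : (∫ x, ∑ a, ‖r a x‖ ^ 2 ∂μ) * (t * t) +
          2 * (∫ x, ∑ a, inner ℝ (r a x) (q a x) ∂μ) * t + ∫ x, ∑ a, ‖q a x‖ ^ 2 ∂μ =
          ∫ x, ((t * t) * (∑ a, ‖r a x‖ ^ 2) + (2 * t) * (∑ a, inner ℝ (r a x) (q a x)) +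
            ∑ a, ‖q a x‖ ^ 2) ∂μ := by
        have i4 : Integrable (fun x => (t * t) * (∑ a, ‖r a x‖ ^ 2) +
            (2 * t) * (∑ a, inner ℝ (r a x) (q a x))) μ := (i1.const_mul _).add (i3.const_mul _)
        rw [integral_add i4 i2,
          integral_add (i1.const_mul _) (i3.const_mul _), integral_const_mul, integral_const_mul]
        ring
      rw [e]
      refine integral_nonneg fun x => ?_
      simp only [Finset.mul_sum, ← Finset.sum_add_distrib]
      refine Finset.sum_nonneg fun a _ => ?_
      have := norm_add_sq_real (t • r a x) (q a x)
      rw [norm_smul, mul_pow, Real.norm_eq_abs, sq_abs, real_inner_smul_left] at this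
      nlinarith [sq_nonneg ‖t • r a x + q a x‖]
  rw [discrim] at h
  linarith

-- With b the boundary residual, W = Γ̃_e⁻¹ b is extended off the facet and multiplied by χ ν. The
-- boundary term then dominates J = ‖b‖²_F, the volume term is handled by Cauchy-Schwarz and the
-- bound on the flux residual, and both right-hand contributions carry the factor √(δ h_K J) |ζ -
-- ζ̃_h|_{+,K}.
open Classical in
lemma exists_etaBC_bound (n k mo mφ : ℕ) {κ : ℝ} (hκ : 0 < κ) (Nh : ℕ) : ∃ C : ℝ, 0 < C ∧
    ∀ {G : ℕ} [Nonempty (Idx G Nh)] {Ω : Set (E (n + 1))} (_ : IsLipschitzDomain Ω)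
      {T : Mesh Ω} {X : CrossSections (n + 1) G} (_ : X.Admissible Nh Ω) {me : ℕ}
      (_ : ∀ K a b, (T.elt K).IsPoly mo (fun x => X.To Nh x a b))
      (_ : ∀ K a b, (T.elt K).IsPoly me (fun x => X.Te Nh x a b))
      {S : Idx G Nh → E (n + 1) → ℝ} (_ : ∀ a, MemLp (S a) 2 (volume.restrict Ω))
      {z zh : State (n + 1) G Nh} {φ : Idx G Nh → ScalarField (n + 1)}
      (_ : IsSolution X Ω S z) (_ : ∀ a, MemQ Ω (zh.flux a)) (_ : ∀ a, MemH1 Ω (φ a))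
      {K : Fin T.card} (_ : ∀ a, (T.elt K).MemRTN k (zh.flux a).val)
      (_ : ∀ a, (T.elt K).IsPoly mφ (φ a).val) (_ : κ ≤ (T.elt K).shapeReg)
      {N : ℝ} (_ : 0 ≤ N)
      (_ : localNorm X T K (z - reconstruct zh φ) ≤ ENNReal.ofReal N)
      {F : (T.elt K).FacetIdx} (_ : T.IsBoundaryFacet K F),
      etaBC X Ω (T.elt K) F zh.flux φ ≤ C * N := by
  obtain ⟨C, hC, hbub⟩ := exists_facet_bubble n (mφ + (n + 1) * (k + 1)) hκ
  obtain ⟨CF, hCF, hresF⟩ := exists_etaF_bound n k mo mφ hκ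
  obtain ⟨l, M, hl, hM, hΓ⟩ := exists_gammaT_bounds Nh
  -- The first summand bounds the norm of the test flux: 2C for its L² and divergence parts, 1 for
  -- the facet part, and M for Γ̃_e⁻¹. The second comes from the pairing with the flux residual.
  set D : ℝ := Real.sqrt (M * (2 * C + 1)) + CF * Real.sqrt (C * M) with hD
  have hD0 : 0 < D := by positivity
  refine ⟨Real.sqrt M * (C / l * D) / Real.sqrt (κ / 2 ^ n), by positivity, ?_⟩
  intro G _ Ω hΩ T X hX me hTo hTe S hS z zh φ hz hzh hφ K hp hφp hK N hN hloc F hF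
  have hKm := (T.elt K).isCompact_carrier.measurableSet
  have hKb := (T.elt K).isCompact_carrier.isBounded
  have hres := (hresF hΩ hX hTo hTe hS hz hzh hφ hp hφp hK hN hloc).1
  obtain ⟨hmin, hdiag⟩ := delta_bounds_O T hΩ hX K
  have hmm := deltaMinO_le_deltaMaxO (T := T) hΩ hX K
  set δ := X.deltaMaxO Nh (T.elt K) with hδ
  have hδ0 : 0 < δ := hmin.trans_le hmm
  set f := (T.elt K).frame with hf
  set h := (T.elt K).diam with hh
  have hd : 0 < h := f.diam_pos F
  obtain ⟨B, hB⟩ := exists_basis_head (f.norm_nrm F)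
  obtain ⟨χ, hχ, hχc, hχs, h01, hest⟩ := hbub (T.elt K) hK F B hB
    ((surf Ω).restrict ((T.elt K).facet F)) (Mesh.surf_restrict_facet hF hB (f.fctr_eq F))
  set σ := (surf Ω).restrict ((T.elt K).facet F) with hσ
  have hfin := T.isFiniteMeasure_surf hΩ
  have hfm := (Mesh.isCompact_facet f F).measurableSet
  obtain ⟨g, hg, hgres⟩ := exists_bdResidual_isPF hΩ hF hzh hp hφ hφp
  -- With this choice both the pairing b·W and the boundary energy Γ̃_e W·W equal the quadratic form
  -- of Γ̃_e⁻¹ at b.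
  set W : Idx G Nh → E (n + 1) → ℝ := fun a x => ((matGammaT G Nh)⁻¹ *ᵥ fun b => g b x) a with hW
  have hWp : ∀ a, IsPF (mφ + (n + 1) * (k + 1)) (W a) := fun a =>
    IsPF.sum fun b _ => (hg b).const_mul _
  have hWest := fun a => (hest (W a) (hWp a)).2
  choose Y hYc hYW hYq hYd using hWest
  have iσ : ∀ u : E (n + 1) → ℝ, Continuous u → Integrable u σ := fun u hu =>
    ((T.memLp_surf hΩ hu).integrable (by simp)).restrict
  set V : Idx G Nh → E (n + 1) → E (n + 1) := fun a x => χ x • (Y a x • f.nrm F) with hV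
  have hVc : ∀ a, ContDiff ℝ ∞ (V a) := fun a => hχ.smul ((hYc a).smul contDiff_const)
  have hsub : ∀ a, tsupport (V a) ⊆ tsupport χ := fun a => tsupport_smul_subset_left χ _
  have hVK : ∀ a, ∀ x ∈ tsupport (V a), inner ℝ (f.nrm F) x ≤ f.off F →
      x ∈ (T.elt K).carrier := fun a x hx hle =>
    f.mem_carrier_of_relint hle (hχs x (hsub a hx))
  have hfacet : ∀ x ∈ tsupport χ, inner ℝ (f.nrm F) x = f.off F → x ∈ (T.elt K).facet F :=
    fun x hx hc => (f.mem_facet F x).2 ⟨f.mem_carrier_of_relint hc.le (hχs x hx), hc⟩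
  set w : State (n + 1) G Nh := ⟨fun a => halfField (V a) (f.nrm F) (f.off F), 0⟩ with hw
  have hwQ : ∀ a, MemQ Ω (w.flux a) := fun a =>
    memQ_halfField (T := T) (K := K) hΩ (hVc a) hχc.smul_right (f.norm_nrm F)
      (hVK a) fun x hx hc => hF (hfacet x (hsub a hx) hc)
  have hwX : MemX Ω w := ⟨hwQ, fun a => MemLp.zero⟩
  have w1 : ∀ a, ∀ x ∉ (T.elt K).carrier, (w.flux a).val x = 0 := fun a x hx =>
    (halfField_eq_zero (hVK a) hx).1
  have w2 : ∀ a, ∀ x ∉ (T.elt K).carrier, (w.flux a).dv x = 0 := fun a x hx =>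
    (halfField_eq_zero (hVK a) hx).2
  have w4 : ∀ a, ∀ x ∈ (T.elt K).carrier, (w.flux a).val x = V a x := fun a x hx => by
    simp only [hw, halfField]
    rw [indicator_of_mem (by exact (f.mem_carrier x).1 hx F)]
  have w5 : ∀ a, ∀ x ∈ (T.elt K).carrier, (w.flux a).dv x = dvg (V a) x := fun a x hx => by
    simp only [hw, halfField]
    rw [indicator_of_mem (by exact (f.mem_carrier x).1 hx F)]
  have w3 : ∀ a, ∀ x ∈ (T.elt K).facet F, (w.flux a).ntr x = χ x * W a x := fun a x hx => by
    have hc := ((f.mem_facet F x).1 hx).2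
    simp only [hw, halfField]
    rw [indicator_of_mem (by exact hc), hV]
    simp only [inner_smul_right]
    rw [real_inner_self_eq_norm_sq, f.norm_nrm, hYW a x hc]
    ring
  have w6 : ∀ a x, (w.flux a).ntr x ≠ 0 → x ∈ tsupport χ ∧ inner ℝ (f.nrm F) x = f.off F := by
    intro a x hx
    by_cases hc : inner ℝ (f.nrm F) x = f.off F
    · refine ⟨?_, hc⟩
      by_contra hs
      apply hx
      have hz : χ x = 0 := image_eq_zero_of_notMem_tsupport hs
      simp only [hw, halfField]
      rw [indicator_of_mem (by exact hc), hV]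
      simp [hz]
    · exfalso
      apply hx
      simp only [hw, halfField]
      rw [indicator_of_notMem (by exact hc)]
  have hwK : MemXK T K w := by
    refine ⟨hwX, fun a => ae_of_all _ fun x _ => rfl, fun a => ae_of_all _ fun x hx => ?_⟩
    exact w1 a x fun h => hx (mem_biUnion (T.self_mem_nbhd K) h)
  -- integrals on the facet
  set J : ℝ := ∫ x, ∑ a, g a x ^ 2 ∂σ with hJ
  have hgc : ∀ a, Continuous (g a) := fun a => (hg a).continuous
  have hWc : ∀ a, Continuous (W a) := fun a => (hWp a).continuous
  have iJ : Integrable (fun x => ∑ a, g a x ^ 2) σ := iσ _ (by fun_prop)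
  have hJ0 : 0 ≤ J := integral_nonneg fun x => Finset.sum_nonneg fun a _ => sq_nonneg _
  have hsq : ∀ y : Idx G Nh → ℝ, y ⬝ᵥ y = ∑ a, y a ^ 2 := fun y =>
    Finset.sum_congr rfl fun a _ => (sq (y a)).symm
  have hWJ : ∑ a, ∫ x, W a x ^ 2 ∂σ ≤ M * J := by
    have iW : ∀ a, Integrable (fun x => W a x ^ 2) σ := fun a => iσ _ ((hWc a).pow 2)
    rw [← integral_finsetSum _ fun a _ => iW a, hJ, ← integral_const_mul]
    refine integral_mono (iσ _ (by fun_prop)) (iJ.const_mul M) fun x => ?_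
    have := (hΓ G fun b => g b x).2.2.1
    rwa [hsq, hsq] at this
  have hvol : ∀ a x, ‖V a x‖ ^ 2 = (χ x * Y a x) ^ 2 := fun a x => by
    rw [hV]
    simp only [norm_smul, f.norm_nrm, Real.norm_eq_abs, mul_one]
    rw [← abs_mul, sq_abs]
  have iV : ∀ a, IntegrableOn (fun x => ‖V a x‖ ^ 2) (T.elt K).carrier := fun a =>
    integrableOn_of_continuous ((hVc a).continuous.norm.pow 2) hKb
  have iD : ∀ a, IntegrableOn (fun x => dvg (V a) x ^ 2) (T.elt K).carrier :=
    fun a => integrableOn_of_continuous ((continuous_dvg ((hVc a).of_le (by simp))).pow 2) hKb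
  have iQ : IntegrableOn (fun x => ∑ a, ‖V a x‖ ^ 2) (T.elt K).carrier :=
    integrable_finsetSum _ fun a _ => iV a
  have hQ : ∫ x in (T.elt K).carrier, ∑ a, ‖V a x‖ ^ 2 ≤ C * h * (M * J) := by
    rw [integral_finsetSum _ fun a _ => iV a]
    refine le_trans ?_ (mul_le_mul_of_nonneg_left hWJ (by positivity))
    rw [Finset.mul_sum]
    refine Finset.sum_le_sum fun a _ => ?_
    simp only [hvol]
    exact hYq a
  have hJle : Real.sqrt J ≤ C / l * D * Real.sqrt (δ * h) * N := by
    refine le_of_sq_le_sqrt_mul hJ0 (by positivity) hN fun hJpos => ?_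
    have hnorm : normS X T w ≤ Real.sqrt (M * (2 * C + 1) * (δ * h * J)) := by
      refine normS_sq_le hΩ (K := K) (fun a => rfl) w1 w2 (Real.sqrt_nonneg _) ?_
      rw [Real.sq_sqrt (by positivity)]
      have t1 : ∫ x in (T.elt K).carrier, ∑ a, X.To Nh x a a * ‖(w.flux a).val x‖ ^ 2 ≤
          δ * (C * h * (M * J)) := by
        refine le_trans ?_ (mul_le_mul_of_nonneg_left hQ hδ0.le)
        rw [← integral_const_mul]
        refine integral_mono_of_nonneg ?_ (iQ.const_mul δ) ?_
        · filter_upwards [hdiag] with x hx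
          exact Finset.sum_nonneg fun a _ => mul_nonneg (hmin.le.trans (hx a).1) (sq_nonneg _)
        · filter_upwards [hdiag, ae_restrict_mem hKm] with x hx hxK
          simp only [Finset.mul_sum]
          refine Finset.sum_le_sum fun a _ => ?_
          rw [w4 a x hxK]
          exact mul_le_mul_of_nonneg_right (hx a).2 (sq_nonneg _)
      have t2 : δ * h ^ 2 * ∫ x in (T.elt K).carrier, ∑ a, (w.flux a).dv x ^ 2 ≤
          δ * (C * h * (M * J)) := by
        have e : ∫ x in (T.elt K).carrier, ∑ a, (w.flux a).dv x ^ 2 =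
            ∑ a, ∫ x in (T.elt K).carrier, dvg (V a) x ^ 2 := by
          rw [← integral_finsetSum _ fun a _ => iD a]
          refine setIntegral_congr_fun hKm fun x hx => ?_
          exact Finset.sum_congr rfl fun a _ => by rw [w5 a x hx]
        rw [e, mul_assoc]
        refine mul_le_mul_of_nonneg_left ?_ hδ0.le
        refine le_trans ?_ (mul_le_mul_of_nonneg_left hWJ (by positivity))
        rw [Finset.mul_sum, Finset.mul_sum]
        exact Finset.sum_le_sum fun a _ => hYd a
      have t3 : (∑ K', ∑ F' : (T.elt K').FacetIdx,
          if T.IsBoundaryFacet K' F' then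
            X.deltaMaxO Nh (T.elt K') * (T.elt K').altitude F' *
              ∫ x in (T.elt K').facet F', (∑ a, (∑ b, matGammaT G Nh a b * (w.flux b).ntr x) *
                (w.flux a).ntr x) ∂(surf Ω)
          else 0) ≤ δ * h * (M * J) := by
        have hz : ∀ (K' : Fin T.card) (F' : (T.elt K').FacetIdx),
            (∀ x ∈ (T.elt K').facet F', ∀ a, (w.flux a).ntr x = 0) →
            (if T.IsBoundaryFacet K' F' then
            X.deltaMaxO Nh (T.elt K') * (T.elt K').altitude F' *
              ∫ x in (T.elt K').facet F', (∑ a, (∑ b, matGammaT G Nh a b * (w.flux b).ntr x) *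
                (w.flux a).ntr x) ∂(surf Ω)
            else 0) = 0 := by
          intro K' F' hx
          split_ifs
          · rw [setIntegral_eq_zero_of_forall_eq_zero, mul_zero]
            intro x hxF
            simp [hx x hxF]
          · rfl
        -- The normal trace is carried by the relative interior of F, which meets neither another
        -- element nor another facet of K.
        rw [Finset.sum_eq_single K]
        rotate_left
        · intro K' _ hKK
          refine Finset.sum_eq_zero fun F' _ => hz K' F' fun x hx a => ?_
          by_contra hne
          obtain ⟨hs, hc⟩ := w6 a x hne
          exact T.notMem_of_relint hΩ hKK f hF hc (hχs x hs)
            (((T.elt K').frame.mem_facet F' x).1 hx).1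
        · simp
        rw [Finset.sum_eq_single F]
        rotate_left
        · intro F' _ hFF
          refine hz K F' fun x hx a => ?_
          by_contra hne
          obtain ⟨hs, hc⟩ := w6 a x hne
          exact (hχs x hs F' hFF).ne ((f.mem_facet F' x).1 hx).2
        · simp
        rw [if_pos hF]
        have hle : ∫ x in (T.elt K).facet F, (∑ a, (∑ b, matGammaT G Nh a b * (w.flux b).ntr x) *
            (w.flux a).ntr x) ∂(surf Ω) ≤ M * J := by
          have e : ∫ x in (T.elt K).facet F, (∑ a, (∑ b, matGammaT G Nh a b * (w.flux b).ntr x) *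
            (w.flux a).ntr x) ∂(surf Ω) = ∫ x, χ x ^ 2 * ∑ a, g a x * W a x ∂σ := by
            refine setIntegral_congr_fun hfm fun x hx => ?_
            have hΓW : ∀ a, ∑ b, matGammaT G Nh a b * W b x = g a x := fun a =>
              congrFun (hΓ G fun b => g b x).2.2.2 a
            have e2 : ∀ a, ∑ b, matGammaT G Nh a b * (w.flux b).ntr x = χ x * g a x := fun a => by
              rw [← hΓW, Finset.mul_sum]
              exact Finset.sum_congr rfl fun b _ => by rw [w3 b x hx]; ring
            simp only [e2, Finset.mul_sum]
            exact Finset.sum_congr rfl fun a _ => by rw [w3 a x hx]; ring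
          rw [e, hJ, ← integral_const_mul]
          refine integral_mono (iσ _ (by have := hχ.continuous; fun_prop)) (iJ.const_mul M)
            fun x => ?_
          obtain ⟨b1, b2, -⟩ := hΓ G fun b => g b x
          have e3 : ∑ a, g a x * W a x =
              ((matGammaT G Nh)⁻¹ *ᵥ fun b => g b x) ⬝ᵥ fun b => g b x :=
            Finset.sum_congr rfl fun a _ => mul_comm _ _
          rw [← hsq fun a => g a x]
          simp only [e3]
          have b3 : 0 ≤ (fun b => g b x) ⬝ᵥ fun b => g b x := by
            rw [hsq]; exact Finset.sum_nonneg fun a _ => sq_nonneg _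
          refine le_trans (mul_le_of_le_one_left ((mul_nonneg hl.le b3).trans b1)
            (pow_le_one₀ (h01 x).1 (h01 x).2)) b2
        refine mul_le_mul ?_ hle ?_ (by positivity)
        · exact mul_le_mul_of_nonneg_left ((T.elt K).altitude_le_diam F) hδ0.le
        · refine setIntegral_nonneg hfm fun x hx => ?_
          have hΓW : ∀ a, ∑ b, matGammaT G Nh a b * W b x = g a x := fun a =>
            congrFun (hΓ G fun b => g b x).2.2.2 a
          have e2 : ∀ a, ∑ b, matGammaT G Nh a b * (w.flux b).ntr x = χ x * g a x := fun a => by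
            rw [← hΓW, Finset.mul_sum]
            exact Finset.sum_congr rfl fun b _ => by rw [w3 b x hx]; ring
          have e4 : ∑ a, (∑ b, matGammaT G Nh a b * (w.flux b).ntr x) * (w.flux a).ntr x =
              χ x ^ 2 * (((matGammaT G Nh)⁻¹ *ᵥ fun b => g b x) ⬝ᵥ fun b => g b x) := by
            rw [dotProduct, Finset.mul_sum]
            exact Finset.sum_congr rfl fun a _ => by rw [e2, w3 a x hx]; ring
          rw [e4]
          have b3 : 0 ≤ (fun b => g b x) ⬝ᵥ fun b => g b x := by
            rw [hsq]; exact Finset.sum_nonneg fun a _ => sq_nonneg _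
          exact mul_nonneg (sq_nonneg _)
            ((mul_nonneg hl.le b3).trans (hΓ G fun b => g b x).1)
      linarith
    have key := formD_le_of_localNorm hwK (Real.sqrt_pos.2 (by positivity)) hnorm hN hloc
    rw [formD_error hTo hTe hS hz hzh hφ hwX] at key
    have k1 : ∀ a x, w.scal a x = 0 := fun _ _ => rfl
    simp only [k1, mul_zero, Finset.sum_const_zero, integral_zero, zero_sub] at key
    have k2 : |∫ x in Ω, ∑ a, inner ℝ (resF X zh.flux φ a x) ((w.flux a).val x)| ≤
        CF * Real.sqrt δ * N * Real.sqrt (C * h * (M * J)) := by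
      have e : ∫ x in Ω, ∑ a, inner ℝ (resF X zh.flux φ a x) ((w.flux a).val x) =
          ∫ x in (T.elt K).carrier, ∑ a, inner ℝ (resF X zh.flux φ a x) (V a x) := by
        rw [setIntegral_domain_eq hΩ.isOpen.measurableSet (T.carrier_ae_subset hΩ K)]
        · refine setIntegral_congr_fun hKm fun x hx => ?_
          exact Finset.sum_congr rfl fun a _ => by rw [w4 a x hx]
        · intro x _ hx
          simp [w1 _ x hx]
      rw [e]
      refine (abs_integral_sum_inner_le
        (fun a => (memLp_resF hTo hzh hφ a).mono_measure (T.restrict_carrier_le hΩ K))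
        fun a => ((hVc a).continuous.memLp_of_hasCompactSupport hχc.smul_right).restrict _).trans ?_
      exact mul_le_mul hres (Real.sqrt_le_sqrt hQ) (Real.sqrt_nonneg _) (by positivity)
    have k3 : l / C * J ≤
        ∫ x, ∑ a, bdResidual zh.flux φ x a * (w.flux a).ntr x ∂(surf Ω) := by
      rw [surf_integral_eq_facet hF]
      rotate_left
      · intro x _ hx
        refine Finset.sum_eq_zero fun a _ => ?_
        have : (w.flux a).ntr x = 0 := by
          by_contra hne
          obtain ⟨hs, hc⟩ := w6 a x hne
          exact hx (hfacet x hs hc)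
        rw [this, mul_zero]
      have e : ∫ x in (T.elt K).facet F, ∑ a, bdResidual zh.flux φ x a * (w.flux a).ntr x
          ∂(surf Ω) = ∫ x, χ x * ∑ a, g a x * W a x ∂σ := by
        refine integral_congr_ae ?_
        filter_upwards [hgres, ae_restrict_mem hfm] with x hx hxF
        rw [Finset.mul_sum]
        exact Finset.sum_congr rfl fun a _ => by rw [hx a, w3 a x hxF]; ring
      rw [e]
      have hχcont := hχ.continuous
      have i1 : ∀ a, Integrable (fun x => χ x * g a x ^ 2) σ := fun a => iσ _ (by fun_prop)
      have e1 : J ≤ C * ∫ x, χ x * ∑ a, g a x ^ 2 ∂σ := by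
        simp only [Finset.mul_sum]
        have ig : ∀ a, Integrable (fun x => g a x ^ 2) σ := fun a => iσ _ ((hgc a).pow 2)
        rw [hJ, integral_finsetSum _ fun a _ => ig a,
          integral_finsetSum _ fun a _ => i1 a, Finset.mul_sum]
        exact Finset.sum_le_sum fun a _ => (hest (g a) (hg a)).1
      have e2 : l * ∫ x, χ x * ∑ a, g a x ^ 2 ∂σ ≤ ∫ x, χ x * ∑ a, g a x * W a x ∂σ := by
        rw [← integral_const_mul]
        refine integral_mono (iσ _ (by fun_prop)) (iσ _ (by fun_prop)) fun x => ?_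
        have b1 := (hΓ G fun b => g b x).1
        have e3 : ∑ a, g a x * W a x =
            ((matGammaT G Nh)⁻¹ *ᵥ fun b => g b x) ⬝ᵥ fun b => g b x :=
          Finset.sum_congr rfl fun a _ => mul_comm _ _
        rw [hsq] at b1
        simp only [e3]
        rw [mul_left_comm]
        exact mul_le_mul_of_nonneg_left b1 (h01 x).1
      refine le_trans ?_ e2
      rw [div_mul_eq_mul_div, div_le_iff₀ hC, mul_assoc, mul_comm _ C]
      exact mul_le_mul_of_nonneg_left e1 hl.le
    have k4 := (abs_le.1 k2).2
    have s1 : Real.sqrt (M * (2 * C + 1) * (δ * h * J)) =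
        Real.sqrt (M * (2 * C + 1)) * Real.sqrt (δ * h * J) := Real.sqrt_mul (by positivity) _
    have s2 : Real.sqrt δ * Real.sqrt (C * h * (M * J)) =
        Real.sqrt (C * M) * Real.sqrt (δ * h * J) := by
      rw [← Real.sqrt_mul hδ0.le, ← Real.sqrt_mul (by positivity)]
      congr 1
      ring
    have k5 : l / C * J ≤ D * (Real.sqrt (δ * h * J) * N) := by
      have e : CF * Real.sqrt δ * N * Real.sqrt (C * h * (M * J)) =
          CF * Real.sqrt (C * M) * (Real.sqrt (δ * h * J) * N) := by
        linear_combination CF * N * s2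
      rw [s1] at key
      rw [e] at k4
      rw [hD, add_mul]
      linarith
    rw [div_mul_eq_mul_div, div_le_iff₀ hC] at k5
    rw [div_mul_eq_mul_div, div_mul_eq_mul_div, le_div_iff₀ hl]
    linarith
  -- conclusion
  have halt : κ / 2 ^ n * h ≤ (T.elt K).altitude F := (f.le_ht hK F).trans (f.ht_le F)
  have hint : ∫ x in (T.elt K).facet F,
      (((matGammaT G Nh)⁻¹ *ᵥ bdResidual zh.flux φ x) ⬝ᵥ bdResidual zh.flux φ x) ∂(surf Ω) ≤
      M * J := by
    rw [hJ, ← integral_const_mul]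
    refine integral_mono_of_nonneg (ae_of_all _ fun x => ?_) (iJ.const_mul M) ?_
    · have b3 : 0 ≤ bdResidual zh.flux φ x ⬝ᵥ bdResidual zh.flux φ x := by
        rw [hsq]; exact Finset.sum_nonneg fun a _ => sq_nonneg _
      exact (mul_nonneg hl.le b3).trans (hΓ G _).1
    · filter_upwards [hgres] with x hx
      have e : bdResidual zh.flux φ x = fun b => g b x := funext hx
      rw [e, ← hsq fun b => g b x]
      exact (hΓ G _).2.1
  have hκ2 : 0 < κ / 2 ^ n := by positivity
  -- The estimator is scaled by the altitude and the test flux by h_K; shape regularity makes the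
  -- two comparable.
  have h1 : Real.sqrt (κ / 2 ^ n) * Real.sqrt (δ * h) ≤
      Real.sqrt (δ * (T.elt K).altitude F) := by
    rw [← Real.sqrt_mul hκ2.le]
    refine Real.sqrt_le_sqrt ?_
    rw [mul_left_comm]
    exact mul_le_mul_of_nonneg_left halt hδ0.le
  have h2 : 0 < Real.sqrt (δ * h) := Real.sqrt_pos.2 (by positivity)
  have h3 : 0 < Real.sqrt (κ / 2 ^ n) := Real.sqrt_pos.2 hκ2
  have h4 : 0 < Real.sqrt (δ * (T.elt K).altitude F) := (mul_pos h3 h2).trans_le h1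
  have h5 : Real.sqrt (∫ x in (T.elt K).facet F,
      (((matGammaT G Nh)⁻¹ *ᵥ bdResidual zh.flux φ x) ⬝ᵥ bdResidual zh.flux φ x) ∂(surf Ω)) ≤
      Real.sqrt M * (C / l * D * Real.sqrt (δ * h) * N) := by
    refine (Real.sqrt_le_sqrt hint).trans ?_
    rw [Real.sqrt_mul hM.le]
    gcongr
  change (Real.sqrt (δ * (T.elt K).altitude F))⁻¹ * _ ≤ _
  rw [inv_mul_le_iff₀ h4]
  refine h5.trans ?_
  calc Real.sqrt M * (C / l * D * Real.sqrt (δ * h) * N)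
      = (Real.sqrt (κ / 2 ^ n) * Real.sqrt (δ * h)) *
        (Real.sqrt M * (C / l * D) / Real.sqrt (κ / 2 ^ n) * N) := by
        field_simp
    _ ≤ _ := by gcongr

end

/-! ### Passage to extended nonnegative values, and the theorem -/

section

/-- An infinite local norm makes the bound trivial, because c > 0; a finite one is itself an
admissible N. -/
lemma ofReal_le_mul_of_forall {x c : ℝ} {L : ℝ≥0∞} (hc : 0 < c)
    (h : ∀ N : ℝ, 0 ≤ N → L ≤ ENNReal.ofReal N → x ≤ c * N) :
    ENNReal.ofReal x ≤ ENNReal.ofReal c * L := by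
  by_cases hL : L = ⊤
  · rw [hL, ENNReal.mul_top (by simpa using hc)]
    exact le_top
  · have h1 := h L.toReal ENNReal.toReal_nonneg (ENNReal.ofReal_toReal hL).ge
    calc ENNReal.ofReal x ≤ ENNReal.ofReal (c * L.toReal) := ENNReal.ofReal_le_ofReal h1
      _ = ENNReal.ofReal c * L := by rw [ENNReal.ofReal_mul hc.le, ENNReal.ofReal_toReal hL]

end

end SPN

end

theorem mainTheorem2 (d : ℕ) (hd : d = 2 ∨ d = 3) (k mo me mφ : ℕ) (κ : ℝ) (hκ : 0 < κ) :
    ∃ (c C : ℝ) (Cbc : ℕ → ℝ), 0 < c ∧ 0 < C ∧ (∀ Nh, 0 < Cbc Nh) ∧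
      ∀ (G Nh : ℕ), 1 ≤ G → 1 ≤ Nh →
      ∀ (Ω : Set (SPN.E d)), SPN.IsLipschitzDomain Ω →
      ∀ (T : SPN.Mesh Ω) (X : SPN.CrossSections d G), X.Admissible Nh Ω →
      ∀ (S : SPN.Idx G Nh → SPN.E d → ℝ) (z zh : SPN.State d G Nh)
        (φ : SPN.Idx G Nh → SPN.ScalarField d),
        SPN.IsSolution X Ω S z →
        SPN.IsDiscreteSolution X T k S zh →
        (∀ a, SPN.MemH1 Ω (φ a)) →
        (∀ K a b, (T.elt K).IsPoly mo (fun x => X.To Nh x a b)) →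
        (∀ K a b, (T.elt K).IsPoly me (fun x => X.Te Nh x a b)) →
        (∀ a, SPN.MemLh T k (S a)) →
        (∀ K a, (T.elt K).IsPoly mφ (φ a).val) →
        ∀ K : Fin T.card, κ ≤ (T.elt K).shapeReg →
          ENNReal.ofReal (SPN.etaR X S (T.elt K) zh.flux φ) ≤
              ENNReal.ofReal
                (c * Real.sqrt (X.deltaMaxE Nh (T.elt K) / X.deltaMinE Nh (T.elt K))) *
                SPN.localNorm X T K (z - SPN.reconstruct zh φ) ∧
          ENNReal.ofReal (SPN.etaF X (T.elt K) zh.flux φ) ≤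
              ENNReal.ofReal
                (C * Real.sqrt (X.deltaMaxO Nh (T.elt K) / X.deltaMinO Nh (T.elt K))) *
                SPN.localNorm X T K (z - SPN.reconstruct zh φ) ∧
          ∀ F : (T.elt K).FacetIdx, T.IsBoundaryFacet K F →
            ENNReal.ofReal (SPN.etaBC X Ω (T.elt K) F zh.flux φ) ≤
              ENNReal.ofReal (Cbc Nh) *
                SPN.localNorm X T K (z - SPN.reconstruct zh φ) := by
  -- Writing d = n + 1 gives facets the dimension n without subtraction.
  obtain ⟨n, rfl⟩ : ∃ n, d = n + 1 := ⟨d - 1, by omega⟩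
  obtain ⟨C, hC, hF⟩ := SPN.exists_etaF_bound n k mo mφ hκ
  choose Cbc hCbc hBC using SPN.exists_etaBC_bound n k mo mφ hκ
  -- The constant 1 suffices for the first estimator, because `etaR_le` has no constant and the
  -- ratio of the extreme values of δ_e is at least 1.
  refine ⟨1, C, Cbc, one_pos, hC, hCbc, ?_⟩
  intro G Nh hG hNh Ω hΩ T X hX S z zh φ hz hzh hφ hTo hTe hS hφp K hK
  have hne : Nonempty (SPN.Idx G Nh) := ⟨(⟨0, hG⟩, ⟨0, hNh⟩)⟩
  have hS2 := fun a => (hS a).1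
  have hzQ := fun a => (hzh.1.1 a).1
  have hzR := fun a => (hzh.1.1 a).2 K
  have hE0 := (SPN.delta_bounds_E T hΩ hX K).1
  have hE := SPN.deltaMinE_le_deltaMaxE (T := T) hΩ hX K
  have hO0 := (SPN.delta_bounds_O T hΩ hX K).1
  have hO := SPN.deltaMinO_le_deltaMaxO (T := T) hΩ hX K
  have hE1 : 1 ≤ Real.sqrt (X.deltaMaxE Nh (T.elt K) / X.deltaMinE Nh (T.elt K)) :=
    Real.one_le_sqrt.2 ((one_le_div hE0).2 hE)
  refine ⟨SPN.ofReal_le_mul_of_forall (by linarith) fun N hN h => ?_,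
    SPN.ofReal_le_mul_of_forall ?_ fun N hN h => ?_, fun F hFb =>
    SPN.ofReal_le_mul_of_forall (hCbc Nh) fun N hN h => ?_⟩
  · refine (SPN.etaR_le hΩ hX hTo hTe hS2 hz hzQ hφ hN h).trans ?_
    rw [one_mul]
    exact le_mul_of_one_le_left hN hE1
  · exact mul_pos hC (Real.sqrt_pos.2 (div_pos (hO0.trans_le hO) hO0))
  · exact (hF hΩ hX hTo hTe hS2 hz hzQ hφ hzR (hφp K) hK hN h).2
  · exact hBC Nh hΩ hX hTo hTe hS2 hz hzQ hφ hzR (hφp K) hK hN h hFb
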